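/- All Hilbert spaces are complex. The weak* topology on $B(H;K)$ is the $\sigma$-weak topology, and $\langle\,\cdot\,\rangle$ denotes the norm-closed linear span. A W*-TRO is a subspace $X\subseteq B(H;K)$ that is closed in norm and in the weak* topology and satisfies $xy^*z\in X$ for all $x,y,z\in X$. A normal TRO morphism between W*-TROs is a weak*-continuous linear map $\alpha:X\to Y$ with $\alpha(xy^*z)=\alpha(x)\alpha(y)^*\alpha(z)$. The linking C*-algebra of $X$ is $$A_X=\begin{pmatrix}\langle XX^*\rangle & X\\ X^* & \langle X^*X\rangle\end{pmatrix}\subseteq B(K\oplus H),$$ and the linking von Neumann algebra of $X$ is $R_X=A_X''$, where, if $A_X$ acts degenerately on $K\oplus H$, the double commutant is taken on the closed span $[A_X(K\oplus H)]$ and extended by $0$ on its orthogonal complement. The morphism $\alpha$ is called non-degenerate if the linear spans of $\alpha(X)Y^*Y$ and $\alpha(X)^*YY^*$ are weak*-dense in $Y$ and $Y^*$, respectively. A *-homomorphism $\beta:R_X\to R_Y$ is unital if it maps the unit of $R_X$ to the unit of $R_Y$. **Proposition.** Let $X\subseteq B(H_1;K_1)$ and $Y\subseteq B(H_2;K_2)$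 be W*-TROs and let $\alpha:X\to Y$ be a normal TRO morphism. Then there is a unique normal (i.e. weak*-continuous) *-homomorphism $\beta:R_X\to R_Y$ such that $$\beta\begin{pmatrix}0&x\\0&0\end{pmatrix}=\begin{pmatrix}0&\alpha(x)\\0&0\end{pmatrix}\qquad(x\in X).$$ Moreover: 1. there is a unique *-homomorphism $\gamma:A_X\to A_Y$ with $\gamma\begin{pmatrix}0&x\\0&0\end{pmatrix}=\begin{pmatrix}0&\alpha(x)\\0&0\end{pmatrix}$ for all $x\in X$ (the Hamana extension of $\alpha$), and $\beta|_{A_X}=\gamma$; 2. the construction preserves composition: if $\alpha':Y\to Z$ is another normal TRO morphism between W*-TROs, with extension $\beta':R_Y\to R_Z$, then $\beta'\circ\beta$ is the unique normal *-homomorphism $R_X\to R_Z$ extending $\alpha'\circ\alpha$ in the above sense; 3. $\alpha$ is injective if and only if $\beta$ is injective; 4. $\alpha$ is non-degenerate if and only if $\beta$ is unital. -/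

import Mathlib

open ContinuousLinearMap Topology

set_option linter.unusedSectionVars false

noncomputable section

section Topology

variable {H K : Type*}
  [NormedAddCommGroup H] [InnerProductSpace ℂ H] [CompleteSpace H]
  [NormedAddCommGroup K] [InnerProductSpace ℂ K] [CompleteSpace K]

/-- The functional `T ↦ ∑ₙ ⟨kₙ, T hₙ⟩` on `B(H;K)` given by two square-summable sequences of
vectors. These are exactly the functionals in the predual of `B(H;K)` (the trace class). -/
def normalFunctional (h : lp (fun _ : ℕ => H) 2) (k : lp (fun _ : ℕ => K) 2)
    (T : H →L[ℂ] K) : ℂ :=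
  ∑' n, inner ℂ (k n) (T (h n))

variable (H K) in
/-- The weak* (σ-weak, ultraweak) topology of `B(H;K)`: the coarsest topology that makes all
functionals `T ↦ ∑ₙ ⟨kₙ, T hₙ⟩` continuous. -/
def weakStarTopology : TopologicalSpace (H →L[ℂ] K) :=
  ⨅ (h : lp (fun _ : ℕ => H) 2) (k : lp (fun _ : ℕ => K) 2),
    TopologicalSpace.induced (normalFunctional h k) inferInstance

/-- The relative weak* topology on a set of operators. -/
def relWeakStar (S : Set (H →L[ℂ] K)) : TopologicalSpace S :=
  TopologicalSpace.induced Subtype.val (weakStarTopology H K)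

end Topology

/-- A (concrete) ternary ring of operators: a norm closed subspace of `B(H;K)` that is closed
under the ternary product `(x, y, z) ↦ x y* z`. -/
structure TRO (H K : Type*)
    [NormedAddCommGroup H] [InnerProductSpace ℂ H] [CompleteSpace H]
    [NormedAddCommGroup K] [InnerProductSpace ℂ K] [CompleteSpace K]
    extends Submodule ℂ (H →L[ℂ] K) where
  isClosed' : IsClosed carrier
  ternary_mem' : ∀ {x y z : H →L[ℂ] K}, x ∈ carrier → y ∈ carrier → z ∈ carrier →
    x ∘L adjoint y ∘L z ∈ carrier

/-- A W*-TRO: a TRO that is weak*-closed in `B(H;K)`. -/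
structure WStarTRO (H K : Type*)
    [NormedAddCommGroup H] [InnerProductSpace ℂ H] [CompleteSpace H]
    [NormedAddCommGroup K] [InnerProductSpace ℂ K] [CompleteSpace K]
    extends TRO H K where
  isWeakStarClosed' : IsClosed[weakStarTopology H K] carrier

namespace TRO

variable {H K : Type*}
  [NormedAddCommGroup H] [InnerProductSpace ℂ H] [CompleteSpace H]
  [NormedAddCommGroup K] [InnerProductSpace ℂ K] [CompleteSpace K]

/-- The ternary product of `X` as an operation on `X`. -/
def ternary (X : TRO H K) (x y z : X.toSubmodule) : X.toSubmodule :=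
  ⟨x.1 ∘L adjoint y.1 ∘L z.1, X.ternary_mem' x.2 y.2 z.2⟩

/-- `⟨X X*⟩`, the closed linear span of the operators `x y*` with `x, y ∈ X`. -/
def leftSpan (X : TRO H K) : Submodule ℂ (K →L[ℂ] K) :=
  (Submodule.span ℂ
    {T | ∃ x ∈ X.toSubmodule, ∃ y ∈ X.toSubmodule, x ∘L adjoint y = T}).topologicalClosure

/-- `⟨X* X⟩`, the closed linear span of the operators `x* y` with `x, y ∈ X`. -/
def rightSpan (X : TRO H K) : Submodule ℂ (H →L[ℂ] H) :=
  (Submodule.span ℂ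
    {T | ∃ x ∈ X.toSubmodule, ∃ y ∈ X.toSubmodule, adjoint x ∘L y = T}).topologicalClosure

section Spans

variable {X : TRO H K}

theorem leftSpan_induction {P : (K →L[ℂ] K) → Prop} (closed : IsClosed {a | P a})
    (zero : P 0) (add : ∀ a b, P a → P b → P (a + b)) (smul : ∀ (c : ℂ) a, P a → P (c • a))
    (gen : ∀ x ∈ X.toSubmodule, ∀ y ∈ X.toSubmodule, P (x ∘L adjoint y))
    {a : K →L[ℂ] K} (ha : a ∈ X.leftSpan) : P a := by
  refine closed.closure_subset_iff.2 (fun T hT => ?_) ha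
  refine Submodule.span_induction (p := fun T _ => P T) ?_ zero
    (fun a b _ _ => add a b) (fun c a _ => smul c a) hT
  rintro _ ⟨x, hx, y, hy, rfl⟩
  exact gen x hx y hy

theorem rightSpan_induction {P : (H →L[ℂ] H) → Prop} (closed : IsClosed {a | P a})
    (zero : P 0) (add : ∀ a b, P a → P b → P (a + b)) (smul : ∀ (c : ℂ) a, P a → P (c • a))
    (gen : ∀ x ∈ X.toSubmodule, ∀ y ∈ X.toSubmodule, P (adjoint x ∘L y))
    {a : H →L[ℂ] H} (ha : a ∈ X.rightSpan) : P a := by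
  refine closed.closure_subset_iff.2 (fun T hT => ?_) ha
  refine Submodule.span_induction (p := fun T _ => P T) ?_ zero
    (fun a b _ _ => add a b) (fun c a _ => smul c a) hT
  rintro _ ⟨x, hx, y, hy, rfl⟩
  exact gen x hx y hy

theorem comp_adjoint_mem_leftSpan {x y : H →L[ℂ] K} (hx : x ∈ X.toSubmodule)
    (hy : y ∈ X.toSubmodule) : x ∘L adjoint y ∈ X.leftSpan :=
  Submodule.le_topologicalClosure _ (Submodule.subset_span ⟨x, hx, y, hy, rfl⟩)

theorem adjoint_comp_mem_rightSpan {x y : H →L[ℂ] K} (hx : x ∈ X.toSubmodule)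
    (hy : y ∈ X.toSubmodule) : adjoint x ∘L y ∈ X.rightSpan :=
  Submodule.le_topologicalClosure _ (Submodule.subset_span ⟨x, hx, y, hy, rfl⟩)

theorem leftSpan_isClosed : IsClosed (X.leftSpan : Set (K →L[ℂ] K)) :=
  Submodule.isClosed_topologicalClosure _

theorem rightSpan_isClosed : IsClosed (X.rightSpan : Set (H →L[ℂ] H)) :=
  Submodule.isClosed_topologicalClosure _

theorem leftSpan_comp_mem {a : K →L[ℂ] K} {x : H →L[ℂ] K} (ha : a ∈ X.leftSpan)
    (hx : x ∈ X.toSubmodule) : a ∘L x ∈ X.toSubmodule := by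
  refine leftSpan_induction (P := fun a => a ∘L x ∈ X.toSubmodule) ?_ ?_ ?_ ?_ ?_ ha
  · exact X.isClosed'.preimage (by fun_prop : Continuous fun a : K →L[ℂ] K => a ∘L x)
  · simp
  · intro a b h g; rw [add_comp]; exact add_mem h g
  · intro c a h; rw [smul_comp]; exact Submodule.smul_mem _ _ h
  · intro y hy z hz; exact X.ternary_mem' hy hz hx

theorem comp_rightSpan_mem {b : H →L[ℂ] H} {x : H →L[ℂ] K} (hb : b ∈ X.rightSpan)
    (hx : x ∈ X.toSubmodule) : x ∘L b ∈ X.toSubmodule := by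
  refine rightSpan_induction (P := fun b => x ∘L b ∈ X.toSubmodule) ?_ ?_ ?_ ?_ ?_ hb
  · exact X.isClosed'.preimage (by fun_prop : Continuous fun b : H →L[ℂ] H => x ∘L b)
  · simp
  · intro a b h g; rw [comp_add]; exact add_mem h g
  · intro c a h; rw [comp_smul]; exact Submodule.smul_mem _ _ h
  · intro y hy z hz; exact X.ternary_mem' hx hy hz

theorem leftSpan_mul {a b : K →L[ℂ] K} (ha : a ∈ X.leftSpan) (hb : b ∈ X.leftSpan) :
    a ∘L b ∈ X.leftSpan := by
  refine leftSpan_induction (P := fun b => a ∘L b ∈ X.leftSpan) ?_ ?_ ?_ ?_ ?_ hb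
  · exact leftSpan_isClosed.preimage (by fun_prop : Continuous fun b : K →L[ℂ] K => a ∘L b)
  · simp
  · intro b c h g; rw [comp_add]; exact add_mem h g
  · intro c b h; rw [comp_smul]; exact Submodule.smul_mem _ _ h
  · intro y hy z hz; exact comp_adjoint_mem_leftSpan (leftSpan_comp_mem ha hy) hz

theorem rightSpan_mul {a b : H →L[ℂ] H} (ha : a ∈ X.rightSpan) (hb : b ∈ X.rightSpan) :
    a ∘L b ∈ X.rightSpan := by
  refine rightSpan_induction (P := fun a => a ∘L b ∈ X.rightSpan) ?_ ?_ ?_ ?_ ?_ ha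
  · exact rightSpan_isClosed.preimage (by fun_prop : Continuous fun a : H →L[ℂ] H => a ∘L b)
  · simp
  · intro a c h g; rw [add_comp]; exact add_mem h g
  · intro c a h; rw [smul_comp]; exact Submodule.smul_mem _ _ h
  · intro y hy z hz
    rw [comp_assoc]
    exact adjoint_comp_mem_rightSpan hy (comp_rightSpan_mem hb hz)

theorem leftSpan_adjoint {a : K →L[ℂ] K} (ha : a ∈ X.leftSpan) : adjoint a ∈ X.leftSpan := by
  refine leftSpan_induction (P := fun a => adjoint a ∈ X.leftSpan) ?_ ?_ ?_ ?_ ?_ ha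
  · exact leftSpan_isClosed.preimage
      (adjoint : (K →L[ℂ] K) ≃ₗᵢ⋆[ℂ] (K →L[ℂ] K)).continuous
  · simp
  · intro b c h g; rw [map_add]; exact add_mem h g
  · intro c b h; rw [map_smulₛₗ]; exact Submodule.smul_mem _ _ h
  · intro y hy z hz
    rw [adjoint_comp, adjoint_adjoint]
    exact comp_adjoint_mem_leftSpan hz hy

theorem rightSpan_adjoint {a : H →L[ℂ] H} (ha : a ∈ X.rightSpan) : adjoint a ∈ X.rightSpan := by
  refine rightSpan_induction (P := fun a => adjoint a ∈ X.rightSpan) ?_ ?_ ?_ ?_ ?_ ha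
  · exact rightSpan_isClosed.preimage
      (adjoint : (H →L[ℂ] H) ≃ₗᵢ⋆[ℂ] (H →L[ℂ] H)).continuous
  · simp
  · intro b c h g; rw [map_add]; exact add_mem h g
  · intro c b h; rw [map_smulₛₗ]; exact Submodule.smul_mem _ _ h
  · intro y hy z hz
    rw [adjoint_comp, adjoint_adjoint]
    exact adjoint_comp_mem_rightSpan hz hy

end Spans

end TRO

section Blocks

variable {H K : Type*}
  [NormedAddCommGroup H] [InnerProductSpace ℂ H] [CompleteSpace H]
  [NormedAddCommGroup K] [InnerProductSpace ℂ K] [CompleteSpace K]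

variable (H K) in
/-- The Hilbert space direct sum `K ⊕ H`. -/
def DirSum := WithLp 2 (K × H)

instance : NormedAddCommGroup (DirSum H K) :=
  inferInstanceAs (NormedAddCommGroup (WithLp 2 (K × H)))

instance : InnerProductSpace ℂ (DirSum H K) :=
  inferInstanceAs (InnerProductSpace ℂ (WithLp 2 (K × H)))

instance : CompleteSpace (DirSum H K) :=
  inferInstanceAs (CompleteSpace (WithLp 2 (K × H)))

variable (H K) in
/-- The inclusion of `K` into `K ⊕ H`. -/
def inK : K →L[ℂ] DirSum H K :=
  (WithLp.prodContinuousLinearEquiv 2 ℂ K H).symm.toContinuousLinearMap ∘L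
    ContinuousLinearMap.inl ℂ K H

variable (H K) in
/-- The inclusion of `H` into `K ⊕ H`. -/
def inH : H →L[ℂ] DirSum H K :=
  (WithLp.prodContinuousLinearEquiv 2 ℂ K H).symm.toContinuousLinearMap ∘L
    ContinuousLinearMap.inr ℂ K H

variable (H K) in
/-- The coordinate map of `K ⊕ H` onto `K`. -/
def prK : DirSum H K →L[ℂ] K := WithLp.fstL 2 ℂ K H

variable (H K) in
/-- The coordinate map of `K ⊕ H` onto `H`. -/
def prH : DirSum H K →L[ℂ] H := WithLp.sndL 2 ℂ K H

/-- A matrix entry of an operator on `K ⊕ H`. -/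
def entry11 (T : DirSum H K →L[ℂ] DirSum H K) : K →L[ℂ] K := prK H K ∘L T ∘L inK H K

/-- A matrix entry of an operator on `K ⊕ H`. -/
def entry12 (T : DirSum H K →L[ℂ] DirSum H K) : H →L[ℂ] K := prK H K ∘L T ∘L inH H K

/-- A matrix entry of an operator on `K ⊕ H`. -/
def entry21 (T : DirSum H K →L[ℂ] DirSum H K) : K →L[ℂ] H := prH H K ∘L T ∘L inK H K

/-- A matrix entry of an operator on `K ⊕ H`. -/
def entry22 (T : DirSum H K →L[ℂ] DirSum H K) : H →L[ℂ] H := prH H K ∘L T ∘L inH H K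

/-- The operator on `K ⊕ H` with matrix `(0 x; 0 0)`. -/
def corner (x : H →L[ℂ] K) : DirSum H K →L[ℂ] DirSum H K := inK H K ∘L x ∘L prH H K

theorem prK_inK (k : K) : prK H K (inK H K k) = k := rfl
theorem prK_inH (h : H) : prK H K (inH H K h) = 0 := rfl
theorem prH_inK (k : K) : prH H K (inK H K k) = 0 := rfl
theorem prH_inH (h : H) : prH H K (inH H K h) = h := rfl

theorem in_pr (v : DirSum H K) : inK H K (prK H K v) + inH H K (prH H K v) = v := by
  apply WithLp.ofLp_injective 2
  change ((WithLp.fst v : K), (0 : H)) + ((0 : K), (WithLp.snd v : H)) = _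
  ext
  · exact add_zero _
  · exact zero_add _

theorem inner_dirSum (v w : DirSum H K) : inner ℂ v w =
    inner ℂ (prK H K v) (prK H K w) + inner ℂ (prH H K v) (prH H K w) := rfl

theorem adjoint_inK : adjoint (inK H K) = prK H K := by
  symm
  rw [eq_adjoint_iff]
  intro v k
  rw [inner_dirSum, prK_inK, prH_inK, inner_zero_right, add_zero]

theorem adjoint_inH : adjoint (inH H K) = prH H K := by
  symm
  rw [eq_adjoint_iff]
  intro v h
  rw [inner_dirSum, prK_inH, prH_inH, inner_zero_right, zero_add]

theorem adjoint_prK : adjoint (prK H K) = inK H K := by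
  rw [← adjoint_inK, adjoint_adjoint]

theorem adjoint_prH : adjoint (prH H K) = inH H K := by
  rw [← adjoint_inH, adjoint_adjoint]

section EntryLemmas

variable (S T : DirSum H K →L[ℂ] DirSum H K)

theorem entry11_mul :
    entry11 (S * T) = entry11 S ∘L entry11 T + entry12 S ∘L entry21 T := by
  ext v
  change prK H K (S (T (inK H K v))) = _
  conv_lhs => rw [← in_pr (T (inK H K v)), map_add, map_add]
  rfl

theorem entry12_mul :
    entry12 (S * T) = entry11 S ∘L entry12 T + entry12 S ∘L entry22 T := by
  ext v
  change prK H K (S (T (inH H K v))) = _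
  conv_lhs => rw [← in_pr (T (inH H K v)), map_add, map_add]
  rfl

theorem entry21_mul :
    entry21 (S * T) = entry21 S ∘L entry11 T + entry22 S ∘L entry21 T := by
  ext v
  change prH H K (S (T (inK H K v))) = _
  conv_lhs => rw [← in_pr (T (inK H K v)), map_add, map_add]
  rfl

theorem entry22_mul :
    entry22 (S * T) = entry21 S ∘L entry12 T + entry22 S ∘L entry22 T := by
  ext v
  change prH H K (S (T (inH H K v))) = _
  conv_lhs => rw [← in_pr (T (inH H K v)), map_add, map_add]
  rfl

theorem entry11_star : entry11 (star T) = adjoint (entry11 T) := by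
  simp only [entry11, star_eq_adjoint, adjoint_comp, adjoint_inK, adjoint_prK, comp_assoc]

theorem entry12_star : entry12 (star T) = adjoint (entry21 T) := by
  simp only [entry12, entry21, star_eq_adjoint, adjoint_comp, adjoint_inK, adjoint_prH, comp_assoc]

theorem entry21_star : entry21 (star T) = adjoint (entry12 T) := by
  simp only [entry12, entry21, star_eq_adjoint, adjoint_comp, adjoint_inH, adjoint_prK, comp_assoc]

theorem entry22_star : entry22 (star T) = adjoint (entry22 T) := by
  simp only [entry22, star_eq_adjoint, adjoint_comp, adjoint_inH, adjoint_prH, comp_assoc]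

theorem entry11_add : entry11 (S + T) = entry11 S + entry11 T := by ext; simp [entry11]
theorem entry12_add : entry12 (S + T) = entry12 S + entry12 T := by ext; simp [entry12]
theorem entry21_add : entry21 (S + T) = entry21 S + entry21 T := by ext; simp [entry21]
theorem entry22_add : entry22 (S + T) = entry22 S + entry22 T := by ext; simp [entry22]
theorem entry11_smul (c : ℂ) : entry11 (c • T) = c • entry11 T := by ext; simp [entry11]
theorem entry12_smul (c : ℂ) : entry12 (c • T) = c • entry12 T := by ext; simp [entry12]
theorem entry21_smul (c : ℂ) : entry21 (c • T) = c • entry21 T := by ext; simp [entry21]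
theorem entry22_smul (c : ℂ) : entry22 (c • T) = c • entry22 T := by ext; simp [entry22]
theorem entry11_zero : entry11 (0 : DirSum H K →L[ℂ] DirSum H K) = 0 := by ext; simp [entry11]
theorem entry12_zero : entry12 (0 : DirSum H K →L[ℂ] DirSum H K) = 0 := by ext; simp [entry12]
theorem entry21_zero : entry21 (0 : DirSum H K →L[ℂ] DirSum H K) = 0 := by ext; simp [entry21]
theorem entry22_zero : entry22 (0 : DirSum H K →L[ℂ] DirSum H K) = 0 := by ext; simp [entry22]

variable (x : H →L[ℂ] K)

theorem entry11_corner : entry11 (corner x) = 0 := by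
  ext k; simp [entry11, corner, prH_inK]
theorem entry12_corner : entry12 (corner x) = x := by
  ext h; simp [entry12, corner, prH_inH, prK_inK]
theorem entry21_corner : entry21 (corner x) = 0 := by
  ext k; simp [entry21, corner, prH_inK]
theorem entry22_corner : entry22 (corner x) = 0 := by
  ext h; simp [entry22, corner, prH_inK]

end EntryLemmas

end Blocks

section VonNeumann

variable {E : Type*} [NormedAddCommGroup E] [InnerProductSpace ℂ E] [CompleteSpace E]

/-- The common kernel of a set of operators. -/
def commonKer (A : Set (E →L[ℂ] E)) : Submodule ℂ E := ⨅ a ∈ A, LinearMap.ker (a : E →ₗ[ℂ] E)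

theorem mem_commonKer {A : Set (E →L[ℂ] E)} {v : E} :
    v ∈ commonKer A ↔ ∀ a ∈ A, a v = 0 := by
  simp [commonKer]

instance (A : Set (E →L[ℂ] E)) : (commonKer A).HasOrthogonalProjection := by
  have h : IsClosed (commonKer A : Set E) := by
    have : (commonKer A : Set E) = ⋂ a ∈ A, {v | a v = 0} := by
      ext v; simp [mem_commonKer]
    rw [this]
    exact isClosed_biInter fun a _ => isClosed_eq a.continuous continuous_const
  have : CompleteSpace (commonKer A) := h.completeSpace_coe
  infer_instance

/-- The projection onto the common kernel of a *-algebra lies in its commutant. -/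
theorem starProjection_commonKer_mem (A : NonUnitalStarSubalgebra ℂ (E →L[ℂ] E)) :
    (commonKer (A : Set (E →L[ℂ] E))).starProjection ∈
      Set.centralizer (A : Set (E →L[ℂ] E)) := by
  have h : ∀ a ∈ A, a * (commonKer (A : Set (E →L[ℂ] E))).starProjection = 0 := by
    intro a ha
    ext v
    exact mem_commonKer.1 ((commonKer (A : Set (E →L[ℂ] E))).starProjection_apply_mem v) a ha
  rw [Set.mem_centralizer_iff]
  intro a ha
  have h2 := congrArg star (h (star a) (star_mem ha))
  rw [star_mul, star_star, star_zero,
    (isSelfAdjoint_starProjection (commonKer (A : Set (E →L[ℂ] E)))).star_eq] at h2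
  rw [h a ha, h2]

/-- The von Neumann algebra generated by a *-algebra `A` of operators on `E`: the double commutant
`A''`, formed on the essential space `[A E]` of `A` and extended by zero, i.e. those operators in
`A''` that vanish on the common kernel `E ⊖ [A E]` of `A`. If `A` acts non-degenerately, the second
condition is void and this is `A''`. -/
def doubleCommutant (A : NonUnitalStarSubalgebra ℂ (E →L[ℂ] E)) :
    NonUnitalStarSubalgebra ℂ (E →L[ℂ] E) where
  carrier := {T | T ∈ Set.centralizer (Set.centralizer (A : Set (E →L[ℂ] E))) ∧
    ∀ v ∈ commonKer (A : Set (E →L[ℂ] E)), T v = 0}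
  add_mem' := by
    rintro S T ⟨hS, hS'⟩ ⟨hT, hT'⟩
    exact ⟨Set.add_mem_centralizer hS hT, fun v hv => by simp [hS' v hv, hT' v hv]⟩
  zero_mem' := ⟨Set.zero_mem_centralizer, fun v _ => by simp⟩
  mul_mem' := by
    rintro S T ⟨hS, hS'⟩ ⟨hT, hT'⟩
    exact ⟨Set.mul_mem_centralizer hS hT, fun v hv => by simp [hT' v hv]⟩
  smul_mem' := by
    rintro c T ⟨hT, hT'⟩
    refine ⟨?_, fun v hv => by simp [hT' v hv]⟩
    rw [Set.mem_centralizer_iff] at hT ⊢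
    intro m hm
    rw [mul_smul_comm, smul_mul_assoc, hT m hm]
  star_mem' := by
    rintro T ⟨hT, hT'⟩
    set P := (commonKer (A : Set (E →L[ℂ] E))).starProjection with hP
    have hPT : P * T = T * P := hT P (starProjection_commonKer_mem A)
    have hTP : T * P = 0 := by
      ext v
      exact hT' _ (Submodule.starProjection_apply_mem _ v)
    constructor
    · refine Set.star_mem_centralizer' (fun a ha => ?_) hT
      refine Set.star_mem_centralizer' (fun a ha => star_mem ha) ha
    · intro v hv
      have h0 : star T * P = 0 := by
        have := congrArg star (hPT.trans hTP)
        rwa [star_mul, star_zero, hP, (isSelfAdjoint_starProjection _).star_eq] at this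
      have hv' : P v = v := Submodule.starProjection_eq_self_iff.2 hv
      have := congrArg (fun S : E →L[ℂ] E => S v) h0
      simpa [hv'] using this

theorem doubleCommutant_eq_of_commonKer_eq_bot (A : NonUnitalStarSubalgebra ℂ (E →L[ℂ] E))
    (hA : commonKer (A : Set (E →L[ℂ] E)) = ⊥) :
    (doubleCommutant A : Set (E →L[ℂ] E)) =
      Set.centralizer (Set.centralizer (A : Set (E →L[ℂ] E))) := by
  ext T
  refine ⟨fun h => h.1, fun h => ⟨h, fun v hv => ?_⟩⟩
  rw [hA, Submodule.mem_bot] at hv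
  rw [hv, map_zero]

theorem le_doubleCommutant (A : NonUnitalStarSubalgebra ℂ (E →L[ℂ] E)) :
    A ≤ doubleCommutant A := fun _ ha =>
  ⟨Set.subset_centralizer_centralizer ha, fun _ hv => mem_commonKer.1 hv _ ha⟩

end VonNeumann

namespace TRO

variable {H K : Type*}
  [NormedAddCommGroup H] [InnerProductSpace ℂ H] [CompleteSpace H]
  [NormedAddCommGroup K] [InnerProductSpace ℂ K] [CompleteSpace K]

/-- The linking C*-algebra `A_X` of a TRO `X`: the operators on `K ⊕ H` with matrix in
`(⟨X X*⟩ X; X* ⟨X* X⟩)`. -/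
def linkingAlgebra (X : TRO H K) :
    NonUnitalStarSubalgebra ℂ (DirSum H K →L[ℂ] DirSum H K) where
  carrier := {T | entry11 T ∈ X.leftSpan ∧ entry12 T ∈ X.toSubmodule ∧
    adjoint (entry21 T) ∈ X.toSubmodule ∧ entry22 T ∈ X.rightSpan}
  add_mem' := by
    rintro S T ⟨h1, h2, h3, h4⟩ ⟨g1, g2, g3, g4⟩
    refine ⟨?_, ?_, ?_, ?_⟩
    · rw [entry11_add]; exact add_mem h1 g1
    · rw [entry12_add]; exact add_mem h2 g2
    · rw [entry21_add, map_add]; exact add_mem h3 g3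
    · rw [entry22_add]; exact add_mem h4 g4
  zero_mem' := by
    refine ⟨?_, ?_, ?_, ?_⟩
    · rw [entry11_zero]; exact zero_mem _
    · rw [entry12_zero]; exact zero_mem _
    · rw [entry21_zero, map_zero]; exact zero_mem _
    · rw [entry22_zero]; exact zero_mem _
  mul_mem' := by
    rintro S T ⟨h1, h2, h3, h4⟩ ⟨g1, g2, g3, g4⟩
    refine ⟨?_, ?_, ?_, ?_⟩
    · rw [entry11_mul]
      refine add_mem (leftSpan_mul h1 g1) ?_
      simpa using comp_adjoint_mem_leftSpan h2 g3
    · rw [entry12_mul]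
      exact add_mem (leftSpan_comp_mem h1 g2) (comp_rightSpan_mem g4 h2)
    · rw [entry21_mul, map_add, adjoint_comp, adjoint_comp]
      exact add_mem (leftSpan_comp_mem (leftSpan_adjoint g1) h3)
        (comp_rightSpan_mem (rightSpan_adjoint h4) g3)
    · rw [entry22_mul]
      refine add_mem ?_ (rightSpan_mul h4 g4)
      simpa using adjoint_comp_mem_rightSpan h3 g2
  smul_mem' := by
    rintro c T ⟨h1, h2, h3, h4⟩
    refine ⟨?_, ?_, ?_, ?_⟩
    · rw [entry11_smul]; exact Submodule.smul_mem _ _ h1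
    · rw [entry12_smul]; exact Submodule.smul_mem _ _ h2
    · rw [entry21_smul, map_smulₛₗ]; exact Submodule.smul_mem _ _ h3
    · rw [entry22_smul]; exact Submodule.smul_mem _ _ h4
  star_mem' := by
    rintro T ⟨h1, h2, h3, h4⟩
    refine ⟨?_, ?_, ?_, ?_⟩
    · rw [entry11_star]; exact leftSpan_adjoint h1
    · rw [entry12_star]; exact h3
    · rw [entry21_star, adjoint_adjoint]; exact h2
    · rw [entry22_star]; exact rightSpan_adjoint h4

/-- The copy `(0 x; 0 0)` of `x ∈ X` in the linking algebra `A_X`. -/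
def toLinkingAlgebra (X : TRO H K) (x : X.toSubmodule) : X.linkingAlgebra :=
  ⟨corner x.1, by
    refine ⟨?_, ?_, ?_, ?_⟩
    · rw [entry11_corner]; exact zero_mem _
    · rw [entry12_corner]; exact x.2
    · rw [entry21_corner, map_zero]; exact zero_mem _
    · rw [entry22_corner]; exact zero_mem _⟩

end TRO

namespace WStarTRO

variable {H K : Type*}
  [NormedAddCommGroup H] [InnerProductSpace ℂ H] [CompleteSpace H]
  [NormedAddCommGroup K] [InnerProductSpace ℂ K] [CompleteSpace K]

/-- The linking von Neumann algebra `R_X = A_X''` of a W*-TRO `X`. -/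
def linkingVN (X : WStarTRO H K) :
    NonUnitalStarSubalgebra ℂ (DirSum H K →L[ℂ] DirSum H K) :=
  doubleCommutant X.linkingAlgebra

/-- The inclusion of `A_X` into `R_X`. -/
def linkingInclusion (X : WStarTRO H K) : X.linkingAlgebra →⋆ₙₐ[ℂ] X.linkingVN :=
  NonUnitalStarSubalgebra.inclusion (le_doubleCommutant X.linkingAlgebra)

/-- The copy `(0 x; 0 0)` of `x ∈ X` in `R_X`. -/
def toLinkingVN (X : WStarTRO H K) (x : X.toSubmodule) : X.linkingVN :=
  X.linkingInclusion (X.toLinkingAlgebra x)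

end WStarTRO

section Morphisms

variable {H₁ K₁ H₂ K₂ : Type*}
  [NormedAddCommGroup H₁] [InnerProductSpace ℂ H₁] [CompleteSpace H₁]
  [NormedAddCommGroup K₁] [InnerProductSpace ℂ K₁] [CompleteSpace K₁]
  [NormedAddCommGroup H₂] [InnerProductSpace ℂ H₂] [CompleteSpace H₂]
  [NormedAddCommGroup K₂] [InnerProductSpace ℂ K₂] [CompleteSpace K₂]
  {X : WStarTRO H₁ K₁} {Y : WStarTRO H₂ K₂}

/-- A normal TRO morphism: a linear map that preserves the ternary product and is
weak*-continuous. -/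
structure IsNormalTROMorphism (α : X.toSubmodule →ₗ[ℂ] Y.toSubmodule) : Prop where
  map_ternary : ∀ x y z : X.toSubmodule,
    α (X.ternary x y z) = Y.ternary (α x) (α y) (α z)
  normal : Continuous[relWeakStar (X.toSubmodule : Set (H₁ →L[ℂ] K₁)),
    relWeakStar (Y.toSubmodule : Set (H₂ →L[ℂ] K₂))] α

/-- A TRO morphism `α : X → Y` between W*-TROs is non-degenerate if the linear spans of
`α(X) Y* Y` and `α(X)* Y Y*` are weak*-dense in `Y` and in `Y*`. -/
def IsNondegenerate (α : X.toSubmodule →ₗ[ℂ] Y.toSubmodule) : Prop :=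
  closure[weakStarTopology H₂ K₂] (Submodule.span ℂ
      {T : H₂ →L[ℂ] K₂ | ∃ x : X.toSubmodule, ∃ y z : Y.toSubmodule,
        T = (α x).1 ∘L adjoint y.1 ∘L z.1} : Set (H₂ →L[ℂ] K₂)) =
    (Y.toSubmodule : Set (H₂ →L[ℂ] K₂)) ∧
  closure[weakStarTopology K₂ H₂] (Submodule.span ℂ
      {T : K₂ →L[ℂ] H₂ | ∃ x : X.toSubmodule, ∃ y z : Y.toSubmodule,
        T = adjoint (α x).1 ∘L y.1 ∘L adjoint z.1} : Set (K₂ →L[ℂ] H₂)) =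
    {T : K₂ →L[ℂ] H₂ | ∃ y : Y.toSubmodule, T = adjoint y.1}

/-- `γ` is a Hamana extension of `α`: a *-homomorphism `A_X → A_Y` that extends `α`. -/
def IsHamanaExtension (α : X.toSubmodule →ₗ[ℂ] Y.toSubmodule)
    (γ : X.linkingAlgebra →⋆ₙₐ[ℂ] Y.linkingAlgebra) : Prop :=
  ∀ x : X.toSubmodule, γ (X.toLinkingAlgebra x) = Y.toLinkingAlgebra (α x)

/-- `β : R_X → R_Y` is a normal (weak*-continuous) *-homomorphism with
`β (0 x; 0 0) = (0 α(x); 0 0)` for `x ∈ X`. -/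
structure IsNormalExtension (α : X.toSubmodule →ₗ[ℂ] Y.toSubmodule)
    (β : X.linkingVN →⋆ₙₐ[ℂ] Y.linkingVN) : Prop where
  normal : Continuous[relWeakStar (X.linkingVN : Set (DirSum H₁ K₁ →L[ℂ] DirSum H₁ K₁)),
    relWeakStar (Y.linkingVN : Set (DirSum H₂ K₂ →L[ℂ] DirSum H₂ K₂))] β
  extends_map : ∀ x : X.toSubmodule, β (X.toLinkingVN x) = Y.toLinkingVN (α x)

/-- `β : R_X → R_Y` is unital: it maps the unit of `R_X` to the unit of `R_Y`. -/
def IsUnitalMap (β : X.linkingVN →⋆ₙₐ[ℂ] Y.linkingVN) : Prop :=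
  ∃ e : X.linkingVN, (∀ a, e * a = a ∧ a * e = a) ∧ ∀ b, β e * b = b ∧ b * β e = b

end Morphisms

end

/-! Put `X` and `X*` together as the off-diagonal operators `(0 x; y* 0)`. They form a self-adjoint
space closed under triple products, and `α` induces a *-preserving ternary map `f = offDiagMap α` on
it. A block operator splits into a diagonal and an off-diagonal part, giving a `ℤ/2`-grading of the
multiplication. Since `X` is weak*-closed, the off-diagonal part of an element of `R_X` lies in this
space, while its diagonal part is only known to multiply the space into itself.

Existence. Multipliers `d` are represented by `π(d) f(x)h = f(dx)h`, and by zero on the complement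
of the vectors `f(x)h`. The map is well defined and bounded because `f(dx)* f(y) = f(x)* f(d* y)`
for every ternary map, together with `‖d‖² - d* d = c* c` in the C*-algebra of multipliers
(`IsTernaryMap.norm_multSum_le`, `IsTernaryMap.exists_leftRep`). Then `β(T) = π(diagonal part) +
f(off-diagonal part)` is a *-homomorphism by the grading, and its values lie in `R_Y` because they
commute with the commutant of `A_Y` and vanish on its common kernel.

Normality. The functionals `T ↦ ⟨v, β(T)v⟩` with `v = f(x)h` are visibly weak*-continuous, as `α`
is. To pass to all normal functionals, call a vector dominated if `‖ρ(a)h‖ ≤ ‖(a ⊗ 1)ξ‖` for some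
`ξ` in `ℓ²(E)`. Dominated vectors yield weak*-continuous functionals by means of an intertwiner, and
they form a closed subspace by a Radon–Nikodym argument (`exists_dominating_norm_le`,
`isClosed_dominatedVectors`). Applied to the amplification of `β`, this gives
`continuous_weakStar_of_vector_functionals`.

Uniqueness and the Hamana extension. The corner generates `A_X` as a C*-algebra, *-homomorphisms are
norm continuous, and `A_X` is weak*-dense in `R_X` by von Neumann's density theorem. Composition
follows from uniqueness.

Injectivity and unitality. Multiplying a kernel element by corners moves it into the corner, where
`β` is `α`; an element of `R_X` killing all corners and their adjoints is zero. The image of the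
unit acts as a unit on `R_Y` exactly when it fixes `Y` and `Y*` from the left, and it is a weak*
limit of operators with diagonal entries in the spans of `α(X)α(X)*` and `α(X)*α(X)`. -/

set_option linter.unusedSectionVars false

noncomputable section

/-! ### Infinite amplifications and square-summable families of vectors. -/

section Amplification

variable {H K L : Type*}
  [NormedAddCommGroup H] [InnerProductSpace ℂ H] [CompleteSpace H]
  [NormedAddCommGroup K] [InnerProductSpace ℂ K] [CompleteSpace K]
  [NormedAddCommGroup L] [InnerProductSpace ℂ L] [CompleteSpace L]

/-- The infinite amplification `T ⊗ 1` of an operator, acting coordinatewise on square-summable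
sequences. -/
def amp (T : H →L[ℂ] K) : lp (fun _ : ℕ => H) 2 →L[ℂ] lp (fun _ : ℕ => K) 2 :=
  lp.mapCLM 2 (fun _ => T) (norm_nonneg T) (fun _ => le_rfl)

@[simp] theorem amp_apply (T : H →L[ℂ] K) (v : lp (fun _ : ℕ => H) 2) (n : ℕ) :
    amp T v n = T (v n) := rfl

theorem amp_add (S T : H →L[ℂ] K) : amp (S + T) = amp S + amp T := by ext; simp

theorem amp_sub (S T : H →L[ℂ] K) : amp (S - T) = amp S - amp T := by ext; simp

theorem amp_smul (c : ℂ) (T : H →L[ℂ] K) : amp (c • T) = c • amp T := by ext; simp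

theorem amp_zero : amp (0 : H →L[ℂ] K) = 0 := by ext; simp

theorem amp_comp (S : K →L[ℂ] L) (T : H →L[ℂ] K) : amp (S ∘L T) = amp S ∘L amp T := by ext; simp

/-- Normal functionals become vector functionals after amplification, so weak* questions turn into
Hilbert space geometry in `ℓ²`. -/
theorem normalFunctional_eq_inner (h : lp (fun _ : ℕ => H) 2) (k : lp (fun _ : ℕ => K) 2)
    (T : H →L[ℂ] K) : normalFunctional h k T = inner ℂ k (amp T h) := by
  rw [lp.inner_eq_tsum]; rfl

theorem amp_adjoint (T : H →L[ℂ] K) : amp (adjoint T) = adjoint (amp T) := by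
  rw [eq_adjoint_iff]
  intro v w
  simp only [lp.inner_eq_tsum, amp_apply, adjoint_inner_left]

variable (H) in
/-- Amplification as a *-homomorphism. -/
def ampHom : (H →L[ℂ] H) →⋆ₙₐ[ℂ]
    (lp (fun _ : ℕ => H) 2 →L[ℂ] lp (fun _ : ℕ => H) 2) where
  toFun := amp
  map_smul' c T := amp_smul c T
  map_zero' := amp_zero
  map_add' := amp_add
  map_mul' := amp_comp
  map_star' := amp_adjoint

@[simp] theorem ampHom_apply (T : H →L[ℂ] H) : ampHom H T = amp T := rfl

theorem normalFunctional_sub (h : lp (fun _ : ℕ => H) 2) (k : lp (fun _ : ℕ => K) 2)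
    (S T : H →L[ℂ] K) :
    normalFunctional h k (S - T) = normalFunctional h k S - normalFunctional h k T := by
  simp [normalFunctional_eq_inner, amp_sub]

theorem hasSum_norm_sq_lp (v : lp (fun _ : ℕ => H) 2) : HasSum (fun n => ‖v n‖ ^ 2) (‖v‖ ^ 2) := by
  simpa using lp.hasSum_norm (p := 2) (by norm_num) v

variable (K) in
/-- A countable square-summable family of vectors in `ℓ²(H)` can be merged into one vector, that
dominates each member of the family under every amplified operator. -/
theorem exists_amp_dominating {ι : Type*} [Countable ι] (v : ι → lp (fun _ : ℕ => H) 2)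
    (hv : Summable fun i => ‖v i‖ ^ 2) :
    ∃ ξ : lp (fun _ : ℕ => H) 2, ∀ (T : H →L[ℂ] K) (i : ι), ‖amp T (v i)‖ ≤ ‖amp T ξ‖ := by
  obtain ⟨j, hj⟩ := Countable.exists_injective_nat (ι × ℕ)
  have hsum : Summable fun p : ι × ℕ => ‖v p.1 p.2‖ ^ 2 := by
    rw [summable_prod_of_nonneg (fun p => by positivity)]
    refine ⟨fun i => (hasSum_norm_sq_lp (v i)).summable, ?_⟩
    simpa only [(hasSum_norm_sq_lp (v _)).tsum_eq] using hv
  -- The injection `j` need not be onto; the default value `0` off its range leaves the square sum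
  -- unchanged.
  let f : ℕ → H := Function.extend j (fun p => v p.1 p.2) 0
  have hf : ∀ p, f (j p) = v p.1 p.2 := fun p => hj.extend_apply _ _ p
  have hf0 : ∀ n, n ∉ Set.range j → ‖f n‖ ^ 2 = 0 := fun n hn => by
    have : f n = 0 := Function.extend_apply' _ _ _ hn
    simp [this]
  have hmem : Memℓp f 2 := by
    refine memℓp_gen ?_
    have : Summable fun n => ‖f n‖ ^ 2 := by
      rw [← hj.summable_iff hf0]
      simpa only [Function.comp_def, hf] using hsum
    simpa using this
  obtain ⟨ξ, hξ⟩ : ∃ ξ : lp (fun _ : ℕ => H) 2, ∀ n, ξ n = f n := ⟨⟨f, hmem⟩, fun _ => rfl⟩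
  refine ⟨ξ, fun T i => le_of_sq_le_sq ?_ (norm_nonneg _)⟩
  have h3 := tsum_comp_le_tsum_of_inj (hasSum_norm_sq_lp (amp T ξ)).summable
    (fun n => by positivity) (i := fun n => j (i, n)) (fun a b hab => by simpa using hj hab)
  rw [← (hasSum_norm_sq_lp (amp T (v i))).tsum_eq, ← (hasSum_norm_sq_lp (amp T ξ)).tsum_eq]
  refine le_trans (le_of_eq (tsum_congr fun n => ?_)) h3
  simp only [Function.comp, amp_apply, hξ, hf]

end Amplification

/-! ### The weak* topology: continuity of algebraic operations, neighbourhoods, functionals. -/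

section WeakStar

variable {H K H' K' Z : Type*}
  [NormedAddCommGroup H] [InnerProductSpace ℂ H] [CompleteSpace H]
  [NormedAddCommGroup K] [InnerProductSpace ℂ K] [CompleteSpace K]
  [NormedAddCommGroup H'] [InnerProductSpace ℂ H'] [CompleteSpace H']
  [NormedAddCommGroup K'] [InnerProductSpace ℂ K'] [CompleteSpace K']

theorem continuous_normalFunctional (h : lp (fun _ : ℕ => H) 2) (k : lp (fun _ : ℕ => K) 2) :
    @Continuous _ _ (weakStarTopology H K) _ (normalFunctional h k) := by
  unfold weakStarTopology
  exact continuous_iInf_dom (i := h) (continuous_iInf_dom (i := k) continuous_induced_dom)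

theorem continuous_weakStar_iff {t : TopologicalSpace Z} {f : Z → H →L[ℂ] K} :
    @Continuous _ _ t (weakStarTopology H K) f ↔
      ∀ h k, Continuous fun z => normalFunctional h k (f z) := by
  unfold weakStarTopology
  simp only [continuous_iInf_rng, continuous_induced_rng]
  rfl

theorem continuous_weakStar_id_norm :
    @Continuous _ _ _ (weakStarTopology H K) (fun T : H →L[ℂ] K => T) := by
  rw [continuous_weakStar_iff]
  intro h k
  let F : (H →L[ℂ] K) →ₗ[ℂ] ℂ :=
    { toFun := fun T => inner ℂ k (amp T h)
      map_add' := fun S T => by simp [amp_add]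
      map_smul' := fun c T => by simp [amp_smul] }
  have hF : Continuous F := by
    refine AddMonoidHomClass.continuous_of_bound F (‖k‖ * ‖h‖) fun T => ?_
    calc ‖F T‖ ≤ ‖k‖ * ‖amp T h‖ := norm_inner_le_norm (𝕜 := ℂ) k (amp T h)
      _ ≤ ‖k‖ * (‖T‖ * ‖h‖) := by
        gcongr
        exact (amp T).le_of_opNorm_le (lp.norm_mapCLM_le 2 _ (norm_nonneg T) _) h
      _ = ‖k‖ * ‖h‖ * ‖T‖ := by ring
  simp only [normalFunctional_eq_inner]
  exact hF

theorem IsClosed.of_weakStar {S : Set (H →L[ℂ] K)} (hS : IsClosed[weakStarTopology H K] S) :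
    IsClosed S :=
  @IsClosed.preimage _ _ _ (weakStarTopology H K) _ continuous_weakStar_id_norm _ hS

theorem continuous_weakStar_add {t : TopologicalSpace Z} {f g : Z → H →L[ℂ] K}
    (hf : @Continuous _ _ t (weakStarTopology H K) f)
    (hg : @Continuous _ _ t (weakStarTopology H K) g) :
    @Continuous _ _ t (weakStarTopology H K) fun z => f z + g z := by
  rw [continuous_weakStar_iff] at *
  intro h k
  simp only [normalFunctional_eq_inner, amp_add, add_apply, inner_add_right] at *
  exact (hf h k).add (hg h k)

theorem continuous_weakStar_comp_comp (A : K →L[ℂ] K') (B : H' →L[ℂ] H) :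
    @Continuous _ _ (weakStarTopology H K) (weakStarTopology H' K')
      fun T : H →L[ℂ] K => A ∘L T ∘L B := by
  rw [@continuous_weakStar_iff]
  intro h k
  simp only [normalFunctional_eq_inner, amp_comp]
  have := continuous_normalFunctional (amp B h) (adjoint (amp A) k)
  refine (@continuous_congr _ _ (weakStarTopology H K) _ _ _ fun T => ?_).1 this
  rw [normalFunctional_eq_inner, adjoint_inner_left]
  rfl

theorem continuous_weakStar_comp_left (A : K →L[ℂ] K') :
    @Continuous _ _ (weakStarTopology H K) (weakStarTopology H K')
      fun T : H →L[ℂ] K => A ∘L T :=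
  continuous_weakStar_comp_comp A (ContinuousLinearMap.id ℂ H)

theorem continuous_weakStar_comp_right (B : H' →L[ℂ] H) :
    @Continuous _ _ (weakStarTopology H K) (weakStarTopology H' K)
      fun T : H →L[ℂ] K => T ∘L B :=
  continuous_weakStar_comp_comp (ContinuousLinearMap.id ℂ K) B

theorem continuous_weakStar_adjoint :
    @Continuous _ _ (weakStarTopology H K) (weakStarTopology K H)
      fun T : H →L[ℂ] K => adjoint T := by
  rw [@continuous_weakStar_iff]
  intro h k
  have := @Continuous.comp _ _ _ (weakStarTopology H K) _ _ _ _ Complex.continuous_conj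
    (continuous_normalFunctional k h)
  refine (@continuous_congr _ _ (weakStarTopology H K) _ _ _ fun T => ?_).1 this
  simp only [Function.comp, normalFunctional_eq_inner, amp_adjoint, adjoint_inner_right]
  exact inner_conj_symm _ _

theorem continuous_weakStar_inner (h : H) (k : K) :
    @Continuous _ _ (weakStarTopology H K) _ fun T : H →L[ℂ] K => inner ℂ k (T h) := by
  have := continuous_normalFunctional (lp.single 2 0 h) (lp.single 2 0 k)
  refine (@continuous_congr _ _ (weakStarTopology H K) _ _ _ fun T => ?_).1 this
  rw [normalFunctional_eq_inner, lp.inner_single_left]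
  simp

theorem t2Space_weakStar : @T2Space _ (weakStarTopology H K) := by
  let _ := weakStarTopology H K
  refine T2Space.mk fun S T hST => ?_
  obtain ⟨h, hh⟩ : ∃ h, S h ≠ T h := by
    by_contra! hc
    exact hST (ContinuousLinearMap.ext hc)
  have hc := continuous_weakStar_inner h (S h - T h)
  refine separated_by_continuous hc fun heq => hh ?_
  rw [← sub_eq_zero, ← inner_self_eq_zero (𝕜 := ℂ)]
  rw [inner_sub_right]
  exact sub_eq_zero.2 heq

theorem exists_finset_of_mem_nhds_weakStar {T : H →L[ℂ] K} {U : Set (H →L[ℂ] K)}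
    (hU : U ∈ @nhds _ (weakStarTopology H K) T) :
    ∃ (I : Finset (lp (fun _ : ℕ => H) 2 × lp (fun _ : ℕ => K) 2)) (ε : ℝ), 0 < ε ∧
      ∀ S, (∀ p ∈ I, ‖normalFunctional p.1 p.2 (S - T)‖ < ε) → S ∈ U := by
  have hw : weakStarTopology H K = ⨅ p : lp (fun _ : ℕ => H) 2 × lp (fun _ : ℕ => K) 2,
      TopologicalSpace.induced (normalFunctional p.1 p.2) inferInstance := by
    unfold weakStarTopology
    rw [iInf_prod]
  rw [hw, nhds_iInf] at hU
  simp only [nhds_induced] at hU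
  have hb := Filter.HasBasis.iInf' fun p : lp (fun _ : ℕ => H) 2 × lp (fun _ : ℕ => K) 2 =>
    (Metric.nhds_basis_ball (x := normalFunctional p.1 p.2 T)).comap (normalFunctional p.1 p.2)
  obtain ⟨⟨I, δ⟩, ⟨hI, hδ⟩, hsub⟩ := hb.mem_iff.1 hU
  obtain ⟨ε, hε, hle⟩ : ∃ ε : ℝ, 0 < ε ∧ ∀ p ∈ I, ε ≤ δ p := by
    rcases I.eq_empty_or_nonempty with rfl | hne
    · exact ⟨1, one_pos, by simp⟩
    · obtain ⟨p, hp, hmin⟩ := hI.exists_minimalFor δ I hne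
      exact ⟨δ p, hδ p hp, fun q hq => (le_total (δ p) (δ q)).elim id fun h => hmin hq h⟩
  refine ⟨hI.toFinset, ε, hε, fun S hS => hsub ?_⟩
  simp only [Set.mem_iInter, Set.mem_preimage, Metric.mem_ball, dist_eq_norm]
  intro p hp
  rw [← normalFunctional_sub]
  exact (hS p (hI.mem_toFinset.2 hp)).trans_le (hle p hp)

/-- Weak* neighbourhoods contain σ-strong neighbourhoods given by a single vector. -/
theorem exists_amp_ball_of_mem_nhds_weakStar {T : H →L[ℂ] K} {U : Set (H →L[ℂ] K)}
    (hU : U ∈ @nhds _ (weakStarTopology H K) T) :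
    ∃ (ξ : lp (fun _ : ℕ => H) 2) (ε : ℝ), 0 < ε ∧
      ∀ S : H →L[ℂ] K, ‖amp S ξ - amp T ξ‖ < ε → S ∈ U := by
  obtain ⟨I, ε, hε, hI⟩ := exists_finset_of_mem_nhds_weakStar hU
  obtain ⟨ξ, hξ⟩ := exists_amp_dominating K (fun p : I => p.1.1)
    (hasSum_fintype _).summable
  obtain ⟨C, hC0, hC⟩ : ∃ C : ℝ, 0 < C ∧ ∀ p ∈ I, ‖p.2‖ ≤ C := by
    obtain ⟨C, hC⟩ := (I.image fun p => ‖p.2‖).exists_le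
    exact ⟨max C 1, by positivity, fun p hp =>
      (hC _ (Finset.mem_image_of_mem _ hp)).trans (le_max_left _ _)⟩
  refine ⟨ξ, ε / C, by positivity, fun S hS => hI S fun p hp => ?_⟩
  rw [normalFunctional_eq_inner]
  calc ‖inner ℂ p.2 (amp (S - T) p.1)‖ ≤ ‖p.2‖ * ‖amp (S - T) p.1‖ := norm_inner_le_norm _ _
    _ ≤ C * ‖amp (S - T) ξ‖ := by
      gcongr
      · exact hC p hp
      · exact hξ (S - T) ⟨p, hp⟩
    _ < C * (ε / C) := by
      gcongr
      rw [amp_sub]; exact hS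
    _ = ε := by field_simp

/-- A weak*-continuous functional on a *-algebra is dominated on `a* a` by a vector functional of
the amplification. -/
theorem exists_amp_dominating_of_continuous
    (R : NonUnitalStarSubalgebra ℂ (H →L[ℂ] H)) (φ : R →ₗ[ℂ] ℂ)
    (hφ : @Continuous _ _ (relWeakStar (R : Set (H →L[ℂ] H))) _ φ) :
    ∃ ξ : lp (fun _ : ℕ => H) 2, ∀ a : R, ‖φ (star a * a)‖ ≤ ‖amp a.1 ξ‖ ^ 2 := by
  have hU : φ ⁻¹' Metric.ball 0 1 ∈ @nhds _ (relWeakStar (R : Set (H →L[ℂ] H))) 0 := by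
    let _ := relWeakStar (R : Set (H →L[ℂ] H))
    refine hφ.continuousAt.preimage_mem_nhds ?_
    rw [map_zero]
    exact Metric.ball_mem_nhds _ one_pos
  rw [relWeakStar, @nhds_induced, Filter.mem_comap] at hU
  obtain ⟨V, hV, hVU⟩ := hU
  obtain ⟨I, ε, hε, hI⟩ := exists_finset_of_mem_nhds_weakStar hV
  -- Both vectors of each pair must be dominated, since `⟨k, (a* a ⊗ 1)h⟩ = ⟨(a ⊗ 1)k, (a ⊗ 1)h⟩`;
  -- hence the index type `I ⊕ I`.
  obtain ⟨ξ, hξ⟩ := exists_amp_dominating H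
    (fun p : I ⊕ I => Sum.elim (fun q => q.1.1) (fun q => q.1.2) p) (hasSum_fintype _).summable
  have key : ∀ (a : R) (r : ℝ), 0 < r → (∀ p ∈ I, ‖normalFunctional p.1 p.2 a.1‖ ≤ r) →
      ‖φ a‖ ≤ 2 * r / ε := by
    intro a r hr ha
    -- Scaling by `ε / (2r)` makes the finitely many functionals at most `ε / 2`, which puts `c • a`
    -- into the neighbourhood where `φ` is less than `1` in modulus.
    set c : ℂ := ((ε / (2 * r) : ℝ) : ℂ) with hc
    have hcn : ‖c‖ = ε / (2 * r) := by
      rw [hc, Complex.norm_real, Real.norm_of_nonneg (by positivity)]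
    have h1 : c • a ∈ φ ⁻¹' Metric.ball 0 1 := hVU <| hI _ fun p hp => by
      have : normalFunctional p.1 p.2 ((c • a : R).1 - (0 : R).1) =
          c * normalFunctional p.1 p.2 a.1 := by
        simp [normalFunctional_eq_inner, amp_smul]
      rw [this, norm_mul, hcn]
      calc ε / (2 * r) * ‖normalFunctional p.1 p.2 a.1‖ ≤ ε / (2 * r) * r := by
            gcongr; exact ha p hp
        _ = ε / 2 := by field_simp
        _ < ε := by linarith
    have h2 : ‖c‖ * ‖φ a‖ < 1 := by simpa using h1
    rw [hcn] at h2
    rw [le_div_iff₀ hε]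
    have : ε * ‖φ a‖ < 2 * r := by
      rw [div_mul_eq_mul_div, div_lt_one (by positivity)] at h2
      exact h2
    linarith
  have key2 : ∀ a : R, ‖φ (star a * a)‖ ≤ 2 / ε * ‖amp a.1 ξ‖ ^ 2 := by
    intro a
    -- The estimate `key` needs a strictly positive bound, but `amp a ξ` may vanish; the slack `δ *
    -- ε / 2` turns into `δ` after multiplication by `2 / ε`.
    refine le_of_forall_pos_le_add fun δ hδ => ?_
    have := key (star a * a) (‖amp a.1 ξ‖ ^ 2 + δ * ε / 2) (by positivity) fun p hp => by
      have h3 : normalFunctional p.1 p.2 (star a * a : R).1 =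
          inner ℂ (amp a.1 p.2) (amp a.1 p.1) := by
        change normalFunctional p.1 p.2 (adjoint a.1 ∘L a.1) = _
        rw [normalFunctional_eq_inner, amp_comp, amp_adjoint, comp_apply, adjoint_inner_right]
      rw [h3]
      calc _ ≤ ‖amp a.1 p.2‖ * ‖amp a.1 p.1‖ := norm_inner_le_norm _ _
        _ ≤ ‖amp a.1 ξ‖ * ‖amp a.1 ξ‖ := by
          gcongr
          · exact hξ a.1 (Sum.inr ⟨p, hp⟩)
          · exact hξ a.1 (Sum.inl ⟨p, hp⟩)
        _ ≤ _ := by rw [sq]; linarith [show 0 < δ * ε / 2 by positivity]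
    refine this.trans (le_of_eq ?_)
    field_simp
  refine ⟨((Real.sqrt (2 / ε) : ℝ) : ℂ) • ξ, fun a => (key2 a).trans (le_of_eq ?_)⟩
  rw [map_smul, norm_smul, mul_pow, Complex.norm_real, Real.norm_of_nonneg (Real.sqrt_nonneg _),
    Real.sq_sqrt (by positivity)]

end WeakStar

/-! ### Operators determined on a subspace and on its orthogonal complement. -/

section Extension

variable {M L₁ L₂ : Type*} [AddCommGroup M] [Module ℂ M]
  [NormedAddCommGroup L₁] [InnerProductSpace ℂ L₁] [CompleteSpace L₁]
  [NormedAddCommGroup L₂] [InnerProductSpace ℂ L₂] [CompleteSpace L₂]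

/-- A densely defined bounded map between Hilbert spaces extends to the closure of its domain, and
by zero to the orthogonal complement. -/
theorem exists_extension_by_zero (g₁ : M →ₗ[ℂ] L₁) (g₂ : M →ₗ[ℂ] L₂) (C : ℝ)
    (hg : ∀ a, ‖g₂ a‖ ≤ C * ‖g₁ a‖) :
    ∃ S : L₁ →L[ℂ] L₂, (∀ a, S (g₁ a) = g₂ a) ∧
      (∀ v, (∀ a, inner ℂ (g₁ a) v = 0) → S v = 0) ∧
      ∀ v, S v ∈ (LinearMap.range g₂).topologicalClosure := by
  set V := (LinearMap.range g₁).topologicalClosure with hV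
  have hVc : IsClosed (V : Set L₁) := Submodule.isClosed_topologicalClosure _
  have : CompleteSpace V := hVc.completeSpace_coe
  have hmem : ∀ a, g₁ a ∈ V := fun a =>
    Submodule.le_topologicalClosure _ (LinearMap.mem_range_self g₁ a)
  let e : M →ₗ[ℂ] V := g₁.codRestrict V hmem
  have hd : DenseRange e := by
    intro v
    rw [closure_subtype]
    refine closure_mono ?_ v.2
    rintro _ ⟨a, rfl⟩
    exact ⟨e a, ⟨a, rfl⟩, rfl⟩
  have hS : ∀ a, g₂.extendOfNorm e (e a) = g₂ a := LinearMap.extendOfNorm_eq hd ⟨C, hg⟩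
  refine ⟨g₂.extendOfNorm e ∘L V.orthogonalProjectionOnto, fun a => ?_, fun v hv => ?_, fun v => ?_⟩
  · rw [comp_apply, ← hS a]
    congr 1
    exact Submodule.orthogonalProjectionOnto_mem_subspace_eq_self (K := V) (e a)
  · have : v ∈ Vᗮ := by
      rw [hV, Submodule.orthogonal_closure, Submodule.mem_orthogonal]
      rintro _ ⟨a, rfl⟩
      exact hv a
    rw [comp_apply, Submodule.orthogonalProjectionOnto_apply_of_mem_orthogonal this,
      map_zero]
  · rw [comp_apply]
    refine hd.induction_on (p := fun u => g₂.extendOfNorm e u ∈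
      (LinearMap.range g₂).topologicalClosure) _ ?_ fun a => ?_
    · exact (Submodule.isClosed_topologicalClosure _).preimage (ContinuousLinearMap.continuous _)
    · rw [hS]
      exact Submodule.le_topologicalClosure _ (LinearMap.mem_range_self g₂ a)

/-- Linearity and continuity settle the closed span of `s`, and the second hypothesis settles its
complement. Operators produced by `exists_extension_by_zero` are compared in this way, with no
density assumption on `s`. -/
theorem ContinuousLinearMap.eq_of_eqOn_of_eqOn_orthogonal (s : Set L₁) {S T : L₁ →L[ℂ] L₂}
    (h₁ : ∀ v ∈ s, S v = T v) (h₂ : ∀ v, (∀ w ∈ s, inner ℂ w v = 0) → S v = T v) : S = T := by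
  set V := (Submodule.span ℂ s).topologicalClosure with hV
  have hVc : IsClosed (V : Set L₁) := Submodule.isClosed_topologicalClosure _
  have : CompleteSpace V := hVc.completeSpace_coe
  have hmem : V ≤ LinearMap.eqLocus (S : L₁ →ₗ[ℂ] L₂) (T : L₁ →ₗ[ℂ] L₂) :=
    Submodule.topologicalClosure_minimal _ (Submodule.span_le.2 h₁)
      (isClosed_eq S.continuous T.continuous)
  ext v
  rw [← sub_add_cancel v (V.starProjection v), map_add, map_add,
    show S _ = T _ from hmem (Submodule.starProjection_apply_mem V v), h₂]
  intro w hw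
  exact Submodule.sub_starProjection_mem_orthogonal v _
    (Submodule.le_topologicalClosure _ (Submodule.subset_span hw))

end Extension

/-! ### Intertwiners between cyclic subspaces and a Radon–Nikodym argument. -/

section Intertwiner

variable {M L₁ L₂ : Type*} [NonUnitalRing M] [StarRing M] [Module ℂ M]
  [NormedAddCommGroup L₁] [InnerProductSpace ℂ L₁] [CompleteSpace L₁]
  [NormedAddCommGroup L₂] [InnerProductSpace ℂ L₂] [CompleteSpace L₂]

/-- The orbit map `a ↦ ρ(a) v` of a representation. -/
def orbitMap (ρ : M →⋆ₙₐ[ℂ] (L₁ →L[ℂ] L₁)) (v : L₁) : M →ₗ[ℂ] L₁ where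
  toFun a := ρ a v
  map_add' := by simp
  map_smul' := by simp

@[simp] theorem orbitMap_apply (ρ : M →⋆ₙₐ[ℂ] (L₁ →L[ℂ] L₁)) (v : L₁) (a : M) :
    orbitMap ρ v a = ρ a v := rfl

theorem inner_rep_left (ρ : M →⋆ₙₐ[ℂ] (L₁ →L[ℂ] L₁)) (a : M) (v w : L₁) :
    inner ℂ (ρ a v) w = inner ℂ v (ρ (star a) w) := by
  rw [map_star, star_eq_adjoint, adjoint_inner_right]

/-- If the vector `h` is dominated by `ξ`, there is a bounded intertwiner that maps the cyclic
subspace of `ξ` to that of `h`. -/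
theorem exists_intertwiner (ρ₁ : M →⋆ₙₐ[ℂ] (L₁ →L[ℂ] L₁)) (ρ₂ : M →⋆ₙₐ[ℂ] (L₂ →L[ℂ] L₂))
    (ξ : L₁) (h : L₂) (hh : ∀ a, ‖ρ₂ a h‖ ≤ ‖ρ₁ a ξ‖) :
    ∃ S : L₁ →L[ℂ] L₂, (∀ a, S (ρ₁ a ξ) = ρ₂ a h) ∧ (∀ a, S ∘L ρ₁ a = ρ₂ a ∘L S) ∧
      ‖S ξ‖ ≤ ‖h‖ := by
  obtain ⟨S, hS, hS0, hSc⟩ := exists_extension_by_zero (orbitMap ρ₁ ξ) (orbitMap ρ₂ h) 1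
    (by simpa using hh)
  simp only [orbitMap_apply] at hS hS0
  have hint : ∀ a, S ∘L ρ₁ a = ρ₂ a ∘L S := by
    intro a
    refine ContinuousLinearMap.eq_of_eqOn_of_eqOn_orthogonal (Set.range fun b => ρ₁ b ξ) ?_
      (fun v hv => ?_)
    · rintro _ ⟨b, rfl⟩
      have := hS (a * b)
      simp only [map_mul, mul_apply_eq_comp] at this
      simp [hS, this]
    -- The complement of the orbit of `ξ` is invariant, because `⟨ρ₁(b)ξ, ρ₁(a)v⟩ = ⟨ρ₁(a* b)ξ, v⟩ =
    -- 0`; both sides vanish there.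
    · simp only [Set.forall_mem_range] at hv
      rw [comp_apply, comp_apply, hS0 v hv, map_zero]
      refine hS0 _ fun b => ?_
      rw [← star_star a, ← inner_rep_left]
      have := hv (star a * b)
      rwa [map_mul] at this
  refine ⟨S, hS, hint, ?_⟩
  -- `M` has no unit, so `S ξ = h` can fail. But `ρ₂` kills `h - S ξ`, which is therefore orthogonal
  -- to the closed orbit of `h`, where `S ξ` lies; hence `‖S ξ‖ ≤ ‖h‖`.
  have hn : ∀ a, ρ₂ a (h - S ξ) = 0 := fun a => by
    have := congrArg (fun T : L₁ →L[ℂ] L₂ => T ξ) (hint a)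
    simp only [comp_apply, hS] at this
    rw [map_sub, ← this, sub_self]
  have h0 : inner ℂ (S ξ) (h - S ξ) = 0 := by
    have hcl : IsClosed {u : L₂ | inner ℂ u (h - S ξ) = 0} :=
      isClosed_eq (by fun_prop) continuous_const
    refine hcl.closure_subset_iff.2 ?_ (hSc ξ)
    rintro _ ⟨a, rfl⟩
    change inner ℂ (ρ₂ a h) _ = 0
    rw [inner_rep_left, hn, inner_zero_right]
  rw [inner_sub_right, sub_eq_zero] at h0
  have h1 : ‖S ξ‖ * ‖S ξ‖ ≤ ‖S ξ‖ * ‖h‖ := by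
    rw [← inner_self_eq_norm_mul_norm (𝕜 := ℂ), ← h0]
    exact (RCLike.re_le_norm _).trans (norm_inner_le_norm _ _)
  rcases (norm_nonneg (S ξ)).eq_or_lt with h2 | h2
  · rw [← h2]; exact norm_nonneg h
  · exact le_of_mul_le_mul_left h1 h2

/-- A dominated vector is dominated by a vector of no larger norm (a Radon–Nikodym argument). -/
theorem exists_dominating_norm_le (ρ₁ : M →⋆ₙₐ[ℂ] (L₁ →L[ℂ] L₁))
    (ρ₂ : M →⋆ₙₐ[ℂ] (L₂ →L[ℂ] L₂)) (ξ : L₁) (h : L₂) (hh : ∀ a, ‖ρ₂ a h‖ ≤ ‖ρ₁ a ξ‖) :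
    ∃ η : L₁, ‖η‖ ≤ ‖h‖ ∧ ∀ a, ‖ρ₂ a h‖ ≤ ‖ρ₁ a η‖ := by
  obtain ⟨S, hS, hint, hle⟩ := exists_intertwiner ρ₁ ρ₂ ξ h hh
  set A : L₁ →L[ℂ] L₁ := adjoint S ∘L S with hA
  have hApos : 0 ≤ A := by
    rw [ContinuousLinearMap.nonneg_iff_isPositive]
    exact isPositive_adjoint_comp_self S
  have hint' : ∀ a, adjoint S ∘L ρ₂ a = ρ₁ a ∘L adjoint S := by
    intro a
    have := congrArg adjoint (hint (star a))
    rw [adjoint_comp, adjoint_comp, ← star_eq_adjoint (ρ₁ _), ← star_eq_adjoint (ρ₂ _),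
      ← map_star ρ₁, ← map_star ρ₂, star_star] at this
    exact this.symm
  have hAc : ∀ a, Commute A (ρ₁ a) := by
    intro a
    change A ∘L ρ₁ a = ρ₁ a ∘L A
    rw [hA, comp_assoc, hint, ← comp_assoc, hint', comp_assoc]
  -- `R = |S|` commutes with `ρ₁` and satisfies `‖R v‖ = ‖S v‖`. Hence `‖ρ₁(a) R ξ‖ = ‖S ρ₁(a) ξ‖ =
  -- ‖ρ₂(a) h‖`, so `R ξ` is the required vector.
  set R := CFC.sqrt A with hR
  have hRc : ∀ a, R ∘L ρ₁ a = ρ₁ a ∘L R := fun a => (hAc a).cfcₙ_nnreal _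
  have hRsa : adjoint R = R := (CFC.sqrt_nonneg A).isSelfAdjoint.star_eq
  have hRR : R ∘L R = A := CFC.sqrt_mul_sqrt_self A hApos
  have hnorm : ∀ v, ‖R v‖ = ‖S v‖ := by
    intro v
    have h1 : inner ℂ (R v) (R v) = inner ℂ (S v) (S v) := by
      rw [← adjoint_inner_right, hRsa, ← comp_apply, hRR, hA, comp_apply, adjoint_inner_right]
    rw [inner_self_eq_norm_sq_to_K, inner_self_eq_norm_sq_to_K] at h1
    have h2 : ‖R v‖ ^ 2 = ‖S v‖ ^ 2 := by exact_mod_cast h1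
    exact (pow_left_inj₀ (norm_nonneg _) (norm_nonneg _) two_ne_zero).1 h2
  refine ⟨R ξ, (hnorm ξ).trans_le hle, fun a => ?_⟩
  rw [← comp_apply, ← hRc, comp_apply, hnorm, hS]

end Intertwiner

/-! ### Vectors dominated by the amplified identity representation. -/

section NormalVectors

variable {E L : Type*}
  [NormedAddCommGroup E] [InnerProductSpace ℂ E] [CompleteSpace E]
  [NormedAddCommGroup L] [InnerProductSpace ℂ L] [CompleteSpace L]
  {R : NonUnitalStarSubalgebra ℂ (E →L[ℂ] E)}

/-- The vectors of a representation of an operator algebra that are dominated by a vector of the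
infinite amplification. -/
def dominatedVectors (ρ : R →⋆ₙₐ[ℂ] (L →L[ℂ] L)) : Submodule ℂ L where
  carrier := {h | ∃ ξ : lp (fun _ : ℕ => E) 2, ∀ a : R, ‖ρ a h‖ ≤ ‖amp a.1 ξ‖}
  zero_mem' := ⟨0, by simp⟩
  add_mem' := by
    rintro h k ⟨ξ, hξ⟩ ⟨η, hη⟩
    obtain ⟨ζ, hζ⟩ := exists_amp_dominating E (fun i : Bool => cond i ξ η)
      (hasSum_fintype _).summable
    refine ⟨(2 : ℂ) • ζ, fun a => ?_⟩
    rw [map_add, map_smul, norm_smul]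
    have h1 := (hξ a).trans (hζ a.1 true)
    have h2 := (hη a).trans (hζ a.1 false)
    calc _ ≤ ‖ρ a h‖ + ‖ρ a k‖ := norm_add_le _ _
      _ ≤ ‖amp a.1 ζ‖ + ‖amp a.1 ζ‖ := add_le_add h1 h2
      _ = _ := by rw [Complex.norm_ofNat]; ring
  smul_mem' := by
    rintro c h ⟨ξ, hξ⟩
    refine ⟨c • ξ, fun a => ?_⟩
    rw [map_smul, map_smul, norm_smul, norm_smul]
    exact mul_le_mul_of_nonneg_left (hξ a) (norm_nonneg c)

/-- A limit is a series of dominated `v n` with rapidly decreasing norms, and each `v n` is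
dominated by some `η n` of no larger norm. This norm control makes `2ⁿ • η n` square-summable, so
one `ξ` dominates them all; then `‖ρ(a) v n‖ ≤ 2⁻ⁿ ‖(a ⊗ 1)ξ‖`, and summing gives the bound by `2 •
ξ`. -/
theorem isClosed_dominatedVectors (ρ : R →⋆ₙₐ[ℂ] (L →L[ℂ] L)) :
    IsClosed (dominatedVectors ρ : Set L) := by
  refine isClosed_of_closure_subset fun h hh => ?_
  obtain ⟨v, hlim, hv, -, hvb⟩ := controlled_sum_of_mem_closure
    (s := (dominatedVectors ρ).toAddSubgroup) hh (b := fun n => (1 / 4 : ℝ) ^ n)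
    (fun n => by positivity)
  have hη : ∀ n, ∃ η : lp (fun _ : ℕ => E) 2, ‖η‖ ≤ ‖v n‖ ∧ ∀ a : R, ‖ρ a (v n)‖ ≤ ‖amp a.1 η‖ := by
    intro n
    obtain ⟨ξ, hξ⟩ := hv n
    exact exists_dominating_norm_le
      ((ampHom E).comp (NonUnitalStarSubalgebraClass.subtype R)) ρ ξ (v n) hξ
  choose η hηn hηa using hη
  have hsum : Summable fun n => ‖(2 : ℂ) ^ n • η n‖ ^ 2 := by
    refine Summable.of_norm_bounded_eventually_nat (g := fun n => (1 / 4 : ℝ) ^ n)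
      (summable_geometric_of_lt_one (by norm_num) (by norm_num)) ?_
    -- The initial term `v 0` approximates the limit vector and need not be small; the bound `4⁻ⁿ`
    -- holds from `n = 1` on.
    filter_upwards [Filter.eventually_gt_atTop 0] with n hn
    have h1 : ‖η n‖ ≤ (1 / 4 : ℝ) ^ n := (hηn n).trans (hvb n hn).le
    rw [Real.norm_of_nonneg (by positivity), norm_smul, norm_pow, Complex.norm_ofNat]
    calc (2 ^ n * ‖η n‖) ^ 2 ≤ (2 ^ n * (1 / 4 : ℝ) ^ n) ^ 2 := by gcongr
      _ = (1 / 4 : ℝ) ^ n := by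
        rw [← mul_pow, ← pow_mul, mul_comm n, pow_mul]; norm_num
  obtain ⟨ξ, hξ⟩ := exists_amp_dominating E _ hsum
  refine ⟨(2 : ℂ) • ξ, fun a => ?_⟩
  refine le_of_tendsto (((ρ a).continuous.tendsto h).comp hlim).norm
    (Filter.Eventually.of_forall fun N => ?_)
  rw [map_smul, norm_smul, Complex.norm_ofNat]
  have hterm : ∀ n, ‖ρ a (v n)‖ ≤ (1 / 2 : ℝ) ^ n * ‖amp a.1 ξ‖ := by
    intro n
    have h1 := hξ a.1 n
    rw [map_smul, norm_smul, norm_pow, Complex.norm_ofNat] at h1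
    calc ‖ρ a (v n)‖ ≤ ‖amp a.1 (η n)‖ := hηa n a
      _ = (1 / 2 : ℝ) ^ n * (2 ^ n * ‖amp a.1 (η n)‖) := by
        rw [← mul_assoc, ← mul_pow]; norm_num
      _ ≤ _ := by gcongr
  calc ‖ρ a (∑ i ∈ Finset.range (N + 1), v i)‖
      ≤ ∑ i ∈ Finset.range (N + 1), ‖ρ a (v i)‖ := by
        rw [map_sum]; exact norm_sum_le _ _
    _ ≤ ∑ i ∈ Finset.range (N + 1), (1 / 2 : ℝ) ^ i * ‖amp a.1 ξ‖ :=
        Finset.sum_le_sum fun i _ => hterm i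
    _ = (∑ i ∈ Finset.range (N + 1), (1 / 2 : ℝ) ^ i) * ‖amp a.1 ξ‖ := by rw [Finset.sum_mul]
    _ ≤ 2 * ‖amp a.1 ξ‖ := by
        gcongr
        exact sum_geometric_two_le (N + 1)

/-- With the intertwiner `S` sending `(a ⊗ 1)ξ` to `ρ(a)h`, the functional equals `a ↦ ⟨S* k, (a ⊗
1)ξ⟩`, which is normal. -/
theorem continuous_inner_of_mem_dominatedVectors (ρ : R →⋆ₙₐ[ℂ] (L →L[ℂ] L)) {h : L}
    (hh : h ∈ dominatedVectors ρ) (k : L) :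
    @Continuous _ _ (relWeakStar (R : Set (E →L[ℂ] E))) _ fun a : R => inner ℂ k (ρ a h) := by
  obtain ⟨ξ, hξ⟩ := hh
  obtain ⟨S, hS, -, -⟩ := exists_intertwiner
    ((ampHom E).comp (NonUnitalStarSubalgebraClass.subtype R)) ρ ξ h hξ
  have hc : @Continuous _ _ (relWeakStar (R : Set (E →L[ℂ] E))) _
      fun a : R => normalFunctional ξ (adjoint S k) a.1 :=
    @Continuous.comp _ _ _ (relWeakStar (R : Set (E →L[ℂ] E))) (weakStarTopology E E) _ _ _
      (continuous_normalFunctional ξ (adjoint S k)) continuous_induced_dom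
  refine (@continuous_congr _ _ (relWeakStar (R : Set (E →L[ℂ] E))) _ _ _ fun a => ?_).1 hc
  rw [normalFunctional_eq_inner, adjoint_inner_left, ← hS]
  rfl

end NormalVectors

/-! ### A criterion for normality of a representation. -/

section Normality

variable {E F : Type*}
  [NormedAddCommGroup E] [InnerProductSpace ℂ E] [CompleteSpace E]
  [NormedAddCommGroup F] [InnerProductSpace ℂ F] [CompleteSpace F]
  {R : NonUnitalStarSubalgebra ℂ (E →L[ℂ] E)}

/-- A representation is normal as soon as the functionals `a ↦ ⟨v, ρ(a) v⟩` are weak*-continuous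
for `v` in a set `S` whose orthogonal complement is annihilated by the representation. -/
theorem continuous_weakStar_of_vector_functionals (ρ : R →⋆ₙₐ[ℂ] (F →L[ℂ] F)) (S : Set F)
    (hS : ∀ v ∈ S, @Continuous _ _ (relWeakStar (R : Set (E →L[ℂ] E))) _
      fun a : R => inner ℂ v (ρ a v))
    (hS0 : ∀ v, (∀ s ∈ S, inner ℂ s v = 0) → ∀ a, ρ a v = 0) :
    @Continuous _ _ (relWeakStar (R : Set (E →L[ℂ] E))) (weakStarTopology F F)
      fun a : R => ρ a := by
  rw [@continuous_weakStar_iff]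
  intro h k
  simp only [normalFunctional_eq_inner]
  refine continuous_inner_of_mem_dominatedVectors ((ampHom F).comp ρ) ?_ k
  set D := dominatedVectors ((ampHom F).comp ρ) with hD
  have hDc : IsClosed (D : Set (lp (fun _ : ℕ => F) 2)) := isClosed_dominatedVectors _
  have hsingle : ∀ (n : ℕ) (v : F) (a : R),
      (ampHom F).comp ρ a (lp.single 2 n v) = lp.single 2 n (ρ a v) := by
    intro n v a
    ext m
    by_cases hmn : m = n
    · subst hmn; simp
    · simp [Pi.single_eq_of_ne hmn]
  have h1 : ∀ n, ∀ v ∈ S, lp.single 2 n v ∈ D := by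
    intro n v hv
    let φ : R →ₗ[ℂ] ℂ :=
      { toFun := fun a => inner ℂ v (ρ a v)
        map_add' := fun a b => by simp
        map_smul' := fun c a => by simp }
    -- For this `φ`, `φ(a* a) = ‖ρ(a)v‖²`, so weak*-continuity of one diagonal functional already
    -- makes `v` dominated.
    obtain ⟨ξ, hξ⟩ := exists_amp_dominating_of_continuous R φ (hS v hv)
    refine ⟨ξ, fun a => le_of_sq_le_sq ?_ (norm_nonneg _)⟩
    rw [hsingle, lp.norm_single (by norm_num)]
    refine le_trans (le_of_eq ?_) (hξ a)
    have : φ (star a * a) = inner ℂ (ρ a v) (ρ a v) := by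
      change inner ℂ v (ρ (star a * a) v) = _
      rw [map_mul, mul_apply_eq_comp, inner_rep_left]
    rw [this, inner_self_eq_norm_sq_to_K]
    simp
  have h2 : ∀ n v, lp.single 2 n v ∈ D := by
    intro n v
    let V : Submodule ℂ F := (Submodule.span ℂ S).topologicalClosure
    have hVc : IsClosed (V : Set F) := Submodule.isClosed_topologicalClosure _
    have : CompleteSpace V := hVc.completeSpace_coe
    have hV : V ≤ D.comap (lp.singleContinuousLinearMap ℂ (fun _ : ℕ => F) 2 n).toLinearMap := by
      refine Submodule.topologicalClosure_minimal _ (Submodule.span_le.2 fun v hv => h1 n v hv) ?_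
      exact hDc.preimage (lp.singleContinuousLinearMap ℂ (fun _ : ℕ => F) 2 n).continuous
    rw [← sub_add_cancel v (V.starProjection v), lp.single_add]
    -- The component orthogonal to `S` is annihilated by `ρ` and is dominated by `0`.
    refine D.add_mem ⟨0, fun a => ?_⟩ (hV (Submodule.starProjection_apply_mem V v))
    rw [hsingle, hS0, lp.single_zero]
    · simp
    · intro s hs
      exact Submodule.sub_starProjection_mem_orthogonal v _
        (Submodule.le_topologicalClosure _ (Submodule.subset_span hs))
  exact hDc.mem_of_tendsto (lp.hasSum_single (by norm_num) h)
    (Filter.Eventually.of_forall fun s => D.sum_mem fun i _ => h2 i _)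

end Normality

/-! ### Von Neumann's density theorem. -/

section Density

variable {E : Type*} [NormedAddCommGroup E] [InnerProductSpace ℂ E] [CompleteSpace E]

/-- The infinite amplification commutes with an operator on `ℓ²(E)` whose matrix entries commute
with the given operator. -/
theorem amp_comp_comm_of_entries {T : E →L[ℂ] E}
    {P : lp (fun _ : ℕ => E) 2 →L[ℂ] lp (fun _ : ℕ => E) 2}
    (h : ∀ m n v, T (P (lp.single 2 n v) m) = P (lp.single 2 n (T v)) m) :
    amp T ∘L P = P ∘L amp T := by
  refine lp.ext_continuousLinearMap (by norm_num) fun n => ?_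
  ext v m
  have hs : amp T (lp.single 2 n v) = lp.single 2 n (T v) := by
    ext j
    by_cases hj : j = n
    · subst hj; simp
    · simp [Pi.single_eq_of_ne hj]
  simpa [hs] using h m n v

/-- Von Neumann's density theorem, for the ultrastrong topology. -/
theorem amp_mem_closure_of_mem_doubleCommutant (A : NonUnitalStarSubalgebra ℂ (E →L[ℂ] E))
    {T : E →L[ℂ] E} (hT : T ∈ doubleCommutant A) (ξ : lp (fun _ : ℕ => E) 2) :
    amp T ξ ∈ closure (Set.range fun a : A => amp a.1 ξ) := by
  set ρ : A →⋆ₙₐ[ℂ] _ := (ampHom E).comp (NonUnitalStarSubalgebraClass.subtype A) with hρ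
  have hρa : ∀ a : A, ρ a = amp a.1 := fun a => rfl
  set V := (LinearMap.range (orbitMap ρ ξ)).topologicalClosure with hV
  have hVc : IsClosed (V : Set (lp (fun _ : ℕ => E) 2)) := Submodule.isClosed_topologicalClosure _
  have : CompleteSpace V := hVc.completeSpace_coe
  have hmem : ∀ a : A, ρ a ξ ∈ V := fun a =>
    Submodule.le_topologicalClosure _ (LinearMap.mem_range_self (orbitMap ρ ξ) a)
  have hperp : ∀ v, (∀ a : A, inner ℂ (ρ a ξ) v = 0) → v ∈ Vᗮ := by
    intro v hv
    rw [hV, Submodule.orthogonal_closure, Submodule.mem_orthogonal]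
    rintro _ ⟨a, rfl⟩
    exact hv a
  have hPa : ∀ a : A, V.starProjection ∘L ρ a = ρ a ∘L V.starProjection := by
    intro a
    refine eq_of_eqOn_of_eqOn_orthogonal (Set.range fun b => ρ b ξ) ?_ (fun v hv => ?_)
    · rintro _ ⟨b, rfl⟩
      have h1 : ρ a (ρ b ξ) ∈ V := by
        have := hmem (a * b)
        rwa [map_mul] at this
      simp only [comp_apply]
      rw [Submodule.starProjection_eq_self_iff.2 h1,
        Submodule.starProjection_eq_self_iff.2 (hmem b)]
    · simp only [Set.forall_mem_range] at hv
      have h1 : ρ a v ∈ Vᗮ := hperp _ fun b => by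
        rw [← star_star a, ← inner_rep_left]
        have := hv (star a * b)
        rwa [map_mul] at this
      rw [comp_apply, comp_apply, (Submodule.starProjection_apply_eq_zero_iff V).2 h1,
        (Submodule.starProjection_apply_eq_zero_iff V).2 (hperp v hv), map_zero]
  have hPT : amp T ∘L V.starProjection = V.starProjection ∘L amp T := by
    refine amp_comp_comm_of_entries fun m n v => ?_
    -- The matrix entries of the projection onto the closed orbit of `ξ` lie in the commutant of
    -- `A`, hence commute with `T`; this is how `T ∈ A''` passes to the amplification.
    let Pmn : E →L[ℂ] E := lp.evalCLM ℂ (fun _ : ℕ => E) 2 m ∘L V.starProjection ∘L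
      lp.singleContinuousLinearMap ℂ (fun _ : ℕ => E) 2 n
    have hcomm : Pmn ∈ Set.centralizer (A : Set (E →L[ℂ] E)) := by
      rw [Set.mem_centralizer_iff]
      intro a ha
      ext w
      have h1 := congrArg (fun S => S (lp.single 2 n w) m) (hPa ⟨a, ha⟩)
      have hs : amp a (lp.single 2 n w) = lp.single 2 n (a w) := by
        ext j
        by_cases hj : j = n
        · subst hj; simp
        · simp [Pi.single_eq_of_ne hj]
      simp only [comp_apply, hρa, hs, amp_apply] at h1
      exact h1.symm
    have h2 := congrArg (fun S : E →L[ℂ] E => S v) (hT.1 Pmn hcomm)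
    exact h2.symm
  -- If `A` acts degenerately, `ξ` may lie outside its closed orbit `V`. Every coordinate of the
  -- difference from its projection lies in the common kernel of `A`, where `T` vanishes by
  -- definition of `doubleCommutant`.
  have hw : amp T (ξ - V.starProjection ξ) = 0 := by
    have h1 : ∀ a : A, ρ a (ξ - V.starProjection ξ) = 0 := by
      intro a
      have := congrArg (fun S => S ξ) (hPa a)
      simp only [comp_apply] at this
      rw [map_sub, ← this, Submodule.starProjection_eq_self_iff.2 (hmem a), sub_self]
    ext n
    rw [amp_apply, hT.2 _ (mem_commonKer.2 fun a ha => ?_)]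
    · rfl
    · have := congrArg (fun v : lp (fun _ : ℕ => E) 2 => v n) (h1 ⟨a, ha⟩)
      exact this
  have hfin : amp T ξ ∈ V := by
    rw [map_sub, sub_eq_zero] at hw
    rw [hw]
    have := congrArg (fun S => S ξ) hPT
    simp only [comp_apply] at this
    rw [this]
    exact Submodule.starProjection_apply_mem V _
  have : (V : Set _) = closure (Set.range fun a : A => amp a.1 ξ) := by
    rw [hV, Submodule.topologicalClosure_coe]
    rfl
  rwa [← this]

/-- A *-algebra is weak*-dense in the von Neumann algebra it generates. -/
theorem doubleCommutant_subset_of_isClosed (A : NonUnitalStarSubalgebra ℂ (E →L[ℂ] E))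
    {C : Set (E →L[ℂ] E)} (hC : IsClosed[weakStarTopology E E] C)
    (hA : (A : Set (E →L[ℂ] E)) ⊆ C) : (doubleCommutant A : Set (E →L[ℂ] E)) ⊆ C := by
  intro T hT
  by_contra hTC
  have hU : Cᶜ ∈ @nhds _ (weakStarTopology E E) T := by
    let _ := weakStarTopology E E
    exact hC.isOpen_compl.mem_nhds hTC
  obtain ⟨ξ, ε, hε, hξ⟩ := exists_amp_ball_of_mem_nhds_weakStar hU
  obtain ⟨_, ⟨a, rfl⟩, ha⟩ :=
    Metric.mem_closure_iff.1 (amp_mem_closure_of_mem_doubleCommutant A hT ξ) ε hε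
  rw [dist_comm, dist_eq_norm] at ha
  exact hξ a.1 ha (hA a.2)

/-- Relative form of the density theorem, suited to equalizers and preimages under maps defined only
on the generated algebra. -/
theorem doubleCommutant_induction (A : NonUnitalStarSubalgebra ℂ (E →L[ℂ] E))
    {C : Set (doubleCommutant A)}
    (hC : IsClosed[relWeakStar (doubleCommutant A : Set (E →L[ℂ] E))] C)
    (hA : ∀ a (ha : a ∈ A), ⟨a, le_doubleCommutant A ha⟩ ∈ C) (T : doubleCommutant A) :
    T ∈ C := by
  obtain ⟨D, hD, rfl⟩ := (@isClosed_induced_iff _ _ (weakStarTopology E E) _ _).1 hC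
  exact doubleCommutant_subset_of_isClosed A hD (fun a ha => hA a ha) T.2

theorem isClosed_doubleCommutant (A : NonUnitalStarSubalgebra ℂ (E →L[ℂ] E)) :
    IsClosed (doubleCommutant A : Set (E →L[ℂ] E)) := by
  have h : (doubleCommutant A : Set (E →L[ℂ] E)) =
      Set.centralizer (Set.centralizer (A : Set (E →L[ℂ] E))) ∩
        ⋂ v ∈ commonKer (A : Set (E →L[ℂ] E)), {T | T v = 0} := by
    ext T
    simp only [Set.mem_inter_iff, Set.mem_iInter, Set.mem_ofPred_eq]
    rfl
  rw [h]
  exact (Set.isClosed_centralizer _).inter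
    (isClosed_biInter fun v _ => isClosed_eq (by fun_prop) continuous_const)

end Density

/-- Since `d* d ≤ ‖d‖²`, the difference is positive and so has the form `c* c`. It supplies the
positivity behind the norm bound on multiplier representations. -/
theorem CStarAlgebra.exists_norm_sq_sub_star_mul_self_eq {A : Type*} [CStarAlgebra A] (d : A) :
    ∃ c : A, ((‖d‖ ^ 2 : ℝ) : ℂ) • (1 : A) - star d * d = star c * c := by
  let _ : PartialOrder A := CStarAlgebra.spectralOrder A
  have : StarOrderedRing A := CStarAlgebra.spectralOrderedRing A
  have h1 := CStarAlgebra.star_mul_le_algebraMap_norm_sq (a := d)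
  obtain ⟨c, hc⟩ := CStarAlgebra.nonneg_iff_eq_star_mul_self.1 (sub_nonneg.2 h1)
  refine ⟨c, ?_⟩
  rw [← hc, Algebra.algebraMap_eq_smul_one, Complex.coe_smul]

/-! ### Multipliers of a ternary space and their representation induced by a ternary map. -/

section LeftMultipliers

variable {E F : Type*}
  [NormedAddCommGroup E] [InnerProductSpace ℂ E] [CompleteSpace E]
  [NormedAddCommGroup F] [InnerProductSpace ℂ F] [CompleteSpace F]

/-- The operators `d` such that `d` and `d*` map a space of operators into itself by left
multiplication. -/
def leftMultipliers (X : Submodule ℂ (E →L[ℂ] E)) : StarSubalgebra ℂ (E →L[ℂ] E) where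
  carrier := {d | ∀ x ∈ X, d * x ∈ X ∧ star d * x ∈ X}
  mul_mem' := fun {c d} hc hd x hx => by
    rw [star_mul, mul_assoc, mul_assoc]
    exact ⟨(hc _ (hd x hx).1).1, (hd _ (hc x hx).2).2⟩
  add_mem' := fun {c d} hc hd x hx => by
    rw [star_add, add_mul, add_mul]
    exact ⟨X.add_mem (hc x hx).1 (hd x hx).1, X.add_mem (hc x hx).2 (hd x hx).2⟩
  algebraMap_mem' := fun c x hx => by
    rw [Algebra.algebraMap_eq_smul_one, star_smul, star_one, smul_one_mul, smul_one_mul]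
    exact ⟨X.smul_mem _ hx, X.smul_mem _ hx⟩
  star_mem' := fun {d} hd x hx => by
    rw [star_star]
    exact (hd x hx).symm

theorem isClosed_leftMultipliers {X : Submodule ℂ (E →L[ℂ] E)}
    (hX : IsClosed (X : Set (E →L[ℂ] E))) :
    IsClosed (leftMultipliers X : Set (E →L[ℂ] E)) := by
  have h : (leftMultipliers X : Set (E →L[ℂ] E)) =
      ⋂ x ∈ X, {d : E →L[ℂ] E | d * x ∈ X} ∩ {d : E →L[ℂ] E | star d * x ∈ X} := by
    ext d
    simp only [Set.mem_iInter]
    rfl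
  rw [h]
  exact isClosed_biInter fun x _ => (hX.preimage (by fun_prop)).inter (hX.preimage (by fun_prop))

/-- Left multiplication by a multiplier. -/
def mulLeftOf {X : Submodule ℂ (E →L[ℂ] E)} (d : leftMultipliers X) (x : X) : X :=
  ⟨d.1 * x.1, (d.2 x.1 x.2).1⟩

variable {X : Submodule ℂ (E →L[ℂ] E)} {f : X →ₗ[ℂ] (F →L[ℂ] F)}

/-- A linear map on a space of operators that preserves the ternary product `x y* z`. -/
def IsTernaryMap (f : X →ₗ[ℂ] (F →L[ℂ] F)) : Prop :=
  ∀ x y z : X, ∃ w : X, w.1 = x.1 * star y.1 * z.1 ∧ f w = f x * star (f y) * f z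

/-- Let `T` be the difference of the two sides. Then `f(z) T = 0` for all `z`, since `z (dx)* y = z
x* (d* y)` inside `X`. As `T*` is a combination of operators ending in `f(dx)` or `f(x)`, also `T* T
= 0`, so `T = 0`. -/
theorem IsTernaryMap.star_map_mulLeftOf (hf : IsTernaryMap f) (d : leftMultipliers X) (x y : X) :
    star (f (mulLeftOf d x)) * f y = star (f x) * f (mulLeftOf (star d) y) := by
  set T := star (f (mulLeftOf d x)) * f y - star (f x) * f (mulLeftOf (star d) y) with hT
  have h0 : ∀ z, f z * T = 0 := by
    intro z
    obtain ⟨v, hv, hfv⟩ := hf z (mulLeftOf d x) y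
    obtain ⟨w, hw, hfw⟩ := hf z x (mulLeftOf (star d) y)
    have hvw : v = w := by
      apply Subtype.ext
      rw [hv, hw]
      simp only [mulLeftOf, star_mul, mul_assoc]
      rfl
    rw [hT, mul_sub, ← mul_assoc, ← mul_assoc, ← hfv, ← hfw, hvw, sub_self]
  have h1 : star T * T = 0 := by
    conv_lhs => rw [hT, star_sub, star_mul, star_mul, star_star, star_star, sub_mul, mul_assoc,
      mul_assoc, ← hT, h0, h0, mul_zero, mul_zero, sub_zero]
  exact sub_eq_zero.1 (CStarRing.star_mul_self_eq_zero_iff T |>.1 h1)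

/-- The map `∑ xᵢ ⊗ hᵢ ↦ ∑ f(d xᵢ) hᵢ`. -/
def multSum (f : X →ₗ[ℂ] (F →L[ℂ] F)) (d : leftMultipliers X) : (X →₀ F) →ₗ[ℂ] F :=
  Finsupp.lsum ℂ fun x => (f (mulLeftOf d x) : F →ₗ[ℂ] F)

theorem multSum_single (d : leftMultipliers X) (x : X) (h : F) :
    multSum f d (Finsupp.single x h) = f (mulLeftOf d x) h := by
  simp [multSum]

theorem mulLeftOf_one (x : X) : mulLeftOf (1 : leftMultipliers X) x = x :=
  Subtype.ext (one_mul _)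

theorem mulLeftOf_mul (c d : leftMultipliers X) (x : X) :
    mulLeftOf (c * d) x = mulLeftOf c (mulLeftOf d x) :=
  Subtype.ext (mul_assoc _ _ _)

theorem mulLeftOf_add (c d : leftMultipliers X) (x : X) :
    mulLeftOf (c + d) x = mulLeftOf c x + mulLeftOf d x :=
  Subtype.ext (add_mul _ _ _)

theorem mulLeftOf_sub (c d : leftMultipliers X) (x : X) :
    mulLeftOf (c - d) x = mulLeftOf c x - mulLeftOf d x :=
  Subtype.ext (sub_mul _ _ _)

theorem mulLeftOf_smul (c : ℂ) (d : leftMultipliers X) (x : X) :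
    mulLeftOf (c • d) x = c • mulLeftOf d x :=
  Subtype.ext (smul_mul_assoc _ _ _)

theorem IsTernaryMap.inner_map_mulLeftOf (hf : IsTernaryMap f) (d e : leftMultipliers X)
    (x y : X) (h k : F) :
    inner ℂ (f (mulLeftOf d x) h) (f (mulLeftOf e y) k) =
      inner ℂ (f x h) (f (mulLeftOf (star d * e) y) k) := by
  have := congrArg (fun T : F →L[ℂ] F => inner ℂ h (T k))
    (hf.star_map_mulLeftOf d x (mulLeftOf e y))
  simp only [mul_apply_eq_comp, star_eq_adjoint, adjoint_inner_right] at this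
  rw [this, mulLeftOf_mul]

theorem IsTernaryMap.inner_multSum (hf : IsTernaryMap f) (d e : leftMultipliers X)
    (s t : X →₀ F) :
    inner ℂ (multSum f d s) (multSum f e t) =
      inner ℂ (multSum f 1 s) (multSum f (star d * e) t) := by
  induction s using Finsupp.induction_linear with
  | zero => simp
  | add s₁ s₂ h₁ h₂ => simp only [map_add, inner_add_left, h₁, h₂]
  | single x h =>
    induction t using Finsupp.induction_linear with
    | zero => simp
    | add s₁ s₂ h₁ h₂ => simp only [map_add, inner_add_right, h₁, h₂]
    | single y k =>
      simp only [multSum_single, hf.inner_map_mulLeftOf d e, mulLeftOf_one]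

theorem multSum_sub (c d : leftMultipliers X) (s : X →₀ F) :
    multSum f (c - d) s = multSum f c s - multSum f d s := by
  induction s using Finsupp.induction_linear with
  | zero => simp
  | add s₁ s₂ h₁ h₂ => simp only [map_add, h₁, h₂]; abel
  | single x h => simp [multSum_single, mulLeftOf_sub]

theorem multSum_smul (c : ℂ) (d : leftMultipliers X) (s : X →₀ F) :
    multSum f (c • d) s = c • multSum f d s := by
  induction s using Finsupp.induction_linear with
  | zero => simp
  | add s₁ s₂ h₁ h₂ => simp only [map_add, h₁, h₂, smul_add]
  | single x h => simp [multSum_single, mulLeftOf_smul]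

/-- Write `‖d‖² - d* d = c* c` with `c` again a multiplier. Moving adjoints across the inner product
yields `‖d‖² ‖multSum f 1 s‖² - ‖multSum f d s‖² = ‖multSum f c s‖² ≥ 0`. -/
theorem IsTernaryMap.norm_multSum_le (hf : IsTernaryMap f) (hX : IsClosed (X : Set (E →L[ℂ] E)))
    (d : leftMultipliers X) (s : X →₀ F) :
    ‖multSum f d s‖ ≤ ‖d‖ * ‖multSum f 1 s‖ := by
  have hM := isClosed_leftMultipliers hX
  -- Closedness of `X` enters here: `c` must be found among the multipliers and not merely among all
  -- operators.
  let _ : CStarAlgebra (leftMultipliers X) := StarSubalgebra.cstarAlgebra _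
  obtain ⟨c, hc⟩ := CStarAlgebra.exists_norm_sq_sub_star_mul_self_eq d
  have h1 := hf.inner_multSum c c s s
  rw [← hc, multSum_sub, multSum_smul, inner_sub_right, inner_smul_right,
    ← hf.inner_multSum d d s s] at h1
  have h2 := congrArg Complex.re h1
  have hre : ∀ v : F, (inner ℂ v v).re = ‖v‖ ^ 2 := fun v => inner_self_eq_norm_sq (𝕜 := ℂ) v
  rw [Complex.sub_re, Complex.re_ofReal_mul, hre, hre, hre] at h2
  refine le_of_sq_le_sq ?_ (by positivity)
  rw [mul_pow]
  nlinarith [sq_nonneg ‖multSum f c s‖]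

theorem IsTernaryMap.exists_leftRep_apply (hf : IsTernaryMap f)
    (hX : IsClosed (X : Set (E →L[ℂ] E))) (d : leftMultipliers X) :
    ∃ S : F →L[ℂ] F, (∀ x h, S (f x h) = f (mulLeftOf d x) h) ∧
      ∀ v, (∀ x h, inner ℂ (f x h) v = 0) → S v = 0 := by
  obtain ⟨S, h1, h2, -⟩ := exists_extension_by_zero (multSum f 1) (multSum f d) ‖d‖
    (hf.norm_multSum_le hX d)
  refine ⟨S, fun x h => ?_, fun v hv => h2 v fun s => ?_⟩
  · simpa only [multSum_single, mulLeftOf_one] using h1 (Finsupp.single x h)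
  · induction s using Finsupp.induction_linear with
    | zero => simp
    | add s₁ s₂ h₁ h₂ => simp only [map_add, inner_add_left, h₁, h₂, add_zero]
    | single x h => rw [multSum_single, mulLeftOf_one]; exact hv x h

theorem eq_of_map_apply_eq {L : Type*} [NormedAddCommGroup L] [InnerProductSpace ℂ L]
    [CompleteSpace L] (f : X →ₗ[ℂ] (F →L[ℂ] F)) {S T : F →L[ℂ] L}
    (h₁ : ∀ x h, S (f x h) = T (f x h))
    (h₂ : ∀ v, (∀ x h, inner ℂ (f x h) v = 0) → S v = T v) : S = T := by
  refine eq_of_eqOn_of_eqOn_orthogonal {v | ∃ x h, f x h = v} ?_ fun v hv => h₂ v fun x h => ?_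
  · rintro _ ⟨x, h, rfl⟩
    exact h₁ x h
  · exact hv _ ⟨x, h, rfl⟩

/-- The representation of the left multipliers of a TRO induced by a ternary morphism. -/
theorem IsTernaryMap.exists_leftRep (hf : IsTernaryMap f) (hX : IsClosed (X : Set (E →L[ℂ] E))) :
    ∃ π : leftMultipliers X →⋆ₙₐ[ℂ] (F →L[ℂ] F),
      (∀ d x h, π d (f x h) = f (mulLeftOf d x) h) ∧
      ∀ d v, (∀ x h, inner ℂ (f x h) v = 0) → π d v = 0 := by
  choose π hπ hπ0 using hf.exists_leftRep_apply hX
  refine ⟨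
    { toFun := π
      map_smul' := ?_
      map_zero' := ?_
      map_add' := ?_
      map_mul' := ?_
      map_star' := ?_ }, hπ, hπ0⟩
  · intro c d
    refine eq_of_map_apply_eq f (fun x h => ?_) fun v hv => ?_
    · simp [hπ, mulLeftOf_smul]
    · simp [hπ0 _ v hv]
  · refine eq_of_map_apply_eq f (fun x h => ?_) fun v hv => ?_
    · have : mulLeftOf (0 : leftMultipliers X) x = 0 := Subtype.ext (zero_mul _)
      simp [hπ, this]
    · simp [hπ0 _ v hv]
  · intro c d
    refine eq_of_map_apply_eq f (fun x h => ?_) fun v hv => ?_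
    · simp [hπ, mulLeftOf_add]
    · simp [hπ0 _ v hv]
  · intro c d
    refine eq_of_map_apply_eq f (fun x h => ?_) fun v hv => ?_
    · simp [hπ, mulLeftOf_mul]
    · simp [hπ0 _ v hv]
  · intro d
    refine eq_of_map_apply_eq f (fun y k => ?_) fun v hv => ?_
    -- Compare the functionals `⟨f(y)k, π(d) ·⟩` and `⟨f(d* y)k, ·⟩` on the vectors `f(x)h`, where
    -- they agree by the ternary adjoint relation, and on the complement, where both vanish.
    · have key : innerSL ℂ (f y k) ∘L π d = innerSL ℂ (f (mulLeftOf (star d) y) k) := by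
        refine eq_of_map_apply_eq f (fun x h => ?_) fun v hv => ?_
        · have := hf.inner_map_mulLeftOf (star d) 1 y x k h
          simp only [mulLeftOf_one, star_star, mul_one] at this
          simp only [comp_apply, innerSL_apply_apply, hπ, this]
        · simp only [comp_apply, innerSL_apply_apply, hπ0 _ v hv, inner_zero_right, hv]
      rw [hπ]
      refine ext_inner_right ℂ fun w => ?_
      rw [star_eq_adjoint, adjoint_inner_left]
      exact congrArg (fun S : F →L[ℂ] ℂ => S w) key.symm
    · rw [hπ0 _ v hv]
      have key : innerSL ℂ v ∘L π d = 0 := by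
        refine eq_of_map_apply_eq f (fun x h => ?_) fun w hw => ?_
        · simp only [comp_apply, innerSL_apply_apply, hπ, zero_apply]
          rw [← inner_conj_symm, hv, map_zero]
        · simp [hπ0 _ w hw]
      refine ext_inner_right ℂ fun w => ?_
      rw [star_eq_adjoint, adjoint_inner_left, inner_zero_left]
      exact congrArg (fun S : F →L[ℂ] ℂ => S w) key.symm

end LeftMultipliers

/-! ### Diagonal and off-diagonal parts of block operators. -/

section BlockOperators

variable {H K : Type*}
  [NormedAddCommGroup H] [InnerProductSpace ℂ H] [CompleteSpace H]
  [NormedAddCommGroup K] [InnerProductSpace ℂ K] [CompleteSpace K]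

theorem ext_entries {S T : DirSum H K →L[ℂ] DirSum H K} (h11 : entry11 S = entry11 T)
    (h12 : entry12 S = entry12 T) (h21 : entry21 S = entry21 T) (h22 : entry22 S = entry22 T) :
    S = T := by
  have key : ∀ U : DirSum H K →L[ℂ] DirSum H K, ∀ v, U v =
      inK H K (entry11 U (prK H K v)) + inH H K (entry21 U (prK H K v)) +
      (inK H K (entry12 U (prH H K v)) + inH H K (entry22 U (prH H K v))) := by
    intro U v
    change U v = inK H K (prK H K (U (inK H K (prK H K v)))) +
      inH H K (prH H K (U (inK H K (prK H K v)))) +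
      (inK H K (prK H K (U (inH H K (prH H K v)))) + inH H K (prH H K (U (inH H K (prH H K v)))))
    rw [in_pr, in_pr, ← map_add, in_pr]
  ext v
  rw [key S, key T, h11, h12, h21, h22]

theorem continuous_entry11 : Continuous (entry11 (H := H) (K := K)) := by unfold entry11; fun_prop
theorem continuous_entry12 : Continuous (entry12 (H := H) (K := K)) := by unfold entry12; fun_prop
theorem continuous_entry21 : Continuous (entry21 (H := H) (K := K)) := by unfold entry21; fun_prop
theorem continuous_entry22 : Continuous (entry22 (H := H) (K := K)) := by unfold entry22; fun_prop

theorem continuous_weakStar_entry11 :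
    @Continuous _ _ (weakStarTopology _ _) (weakStarTopology _ _) (entry11 (H := H) (K := K)) :=
  continuous_weakStar_comp_comp _ _
theorem continuous_weakStar_entry12 :
    @Continuous _ _ (weakStarTopology _ _) (weakStarTopology _ _) (entry12 (H := H) (K := K)) :=
  continuous_weakStar_comp_comp _ _
theorem continuous_weakStar_entry21 :
    @Continuous _ _ (weakStarTopology _ _) (weakStarTopology _ _) (entry21 (H := H) (K := K)) :=
  continuous_weakStar_comp_comp _ _
theorem continuous_weakStar_entry22 :
    @Continuous _ _ (weakStarTopology _ _) (weakStarTopology _ _) (entry22 (H := H) (K := K)) :=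
  continuous_weakStar_comp_comp _ _

theorem continuous_weakStar_corner :
    @Continuous _ _ (weakStarTopology _ _) (weakStarTopology _ _) (corner (H := H) (K := K)) :=
  continuous_weakStar_comp_comp _ _

/-- The block diagonal part of an operator on `K ⊕ H`. -/
def diagPart (T : DirSum H K →L[ℂ] DirSum H K) : DirSum H K →L[ℂ] DirSum H K :=
  (inK H K ∘L prK H K) ∘L T ∘L (inK H K ∘L prK H K) +
    (inH H K ∘L prH H K) ∘L T ∘L (inH H K ∘L prH H K)

/-- The block off-diagonal part of an operator on `K ⊕ H`. -/
def offPart (T : DirSum H K →L[ℂ] DirSum H K) : DirSum H K →L[ℂ] DirSum H K :=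
  (inK H K ∘L prK H K) ∘L T ∘L (inH H K ∘L prH H K) +
    (inH H K ∘L prH H K) ∘L T ∘L (inK H K ∘L prK H K)

theorem continuous_weakStar_diagPart :
    @Continuous _ _ (weakStarTopology _ _) (weakStarTopology _ _) (diagPart (H := H) (K := K)) :=
  continuous_weakStar_add (continuous_weakStar_comp_comp _ _) (continuous_weakStar_comp_comp _ _)

theorem continuous_weakStar_offPart :
    @Continuous _ _ (weakStarTopology _ _) (weakStarTopology _ _) (offPart (H := H) (K := K)) :=
  continuous_weakStar_add (continuous_weakStar_comp_comp _ _) (continuous_weakStar_comp_comp _ _)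

section

variable (T : DirSum H K →L[ℂ] DirSum H K)

theorem entry11_diagPart : entry11 (diagPart T) = entry11 T := by
  ext v; simp [entry11, diagPart, prK_inK, prH_inK]
theorem entry12_diagPart : entry12 (diagPart T) = 0 := by
  ext v; simp [entry12, diagPart, prK_inH, prH_inH]
theorem entry21_diagPart : entry21 (diagPart T) = 0 := by
  ext v; simp [entry21, diagPart, prK_inK, prH_inK]
theorem entry22_diagPart : entry22 (diagPart T) = entry22 T := by
  ext v; simp [entry22, diagPart, prK_inH, prH_inH]
theorem entry11_offPart : entry11 (offPart T) = 0 := by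
  ext v; simp [entry11, offPart, prK_inK, prK_inH, prH_inK]
theorem entry12_offPart : entry12 (offPart T) = entry12 T := by
  ext v; simp [entry12, offPart, prK_inK, prK_inH, prH_inH]
theorem entry21_offPart : entry21 (offPart T) = entry21 T := by
  ext v; simp [entry21, offPart, prK_inK, prH_inK, prH_inH]
theorem entry22_offPart : entry22 (offPart T) = 0 := by
  ext v; simp [entry22, offPart, prK_inH, prH_inK, prH_inH]

end

/-- With `offPart_mul`, this is the `ℤ/2`-grading of block operators that makes the extension
multiplicative. -/
theorem diagPart_mul (S T : DirSum H K →L[ℂ] DirSum H K) :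
    diagPart (S * T) = diagPart S * diagPart T + offPart S * offPart T := by
  apply ext_entries <;> simp [entry11_add, entry12_add, entry21_add, entry22_add,
    entry11_diagPart, entry12_diagPart, entry21_diagPart, entry22_diagPart,
    entry11_offPart, entry12_offPart, entry21_offPart, entry22_offPart,
    entry11_mul, entry12_mul, entry21_mul, entry22_mul, add_comm]

theorem offPart_mul (S T : DirSum H K →L[ℂ] DirSum H K) :
    offPart (S * T) = diagPart S * offPart T + offPart S * diagPart T := by
  apply ext_entries <;> simp [entry11_add, entry12_add, entry21_add, entry22_add,
    entry11_diagPart, entry12_diagPart, entry21_diagPart, entry22_diagPart,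
    entry11_offPart, entry12_offPart, entry21_offPart, entry22_offPart,
    entry11_mul, entry12_mul, entry21_mul, entry22_mul, add_comm]

theorem diagPart_star (T : DirSum H K →L[ℂ] DirSum H K) :
    diagPart (star T) = star (diagPart T) := by
  apply ext_entries <;> simp [
    entry11_diagPart, entry12_diagPart, entry21_diagPart, entry22_diagPart,
    entry11_star, entry12_star, entry21_star, entry22_star]

theorem offPart_star (T : DirSum H K →L[ℂ] DirSum H K) :
    offPart (star T) = star (offPart T) := by
  apply ext_entries <;> simp [
    entry11_offPart, entry12_offPart, entry21_offPart, entry22_offPart,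
    entry11_star, entry12_star, entry21_star, entry22_star]

theorem diagPart_add (S T : DirSum H K →L[ℂ] DirSum H K) :
    diagPart (S + T) = diagPart S + diagPart T := by
  simp only [diagPart, add_comp, comp_add]; abel

theorem offPart_add (S T : DirSum H K →L[ℂ] DirSum H K) :
    offPart (S + T) = offPart S + offPart T := by
  simp only [offPart, add_comp, comp_add]; abel

theorem diagPart_smul (c : ℂ) (T : DirSum H K →L[ℂ] DirSum H K) :
    diagPart (c • T) = c • diagPart T := by
  simp only [diagPart, smul_comp, comp_smul, smul_add]

theorem offPart_smul (c : ℂ) (T : DirSum H K →L[ℂ] DirSum H K) :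
    offPart (c • T) = c • offPart T := by
  simp only [offPart, smul_comp, comp_smul, smul_add]

theorem corner_add (x y : H →L[ℂ] K) : corner (x + y) = corner x + corner y := by
  simp only [corner, add_comp, comp_add]

theorem corner_smul (c : ℂ) (x : H →L[ℂ] K) : corner (c • x) = c • corner x := by
  simp only [corner, smul_comp, comp_smul]

theorem corner_zero : corner (0 : H →L[ℂ] K) = 0 := by
  simp only [corner, zero_comp, comp_zero]

theorem entry11_star_corner (x : H →L[ℂ] K) : entry11 (star (corner x)) = 0 := by
  rw [entry11_star, entry11_corner, map_zero]
theorem entry12_star_corner (x : H →L[ℂ] K) : entry12 (star (corner x)) = 0 := by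
  rw [entry12_star, entry21_corner, map_zero]
theorem entry21_star_corner (x : H →L[ℂ] K) : entry21 (star (corner x)) = adjoint x := by
  rw [entry21_star, entry12_corner]
theorem entry22_star_corner (x : H →L[ℂ] K) : entry22 (star (corner x)) = 0 := by
  rw [entry22_star, entry22_corner, map_zero]

end BlockOperators

/-! ### The self-adjoint ternary space of off-diagonal operators. -/

section OffDiagonal

variable {H K : Type*}
  [NormedAddCommGroup H] [InnerProductSpace ℂ H] [CompleteSpace H]
  [NormedAddCommGroup K] [InnerProductSpace ℂ K] [CompleteSpace K]

/-- The self-adjoint TRO `(0 X; X* 0)` of operators on `K ⊕ H`. -/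
def TRO.offDiag (X : TRO H K) : Submodule ℂ (DirSum H K →L[ℂ] DirSum H K) where
  carrier := {T | entry11 T = 0 ∧ entry12 T ∈ X.toSubmodule ∧
    adjoint (entry21 T) ∈ X.toSubmodule ∧ entry22 T = 0}
  zero_mem' := by
    refine ⟨entry11_zero, ?_, ?_, entry22_zero⟩
    · rw [entry12_zero]; exact zero_mem _
    · rw [entry21_zero, map_zero]; exact zero_mem _
  add_mem' := by
    rintro S T ⟨h1, h2, h3, h4⟩ ⟨g1, g2, g3, g4⟩
    refine ⟨?_, ?_, ?_, ?_⟩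
    · rw [entry11_add, h1, g1, add_zero]
    · rw [entry12_add]; exact add_mem h2 g2
    · rw [entry21_add, map_add]; exact add_mem h3 g3
    · rw [entry22_add, h4, g4, add_zero]
  smul_mem' := by
    rintro c T ⟨h1, h2, h3, h4⟩
    refine ⟨?_, ?_, ?_, ?_⟩
    · rw [entry11_smul, h1, smul_zero]
    · rw [entry12_smul]; exact Submodule.smul_mem _ _ h2
    · rw [entry21_smul, map_smulₛₗ]; exact Submodule.smul_mem _ _ h3
    · rw [entry22_smul, h4, smul_zero]

theorem TRO.isClosed_offDiag (X : TRO H K) :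
    IsClosed (X.offDiag : Set (DirSum H K →L[ℂ] DirSum H K)) := by
  refine (isClosed_eq continuous_entry11 continuous_const).inter
    ((X.isClosed'.preimage continuous_entry12).inter
      ((X.isClosed'.preimage ?_).inter (isClosed_eq continuous_entry22 continuous_const)))
  exact (adjoint : (K →L[ℂ] H) ≃ₗᵢ⋆[ℂ] (H →L[ℂ] K)).continuous.comp continuous_entry21

variable {X : TRO H K}

theorem TRO.offDiag_le_linkingAlgebra {T : DirSum H K →L[ℂ] DirSum H K} (hT : T ∈ X.offDiag) :
    T ∈ X.linkingAlgebra := by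
  refine ⟨?_, hT.2.1, hT.2.2.1, ?_⟩
  · rw [hT.1]; exact zero_mem _
  · rw [hT.2.2.2]; exact zero_mem _

theorem TRO.star_mem_offDiag {T : DirSum H K →L[ℂ] DirSum H K} (hT : T ∈ X.offDiag) :
    star T ∈ X.offDiag := by
  refine ⟨?_, ?_, ?_, ?_⟩
  · rw [entry11_star, hT.1, map_zero]
  · rw [entry12_star]; exact hT.2.2.1
  · rw [entry21_star, adjoint_adjoint]; exact hT.2.1
  · rw [entry22_star, hT.2.2.2, map_zero]

theorem TRO.mul_mul_mem_offDiag {S T U : DirSum H K →L[ℂ] DirSum H K} (hS : S ∈ X.offDiag)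
    (hT : T ∈ X.offDiag) (hU : U ∈ X.offDiag) : S * T * U ∈ X.offDiag := by
  obtain ⟨s1, s2, s3, s4⟩ := hS
  obtain ⟨t1, t2, t3, t4⟩ := hT
  obtain ⟨u1, u2, u3, u4⟩ := hU
  refine ⟨?_, ?_, ?_, ?_⟩
  · simp [entry11_mul, entry12_mul, s1, t1, t4, u1]
  · simpa [entry11_mul, entry12_mul, s1, t1, t4, u4, comp_assoc] using X.ternary_mem' s2 t3 u2
  · simpa [entry21_mul, entry22_mul, s4, t1, t4, u1, comp_assoc, adjoint_comp] using
      X.ternary_mem' u3 t2 s3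
  · simp [entry21_mul, entry22_mul, s4, t1, t4, u4]

theorem TRO.corner_mem_offDiag {x : H →L[ℂ] K} (hx : x ∈ X.toSubmodule) :
    corner x ∈ X.offDiag := by
  refine ⟨entry11_corner x, ?_, ?_, entry22_corner x⟩
  · rwa [entry12_corner]
  · rw [entry21_corner, map_zero]; exact zero_mem _

end OffDiagonal

/-! ### Matrix entries of elements of the linking von Neumann algebra. -/

section LinkingVN

variable {H K : Type*}
  [NormedAddCommGroup H] [InnerProductSpace ℂ H] [CompleteSpace H]
  [NormedAddCommGroup K] [InnerProductSpace ℂ K] [CompleteSpace K]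
  {X : WStarTRO H K} {T : DirSum H K →L[ℂ] DirSum H K}

namespace WStarTRO

/-- Taking an entry is weak*-continuous and `X` is weak*-closed, so a property of `A_X` passes to
its weak* closure. The corner of `R_X` is thus no larger than `X`; the two lemmas that follow use
the same argument. -/
theorem entry12_mem (hT : T ∈ X.linkingVN) : entry12 T ∈ X.toSubmodule :=
  doubleCommutant_subset_of_isClosed X.linkingAlgebra
    (@IsClosed.preimage _ _ (weakStarTopology _ _) (weakStarTopology _ _) _
      continuous_weakStar_entry12 _ X.isWeakStarClosed') (fun _ ha => ha.2.1) hT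

theorem entry11_comp_mem (hT : T ∈ X.linkingVN) {x : H →L[ℂ] K} (hx : x ∈ X.toSubmodule) :
    entry11 T ∘L x ∈ X.toSubmodule :=
  doubleCommutant_subset_of_isClosed X.linkingAlgebra
    (@IsClosed.preimage _ _ (weakStarTopology _ _) (weakStarTopology _ _) _
      (@Continuous.comp _ _ _ (weakStarTopology _ _) (weakStarTopology _ _) (weakStarTopology _ _)
        _ _ (continuous_weakStar_comp_right x) continuous_weakStar_entry11)
      _ X.isWeakStarClosed') (fun _ ha => TRO.leftSpan_comp_mem ha.1 hx) hT

theorem comp_entry22_mem (hT : T ∈ X.linkingVN) {x : H →L[ℂ] K} (hx : x ∈ X.toSubmodule) :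
    x ∘L entry22 T ∈ X.toSubmodule :=
  doubleCommutant_subset_of_isClosed X.linkingAlgebra
    (@IsClosed.preimage _ _ (weakStarTopology _ _) (weakStarTopology _ _) _
      (@Continuous.comp _ _ _ (weakStarTopology _ _) (weakStarTopology _ _) (weakStarTopology _ _)
        _ _ (continuous_weakStar_comp_left x) continuous_weakStar_entry22)
      _ X.isWeakStarClosed') (fun _ ha => TRO.comp_rightSpan_mem ha.2.2.2 hx) hT

theorem adjoint_entry21_mem (hT : T ∈ X.linkingVN) : adjoint (entry21 T) ∈ X.toSubmodule := by
  rw [← entry12_star]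
  exact entry12_mem (star_mem hT)

theorem offPart_mem (hT : T ∈ X.linkingVN) : offPart T ∈ X.offDiag := by
  refine ⟨entry11_offPart T, ?_, ?_, entry22_offPart T⟩
  · rw [entry12_offPart]; exact entry12_mem hT
  · rw [entry21_offPart]; exact adjoint_entry21_mem hT

theorem diagPart_mul_mem (hT : T ∈ X.linkingVN) {x : DirSum H K →L[ℂ] DirSum H K}
    (hx : x ∈ X.offDiag) : diagPart T * x ∈ X.offDiag := by
  refine ⟨?_, ?_, ?_, ?_⟩
  · simp [entry11_mul, hx.1, entry12_diagPart]
  · simpa [entry12_mul, hx.2.2.2, entry11_diagPart] using entry11_comp_mem hT hx.2.1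
  · have := comp_entry22_mem (star_mem hT) hx.2.2.1
    rw [entry22_star] at this
    simpa [entry21_mul, hx.1, entry22_diagPart, adjoint_comp] using this
  · simp [entry22_mul, hx.2.2.2, entry21_diagPart]

/-- The diagonal entries of `R_X` are handled only through their action on `X` and `X*`, which is
all that the representation of multipliers requires. -/
theorem diagPart_mem (hT : T ∈ X.linkingVN) : diagPart T ∈ leftMultipliers X.offDiag := by
  intro x hx
  rw [← diagPart_star]
  exact ⟨diagPart_mul_mem hT hx, diagPart_mul_mem (star_mem hT) hx⟩

theorem mul_mem_leftMultipliers {S T : DirSum H K →L[ℂ] DirSum H K} (hS : S ∈ X.offDiag)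
    (hT : T ∈ X.offDiag) : S * T ∈ leftMultipliers X.offDiag := by
  intro x hx
  rw [star_mul]
  exact ⟨TRO.mul_mul_mem_offDiag hS hT hx,
    TRO.mul_mul_mem_offDiag (TRO.star_mem_offDiag hT) (TRO.star_mem_offDiag hS) hx⟩

end WStarTRO

end LinkingVN

/-! ### The ternary map on off-diagonal operators induced by `α`. -/

section HatMap

variable {H₁ K₁ H₂ K₂ : Type*}
  [NormedAddCommGroup H₁] [InnerProductSpace ℂ H₁] [CompleteSpace H₁]
  [NormedAddCommGroup K₁] [InnerProductSpace ℂ K₁] [CompleteSpace K₁]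
  [NormedAddCommGroup H₂] [InnerProductSpace ℂ H₂] [CompleteSpace H₂]
  [NormedAddCommGroup K₂] [InnerProductSpace ℂ K₂] [CompleteSpace K₂]
  {X : WStarTRO H₁ K₁} {Y : WStarTRO H₂ K₂}

/-- The self-adjoint ternary map `(0 x; y* 0) ↦ (0 α(x); α(y)* 0)` induced by `α`. -/
def offDiagMap (α : X.toSubmodule →ₗ[ℂ] Y.toSubmodule) :
    X.offDiag →ₗ[ℂ] (DirSum H₂ K₂ →L[ℂ] DirSum H₂ K₂) where
  toFun T := corner (α ⟨entry12 T.1, T.2.2.1⟩).1 +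
    star (corner (α ⟨adjoint (entry21 T.1), T.2.2.2.1⟩).1)
  map_add' S T := by
    have h1 : (⟨entry12 (S + T).1, (S + T).2.2.1⟩ : X.toSubmodule) =
        ⟨entry12 S.1, S.2.2.1⟩ + ⟨entry12 T.1, T.2.2.1⟩ := Subtype.ext (entry12_add _ _)
    have h2 : (⟨adjoint (entry21 (S + T).1), (S + T).2.2.2.1⟩ : X.toSubmodule) =
        ⟨adjoint (entry21 S.1), S.2.2.2.1⟩ + ⟨adjoint (entry21 T.1), T.2.2.2.1⟩ :=
      Subtype.ext (by
        change adjoint (entry21 (S.1 + T.1)) = _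
        rw [entry21_add, map_add]; rfl)
    rw [h1, h2, map_add, map_add, Submodule.coe_add, Submodule.coe_add, corner_add, corner_add,
      star_add]
    abel
  map_smul' c T := by
    have h1 : (⟨entry12 (c • T).1, (c • T).2.2.1⟩ : X.toSubmodule) =
        c • ⟨entry12 T.1, T.2.2.1⟩ := Subtype.ext (entry12_smul _ _)
    have h2 : (⟨adjoint (entry21 (c • T).1), (c • T).2.2.2.1⟩ : X.toSubmodule) =
        star c • ⟨adjoint (entry21 T.1), T.2.2.2.1⟩ :=
      Subtype.ext (by
        change adjoint (entry21 (c • T.1)) = _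
        rw [entry21_smul, map_smulₛₗ]; rfl)
    rw [h1, h2, map_smul, map_smul, Submodule.coe_smul, Submodule.coe_smul, corner_smul,
      corner_smul, star_smul, star_star, RingHom.id_apply, smul_add]

variable (α : X.toSubmodule →ₗ[ℂ] Y.toSubmodule)

theorem entry11_offDiagMap (T : X.offDiag) : entry11 (offDiagMap α T) = 0 := by
  simp [offDiagMap, entry11_add, entry11_corner, entry11_star_corner]
theorem entry12_offDiagMap (T : X.offDiag) :
    entry12 (offDiagMap α T) = (α ⟨entry12 T.1, T.2.2.1⟩).1 := by
  simp [offDiagMap, entry12_add, entry12_corner, entry12_star_corner]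
theorem entry21_offDiagMap (T : X.offDiag) :
    entry21 (offDiagMap α T) = adjoint (α ⟨adjoint (entry21 T.1), T.2.2.2.1⟩).1 := by
  simp [offDiagMap, entry21_add, entry21_corner, entry21_star_corner]
theorem entry22_offDiagMap (T : X.offDiag) : entry22 (offDiagMap α T) = 0 := by
  simp [offDiagMap, entry22_add, entry22_corner, entry22_star_corner]

theorem offDiagMap_mem (T : X.offDiag) : offDiagMap α T ∈ Y.offDiag := by
  refine ⟨entry11_offDiagMap α T, ?_, ?_, entry22_offDiagMap α T⟩
  · rw [entry12_offDiagMap]; exact Subtype.mem _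
  · rw [entry21_offDiagMap, adjoint_adjoint]; exact Subtype.mem _

theorem offDiagMap_star (T : X.offDiag) :
    offDiagMap α ⟨star T.1, TRO.star_mem_offDiag T.2⟩ = star (offDiagMap α T) := by
  have h1 : ∀ h, (⟨entry12 (star T.1), h⟩ : X.toSubmodule) =
      ⟨adjoint (entry21 T.1), T.2.2.2.1⟩ := fun h => Subtype.ext (entry12_star _)
  have h2 : ∀ h, (⟨adjoint (entry21 (star T.1)), h⟩ : X.toSubmodule) =
      ⟨entry12 T.1, T.2.2.1⟩ := fun h => Subtype.ext (by
        change adjoint (entry21 (star T.1)) = _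
        rw [entry21_star, adjoint_adjoint])
  apply ext_entries
  · simp [entry11_offDiagMap, entry11_star]
  · rw [entry12_star (offDiagMap α T), entry21_offDiagMap, adjoint_adjoint, entry12_offDiagMap]
    exact congrArg (fun x => (α x).1) (h1 _)
  · rw [entry21_star (offDiagMap α T), entry12_offDiagMap, entry21_offDiagMap]
    exact congrArg (fun x => adjoint (α x).1) (h2 _)
  · simp [entry22_offDiagMap, entry22_star]

theorem offDiagMap_mul_mul {α : X.toSubmodule →ₗ[ℂ] Y.toSubmodule} (hα : IsNormalTROMorphism α)
    (S T U : X.offDiag) :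
    offDiagMap α ⟨S.1 * T.1 * U.1, TRO.mul_mul_mem_offDiag S.2 T.2 U.2⟩ =
      offDiagMap α S * offDiagMap α T * offDiagMap α U := by
  have ht : ∀ x y z w : X.toSubmodule, w.1 = x.1 ∘L adjoint y.1 ∘L z.1 →
      (α w).1 = (α x).1 ∘L adjoint (α y).1 ∘L (α z).1 := by
    intro x y z w hw
    have : w = X.ternary x y z := Subtype.ext hw
    rw [this, hα.map_ternary]
    rfl
  obtain ⟨S, s1, s2, s3, s4⟩ := S
  obtain ⟨T, t1, t2, t3, t4⟩ := T
  obtain ⟨U, u1, u2, u3, u4⟩ := U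
  apply ext_entries
  · simp [entry11_offDiagMap, entry12_offDiagMap, entry21_offDiagMap, entry22_offDiagMap,
      entry11_mul, entry12_mul]
  · simp only [entry11_offDiagMap, entry12_offDiagMap, entry21_offDiagMap, entry22_offDiagMap,
      entry11_mul, entry12_mul]
    rw [ht ⟨entry12 S, s2⟩ ⟨adjoint (entry21 T), t3⟩ ⟨entry12 U, u2⟩]
    · simp [comp_assoc]
    · simp [s1, t1, t4, u4, comp_assoc]
  · simp only [entry11_offDiagMap, entry12_offDiagMap, entry21_offDiagMap, entry22_offDiagMap,
      entry21_mul, entry22_mul]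
    rw [ht ⟨adjoint (entry21 U), u3⟩ ⟨entry12 T, t2⟩ ⟨adjoint (entry21 S), s3⟩]
    · simp [comp_assoc, adjoint_comp]
    · simp [s4, t1, t4, u1, comp_assoc, adjoint_comp]
  · simp [entry11_offDiagMap, entry12_offDiagMap, entry21_offDiagMap, entry22_offDiagMap,
      entry21_mul, entry22_mul]

theorem IsNormalTROMorphism.isTernaryMap_offDiagMap {α : X.toSubmodule →ₗ[ℂ] Y.toSubmodule}
    (hα : IsNormalTROMorphism α) : IsTernaryMap (offDiagMap α) := by
  intro x y z
  refine ⟨⟨x.1 * star y.1 * z.1,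
    TRO.mul_mul_mem_offDiag x.2 (TRO.star_mem_offDiag y.2) z.2⟩, rfl, ?_⟩
  rw [← offDiagMap_star]
  exact offDiagMap_mul_mul hα x ⟨star y.1, _⟩ z

theorem continuous_weakStar_offDiagMap {α : X.toSubmodule →ₗ[ℂ] Y.toSubmodule}
    (hα : IsNormalTROMorphism α) {Z : Type*} {t : TopologicalSpace Z} {G : Z → X.offDiag}
    (hG : @Continuous _ _ t (weakStarTopology _ _) fun z => (G z).1) :
    @Continuous _ _ t (weakStarTopology _ _) fun z => offDiagMap α (G z) := by
  have hα' : ∀ g : Z → X.toSubmodule,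
      @Continuous _ _ t (weakStarTopology _ _) (fun z => (g z).1) →
      @Continuous _ _ t (weakStarTopology _ _) (fun z => (α (g z)).1) := by
    intro g hg
    have h1 : @Continuous _ _ t (relWeakStar (X.toSubmodule : Set (H₁ →L[ℂ] K₁))) g :=
      continuous_induced_rng.2 hg
    have h2 := @Continuous.comp _ _ _ t (relWeakStar (X.toSubmodule : Set (H₁ →L[ℂ] K₁)))
      (relWeakStar (Y.toSubmodule : Set (H₂ →L[ℂ] K₂))) _ _ hα.normal h1
    exact continuous_induced_rng.1 h2
  have hc := @Continuous.comp _ _ _ t (weakStarTopology _ _) (weakStarTopology _ _) _ _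
    continuous_weakStar_entry12 hG
  have hd := @Continuous.comp _ _ _ t (weakStarTopology _ _) (weakStarTopology _ _) _ _
    continuous_weakStar_adjoint (@Continuous.comp _ _ _ t (weakStarTopology _ _)
      (weakStarTopology _ _) _ _ continuous_weakStar_entry21 hG)
  refine continuous_weakStar_add ?_ ?_
  · exact @Continuous.comp _ _ _ t (weakStarTopology _ _) (weakStarTopology _ _) _ corner
      continuous_weakStar_corner (hα' (fun z => ⟨entry12 (G z).1, (G z).2.2.1⟩) hc)
  · exact @Continuous.comp _ _ _ t (weakStarTopology _ _) (weakStarTopology _ _) _ _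
      continuous_weakStar_adjoint (@Continuous.comp _ _ _ t (weakStarTopology _ _)
        (weakStarTopology _ _) _ corner continuous_weakStar_corner
        (hα' (fun z => ⟨adjoint (entry21 (G z).1), (G z).2.2.2.1⟩) hd))

end HatMap

/-! ### Construction of the normal extension. -/

section Existence

variable {H₁ K₁ H₂ K₂ : Type*}
  [NormedAddCommGroup H₁] [InnerProductSpace ℂ H₁] [CompleteSpace H₁]
  [NormedAddCommGroup K₁] [InnerProductSpace ℂ K₁] [CompleteSpace K₁]
  [NormedAddCommGroup H₂] [InnerProductSpace ℂ H₂] [CompleteSpace H₂]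
  [NormedAddCommGroup K₂] [InnerProductSpace ℂ K₂] [CompleteSpace K₂]
  {X : WStarTRO H₁ K₁} {Y : WStarTRO H₂ K₂}

namespace WStarTRO

/-- The block diagonal part of an element of `R_X`, as a multiplier. -/
def diagOf (T : X.linkingVN) : leftMultipliers X.offDiag := ⟨diagPart T.1, diagPart_mem T.2⟩

/-- The block off-diagonal part of an element of `R_X`. -/
def offOf (T : X.linkingVN) : X.offDiag := ⟨offPart T.1, offPart_mem T.2⟩

end WStarTRO

open WStarTRO

/-- The product of two off-diagonal operators, as a multiplier. -/
def offMul (x y : X.offDiag) : leftMultipliers X.offDiag :=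
  ⟨x.1 * y.1, mul_mem_leftMultipliers x.2 y.2⟩

/-- The image of `offDiagMap α` is self-adjoint, so a vector orthogonal to all the ranges lies in
all the kernels. -/
theorem offDiagMap_apply_eq_zero (α : X.toSubmodule →ₗ[ℂ] Y.toSubmodule) {v : DirSum H₂ K₂}
    (hv : ∀ x h, inner ℂ (offDiagMap α x h) v = 0) (y : X.offDiag) : offDiagMap α y v = 0 := by
  refine ext_inner_left ℂ fun w => ?_
  rw [inner_zero_right, ← adjoint_inner_left, ← star_eq_adjoint, ← offDiagMap_star]
  exact hv _ w

/-- Consistency of the two pieces of the extension: a product of two off-diagonal operators is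
diagonal, and `π` sends it to the product of the images because `f(xyz) = f(x)f(y)f(z)`. -/
theorem IsNormalTROMorphism.leftRep_offMul {α : X.toSubmodule →ₗ[ℂ] Y.toSubmodule}
    (hα : IsNormalTROMorphism α)
    {π : leftMultipliers X.offDiag →⋆ₙₐ[ℂ] (DirSum H₂ K₂ →L[ℂ] DirSum H₂ K₂)}
    (hπ : ∀ d x h, π d (offDiagMap α x h) = offDiagMap α (mulLeftOf d x) h)
    (hπ0 : ∀ d v, (∀ x h, inner ℂ (offDiagMap α x h) v = 0) → π d v = 0) (x y : X.offDiag) :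
    π (offMul x y) = offDiagMap α x * offDiagMap α y := by
  refine eq_of_map_apply_eq (offDiagMap α) (fun z h => ?_) fun v hv => ?_
  · rw [hπ]
    exact congrArg (fun S : DirSum H₂ K₂ →L[ℂ] DirSum H₂ K₂ => S h) (offDiagMap_mul_mul hα x y z)
  · rw [hπ0 _ v hv, mul_apply_eq_comp, offDiagMap_apply_eq_zero α hv, map_zero]

theorem IsNormalTROMorphism.leftRep_diagOf_mul {α : X.toSubmodule →ₗ[ℂ] Y.toSubmodule}
    (hα : IsNormalTROMorphism α)
    {π : leftMultipliers X.offDiag →⋆ₙₐ[ℂ] (DirSum H₂ K₂ →L[ℂ] DirSum H₂ K₂)}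
    (hπ : ∀ d x h, π d (offDiagMap α x h) = offDiagMap α (mulLeftOf d x) h)
    (hπ0 : ∀ d v, (∀ x h, inner ℂ (offDiagMap α x h) v = 0) → π d v = 0) (S T : X.linkingVN) :
    π (diagOf (S * T)) =
      π (diagOf S) * π (diagOf T) + offDiagMap α (offOf S) * offDiagMap α (offOf T) := by
  have h1 : diagOf (S * T) = diagOf S * diagOf T + offMul (offOf S) (offOf T) :=
    Subtype.ext (diagPart_mul S.1 T.1)
  rw [h1, map_add, map_mul, hα.leftRep_offMul hπ hπ0]

theorem leftRep_mul_offDiagMap {α : X.toSubmodule →ₗ[ℂ] Y.toSubmodule}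
    {π : leftMultipliers X.offDiag →⋆ₙₐ[ℂ] (DirSum H₂ K₂ →L[ℂ] DirSum H₂ K₂)}
    (hπ : ∀ d x h, π d (offDiagMap α x h) = offDiagMap α (mulLeftOf d x) h)
    (d : leftMultipliers X.offDiag) (x : X.offDiag) :
    π d * offDiagMap α x = offDiagMap α (mulLeftOf d x) :=
  ContinuousLinearMap.ext (hπ d x)

/-- Right multiplication of an off-diagonal operator by a multiplier. -/
def mulRightOf (x : X.offDiag) (d : leftMultipliers X.offDiag) : X.offDiag :=
  ⟨star (mulLeftOf (star d) ⟨star x.1, TRO.star_mem_offDiag x.2⟩).1,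
    TRO.star_mem_offDiag (Subtype.mem _)⟩

/-- Right multiplication is the adjoint of left multiplication, so it needs no separate
representation. -/
theorem offDiagMap_mulRightOf {α : X.toSubmodule →ₗ[ℂ] Y.toSubmodule}
    {π : leftMultipliers X.offDiag →⋆ₙₐ[ℂ] (DirSum H₂ K₂ →L[ℂ] DirSum H₂ K₂)}
    (hπ : ∀ d x h, π d (offDiagMap α x h) = offDiagMap α (mulLeftOf d x) h)
    (x : X.offDiag) (d : leftMultipliers X.offDiag) :
    offDiagMap α (mulRightOf x d) = offDiagMap α x * π d := by
  rw [mulRightOf, offDiagMap_star, ← leftRep_mul_offDiagMap hπ, offDiagMap_star, star_mul,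
    star_star, map_star, star_star]

theorem offDiagMap_offOf_mul {α : X.toSubmodule →ₗ[ℂ] Y.toSubmodule}
    {π : leftMultipliers X.offDiag →⋆ₙₐ[ℂ] (DirSum H₂ K₂ →L[ℂ] DirSum H₂ K₂)}
    (hπ : ∀ d x h, π d (offDiagMap α x h) = offDiagMap α (mulLeftOf d x) h) (S T : X.linkingVN) :
    offDiagMap α (offOf (S * T)) =
      π (diagOf S) * offDiagMap α (offOf T) + offDiagMap α (offOf S) * π (diagOf T) := by
  have h2 : offOf (S * T) = mulLeftOf (diagOf S) (offOf T) + mulRightOf (offOf S) (diagOf T) := by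
    apply Subtype.ext
    change offPart (S.1 * T.1) = diagPart S.1 * offPart T.1 +
      star (star (diagPart T.1) * star (offPart S.1))
    rw [star_mul, star_star, star_star, offPart_mul]
  rw [h2, map_add, leftRep_mul_offDiagMap hπ, offDiagMap_mulRightOf hπ]

/-- The linking extension, as a representation of `R_X`. -/
def linkingRep {α : X.toSubmodule →ₗ[ℂ] Y.toSubmodule} (hα : IsNormalTROMorphism α)
    (π : leftMultipliers X.offDiag →⋆ₙₐ[ℂ] (DirSum H₂ K₂ →L[ℂ] DirSum H₂ K₂))
    (hπ : ∀ d x h, π d (offDiagMap α x h) = offDiagMap α (mulLeftOf d x) h)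
    (hπ0 : ∀ d v, (∀ x h, inner ℂ (offDiagMap α x h) v = 0) → π d v = 0) :
    X.linkingVN →⋆ₙₐ[ℂ] (DirSum H₂ K₂ →L[ℂ] DirSum H₂ K₂) where
  toFun T := π (diagOf T) + offDiagMap α (offOf T)
  map_smul' c T := by
    have h1 : diagOf (c • T) = c • diagOf T := Subtype.ext (diagPart_smul c T.1)
    have h2 : offOf (c • T) = c • offOf T := Subtype.ext (offPart_smul c T.1)
    rw [h1, h2, map_smul, map_smul, ← smul_add]; rfl
  map_zero' := by
    have h1 : diagOf (0 : X.linkingVN) = 0 := Subtype.ext (by simp [diagOf, diagPart])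
    have h2 : offOf (0 : X.linkingVN) = 0 := Subtype.ext (by simp [offOf, offPart])
    rw [h1, h2, map_zero, map_zero, add_zero]
  map_add' S T := by
    have h1 : diagOf (S + T) = diagOf S + diagOf T := Subtype.ext (diagPart_add S.1 T.1)
    have h2 : offOf (S + T) = offOf S + offOf T := Subtype.ext (offPart_add S.1 T.1)
    rw [h1, h2, map_add, map_add]; abel
  map_mul' S T := by
    rw [hα.leftRep_diagOf_mul hπ hπ0, offDiagMap_offOf_mul hπ, add_mul, mul_add, mul_add]
    abel
  map_star' T := by
    have h1 : diagOf (star T) = star (diagOf T) := Subtype.ext (diagPart_star T.1)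
    have h2 : offOf (star T) = ⟨star (offOf T).1, TRO.star_mem_offDiag (offOf T).2⟩ :=
      Subtype.ext (offPart_star T.1)
    rw [h1, h2, map_star, offDiagMap_star, star_add]

/-- An operator `c` commuting with `A_Y` commutes with every `f(x)`, so `c π(d) f(x)h = f(dx) c h =
π(d) c f(x)h`. On the common kernel of `A_Y`, which is orthogonal to all `f(x)h`, the operator
`π(d)` vanishes. -/
theorem leftRep_mem_linkingVN {α : X.toSubmodule →ₗ[ℂ] Y.toSubmodule}
    {π : leftMultipliers X.offDiag →⋆ₙₐ[ℂ] (DirSum H₂ K₂ →L[ℂ] DirSum H₂ K₂)}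
    (hπ : ∀ d x h, π d (offDiagMap α x h) = offDiagMap α (mulLeftOf d x) h)
    (hπ0 : ∀ d v, (∀ x h, inner ℂ (offDiagMap α x h) v = 0) → π d v = 0)
    (d : leftMultipliers X.offDiag) : π d ∈ Y.linkingVN := by
  have hmem : ∀ x, offDiagMap α x ∈ Y.linkingAlgebra := fun x =>
    TRO.offDiag_le_linkingAlgebra (offDiagMap_mem α x)
  constructor
  · intro c hc
    have hcx : ∀ x h, c (offDiagMap α x h) = offDiagMap α x (c h) := fun x h =>
      (congrArg (fun S : DirSum H₂ K₂ →L[ℂ] DirSum H₂ K₂ => S h) (hc _ (hmem x))).symm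
    refine eq_of_map_apply_eq (offDiagMap α) (fun x h => ?_) fun v hv => ?_
    · rw [mul_apply_eq_comp, mul_apply_eq_comp, hcx, hπ, hπ, hcx]
    · rw [mul_apply_eq_comp, mul_apply_eq_comp, hπ0 d v hv, map_zero, hπ0]
      -- `c v` remains orthogonal to all `f(x)h`: `f(x)*` is again in the image of `f`, so it
      -- commutes with `c` and kills `v`.
      intro x h
      rw [← adjoint_inner_right, ← star_eq_adjoint, ← offDiagMap_star, ← hcx,
        offDiagMap_apply_eq_zero α hv, map_zero, inner_zero_right]
  · intro v hv
    refine hπ0 d v fun x h => ?_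
    rw [← adjoint_inner_right, ← star_eq_adjoint, mem_commonKer.1 hv _ (star_mem (hmem x)),
      inner_zero_right]

theorem IsNormalTROMorphism.exists_normalExtension {α : X.toSubmodule →ₗ[ℂ] Y.toSubmodule}
    (hα : IsNormalTROMorphism α) :
    ∃ β : X.linkingVN →⋆ₙₐ[ℂ] Y.linkingVN, IsNormalExtension α β := by
  obtain ⟨π, hπ, hπ0⟩ := hα.isTernaryMap_offDiagMap.exists_leftRep X.isClosed_offDiag
  have hmem : ∀ T, linkingRep hα π hπ hπ0 T ∈ Y.linkingVN := fun T =>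
    add_mem (leftRep_mem_linkingVN hπ hπ0 _)
      (le_doubleCommutant _ (TRO.offDiag_le_linkingAlgebra (offDiagMap_mem α _)))
  refine ⟨NonUnitalStarAlgHom.codRestrict (linkingRep hα π hπ hπ0) _ hmem, ⟨?_, fun x => ?_⟩⟩
  · refine continuous_induced_rng.2 ?_
    -- For `v = f(x)h`, the diagonal functional is `⟨v, f(dx)h⟩ + ⟨v, f(o)v⟩` with `d` and `o` the
    -- diagonal and off-diagonal parts of `T`. Only `f` occurs, so normality of `α` suffices.
    refine continuous_weakStar_of_vector_functionals (linkingRep hα π hπ hπ0)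
      {v | ∃ x h, offDiagMap α x h = v} ?_ ?_
    · rintro _ ⟨x, h, rfl⟩
      have hval : @Continuous _ _ (relWeakStar
          (X.linkingVN : Set (DirSum H₁ K₁ →L[ℂ] DirSum H₁ K₁))) (weakStarTopology _ _)
        (fun T : X.linkingVN => T.1) := continuous_induced_dom
      have h1 : @Continuous _ _ (relWeakStar
          (X.linkingVN : Set (DirSum H₁ K₁ →L[ℂ] DirSum H₁ K₁))) (weakStarTopology _ _)
          fun T : X.linkingVN => offDiagMap α (mulLeftOf (diagOf T) x) := by
        refine continuous_weakStar_offDiagMap hα ?_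
        exact @Continuous.comp _ _ _ (relWeakStar
          (X.linkingVN : Set (DirSum H₁ K₁ →L[ℂ] DirSum H₁ K₁))) (weakStarTopology _ _)
          (weakStarTopology _ _) _ _ (continuous_weakStar_comp_right x.1)
          (@Continuous.comp _ _ _ (relWeakStar
          (X.linkingVN : Set (DirSum H₁ K₁ →L[ℂ] DirSum H₁ K₁))) (weakStarTopology _ _)
          (weakStarTopology _ _) _ _ continuous_weakStar_diagPart hval)
      have h2 : @Continuous _ _ (relWeakStar
          (X.linkingVN : Set (DirSum H₁ K₁ →L[ℂ] DirSum H₁ K₁))) (weakStarTopology _ _)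
          fun T : X.linkingVN => offDiagMap α (offOf T) := by
        refine continuous_weakStar_offDiagMap hα ?_
        exact @Continuous.comp _ _ _ (relWeakStar
          (X.linkingVN : Set (DirSum H₁ K₁ →L[ℂ] DirSum H₁ K₁))) (weakStarTopology _ _)
          (weakStarTopology _ _) _ _ continuous_weakStar_offPart hval
      have h3 := @Continuous.comp _ _ _ (relWeakStar
          (X.linkingVN : Set (DirSum H₁ K₁ →L[ℂ] DirSum H₁ K₁))) (weakStarTopology _ _)
        _ _ _ (continuous_weakStar_inner h (offDiagMap α x h)) h1
      have h4 := @Continuous.comp _ _ _ (relWeakStar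
          (X.linkingVN : Set (DirSum H₁ K₁ →L[ℂ] DirSum H₁ K₁))) (weakStarTopology _ _)
        _ _ _ (continuous_weakStar_inner (offDiagMap α x h) (offDiagMap α x h)) h2
      refine (@continuous_congr _ _ (relWeakStar
          (X.linkingVN : Set (DirSum H₁ K₁ →L[ℂ] DirSum H₁ K₁))) _ _ _ fun T => ?_).1
        (@Continuous.add _ _ _ _ _ (relWeakStar
          (X.linkingVN : Set (DirSum H₁ K₁ →L[ℂ] DirSum H₁ K₁))) _ _ h3 h4)
      change _ = inner ℂ _ ((π (diagOf T) + offDiagMap α (offOf T)) (offDiagMap α x h))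
      rw [add_apply, inner_add_right, hπ]
      rfl
    · intro v hv T
      have hv' : ∀ x h, inner ℂ (offDiagMap α x h) v = 0 := fun x h => hv _ ⟨x, h, rfl⟩
      change (π (diagOf T) + offDiagMap α (offOf T)) v = 0
      rw [add_apply, hπ0 _ v hv', offDiagMap_apply_eq_zero α hv', add_zero]
  · apply Subtype.ext
    change π (diagOf (X.toLinkingVN x)) + offDiagMap α (offOf (X.toLinkingVN x)) = corner (α x).1
    have h1 : diagOf (X.toLinkingVN x) = 0 := by
      apply Subtype.ext
      change diagPart (corner x.1) = 0
      apply ext_entries <;> simp [entry11_diagPart, entry12_diagPart, entry21_diagPart,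
        entry22_diagPart, entry11_corner, entry22_corner, entry11_zero, entry12_zero,
        entry21_zero, entry22_zero]
    have h2 : offOf (X.toLinkingVN x) = ⟨corner x.1, TRO.corner_mem_offDiag x.2⟩ := by
      apply Subtype.ext
      change offPart (corner x.1) = corner x.1
      apply ext_entries <;> simp [entry11_offPart, entry12_offPart, entry21_offPart,
        entry22_offPart, entry11_corner, entry22_corner]
    rw [h1, h2, map_zero, zero_add]
    apply ext_entries
    · rw [entry11_offDiagMap, entry11_corner]
    · rw [entry12_offDiagMap, entry12_corner (α x).1]
      exact congrArg (fun y => (α y).1) (Subtype.ext (entry12_corner x.1))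
    · rw [entry21_offDiagMap, entry21_corner (α x).1]
      have : (⟨adjoint (entry21 (corner x.1)), (TRO.corner_mem_offDiag x.2).2.2.1⟩ :
          X.toSubmodule) = 0 := Subtype.ext (by
        change adjoint (entry21 (corner x.1)) = 0
        rw [entry21_corner, map_zero])
      exact (congrArg (fun y => adjoint (α y).1) this).trans (by simp)
    · rw [entry22_offDiagMap, entry22_corner]

end Existence

/-! ### Generation of the linking C*-algebra by its corner. -/

section Generation

variable {H K : Type*}
  [NormedAddCommGroup H] [InnerProductSpace ℂ H] [CompleteSpace H]
  [NormedAddCommGroup K] [InnerProductSpace ℂ K] [CompleteSpace K]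

theorem TRO.isClosed_linkingAlgebra (X : TRO H K) :
    IsClosed (X.linkingAlgebra : Set (DirSum H K →L[ℂ] DirSum H K)) := by
  refine (TRO.leftSpan_isClosed.preimage continuous_entry11).inter
    ((X.isClosed'.preimage continuous_entry12).inter
      ((X.isClosed'.preimage ?_).inter (TRO.rightSpan_isClosed.preimage continuous_entry22)))
  exact (adjoint : (K →L[ℂ] H) ≃ₗᵢ⋆[ℂ] (H →L[ℂ] K)).continuous.comp continuous_entry21

/-- The linking C*-algebra is the closed linear span of the corners and their products. -/
theorem TRO.mem_of_mem_linkingAlgebra {X : TRO H K}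
    {N : Submodule ℂ (DirSum H K →L[ℂ] DirSum H K)}
    (hN : IsClosed (N : Set (DirSum H K →L[ℂ] DirSum H K)))
    (h : ∀ x ∈ X.toSubmodule, corner x ∈ N) (h' : ∀ x ∈ X.toSubmodule, star (corner x) ∈ N)
    (hl : ∀ x ∈ X.toSubmodule, ∀ y ∈ X.toSubmodule, corner x * star (corner y) ∈ N)
    (hr : ∀ x ∈ X.toSubmodule, ∀ y ∈ X.toSubmodule, star (corner x) * corner y ∈ N)
    {T : DirSum H K →L[ℂ] DirSum H K} (hT : T ∈ X.linkingAlgebra) : T ∈ N := by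
  have h11 : ∀ a ∈ X.leftSpan, inK H K ∘L a ∘L prK H K ∈ N := by
    intro a ha
    refine TRO.leftSpan_induction (P := fun a => inK H K ∘L a ∘L prK H K ∈ N) ?_ ?_ ?_ ?_ ?_ ha
    · exact hN.preimage
        (by fun_prop : Continuous fun a : K →L[ℂ] K => inK H K ∘L a ∘L prK H K)
    · simp
    · intro a b h g; rw [add_comp, comp_add]; exact add_mem h g
    · intro c a h; rw [smul_comp, comp_smul]; exact N.smul_mem c h
    · intro x hx y hy
      have := hl x hx y hy
      convert this using 1
      apply ext_entries <;> ext <;>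
        simp [entry11, entry12, entry21, entry22, corner, star_eq_adjoint, adjoint_comp,
          adjoint_inK, adjoint_prH, prK_inK, prK_inH, prH_inK, prH_inH]
  have h22 : ∀ b ∈ X.rightSpan, inH H K ∘L b ∘L prH H K ∈ N := by
    intro b hb
    refine TRO.rightSpan_induction (P := fun b => inH H K ∘L b ∘L prH H K ∈ N) ?_ ?_ ?_ ?_ ?_ hb
    · exact hN.preimage
        (by fun_prop : Continuous fun b : H →L[ℂ] H => inH H K ∘L b ∘L prH H K)
    · simp
    · intro a b h g; rw [add_comp, comp_add]; exact add_mem h g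
    · intro c a h; rw [smul_comp, comp_smul]; exact N.smul_mem c h
    · intro x hx y hy
      have := hr x hx y hy
      convert this using 1
      apply ext_entries <;> ext <;>
        simp [entry11, entry12, entry21, entry22, corner, star_eq_adjoint, adjoint_comp,
          adjoint_inK, adjoint_prH, prK_inK, prK_inH, prH_inK, prH_inH]
  obtain ⟨t1, t2, t3, t4⟩ := hT
  have hT : T = inK H K ∘L entry11 T ∘L prK H K + inH H K ∘L entry22 T ∘L prH H K +
      (corner (entry12 T) + star (corner (adjoint (entry21 T)))) := by
    apply ext_entries <;> ext <;>
      simp [entry11, entry12, entry21, entry22, corner, star_eq_adjoint, adjoint_comp,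
        adjoint_inK, adjoint_prH, adjoint_prK, adjoint_inH, prK_inK, prK_inH, prH_inK, prH_inH]
  rw [hT]
  exact add_mem (add_mem (h11 _ t1) (h22 _ t4)) (add_mem (h _ t2) (h' _ t3))

/-- The linking C*-algebra is generated by the corner `X`. -/
theorem TRO.linkingAlgebra_le {X : TRO H K}
    {N : NonUnitalStarSubalgebra ℂ (DirSum H K →L[ℂ] DirSum H K)}
    (hN : IsClosed (N : Set (DirSum H K →L[ℂ] DirSum H K)))
    (h : ∀ x ∈ X.toSubmodule, corner x ∈ N) : X.linkingAlgebra ≤ N := by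
  intro T hT
  have hs : ∀ x ∈ X.toSubmodule, star (corner x) ∈ N := fun x hx => star_mem (h x hx)
  have hl : ∀ x ∈ X.toSubmodule, ∀ y ∈ X.toSubmodule, corner x * star (corner y) ∈ N :=
    fun x hx y hy => mul_mem (h x hx) (hs y hy)
  have hr : ∀ x ∈ X.toSubmodule, ∀ y ∈ X.toSubmodule, star (corner x) * corner y ∈ N :=
    fun x hx y hy => mul_mem (hs x hx) (h y hy)
  exact TRO.mem_of_mem_linkingAlgebra (N := N.toSubmodule) hN h hs hl hr hT

/-- A closed *-subalgebra of an intermediate algebra that contains the corner `X` contains `A_X`. -/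
theorem TRO.mem_of_corner_mem {X : TRO H K}
    {R : NonUnitalStarSubalgebra ℂ (DirSum H K →L[ℂ] DirSum H K)}
    (hR : IsClosed (R : Set (DirSum H K →L[ℂ] DirSum H K))) (hX : X.linkingAlgebra ≤ R)
    {N : NonUnitalStarSubalgebra ℂ R} (hN : IsClosed (N : Set R))
    (h : ∀ x : X.toSubmodule, NonUnitalStarSubalgebra.inclusion hX (X.toLinkingAlgebra x) ∈ N)
    (a : X.linkingAlgebra) : NonUnitalStarSubalgebra.inclusion hX a ∈ N := by
  have hle : X.linkingAlgebra ≤ N.map (NonUnitalStarSubalgebraClass.subtype R) := by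
    refine TRO.linkingAlgebra_le ?_ fun x hx => ?_
    · exact hR.isClosedEmbedding_subtypeVal.isClosedMap _ hN
    · exact ⟨_, h ⟨x, hx⟩, rfl⟩
  obtain ⟨b, hb, hba⟩ := hle a.2
  have : b = NonUnitalStarSubalgebra.inclusion hX a := Subtype.ext hba
  exact this ▸ hb

/-- *-homomorphisms between C*-algebras are contractive, so uniqueness of the Hamana extension needs
no continuity hypothesis. -/
theorem NonUnitalStarAlgHom.continuous_of_isClosed {E F : Type*}
    [NormedAddCommGroup E] [InnerProductSpace ℂ E] [CompleteSpace E]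
    [NormedAddCommGroup F] [InnerProductSpace ℂ F] [CompleteSpace F]
    {R : NonUnitalStarSubalgebra ℂ (E →L[ℂ] E)} {S : NonUnitalStarSubalgebra ℂ (F →L[ℂ] F)}
    (hR : IsClosed (R : Set (E →L[ℂ] E))) (hS : IsClosed (S : Set (F →L[ℂ] F)))
    (φ : R →⋆ₙₐ[ℂ] S) : Continuous φ := by
  let _ : NonUnitalCStarAlgebra R := NonUnitalStarSubalgebra.nonUnitalCStarAlgebra R
  let _ : NonUnitalCStarAlgebra S := NonUnitalStarSubalgebra.nonUnitalCStarAlgebra S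
  exact AddMonoidHomClass.continuous_of_bound φ 1 fun a => by
    simpa using NonUnitalStarAlgHom.norm_apply_le φ a

end Generation

/-! ### Uniqueness of the normal extension and the Hamana extension. -/

section Uniqueness

variable {H₁ K₁ H₂ K₂ : Type*}
  [NormedAddCommGroup H₁] [InnerProductSpace ℂ H₁] [CompleteSpace H₁]
  [NormedAddCommGroup K₁] [InnerProductSpace ℂ K₁] [CompleteSpace K₁]
  [NormedAddCommGroup H₂] [InnerProductSpace ℂ H₂] [CompleteSpace H₂]
  [NormedAddCommGroup K₂] [InnerProductSpace ℂ K₂] [CompleteSpace K₂]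
  {X : WStarTRO H₁ K₁} {Y : WStarTRO H₂ K₂} {α : X.toSubmodule →ₗ[ℂ] Y.toSubmodule}

theorem WStarTRO.isClosed_linkingVN (X : WStarTRO H₁ K₁) :
    IsClosed (X.linkingVN : Set (DirSum H₁ K₁ →L[ℂ] DirSum H₁ K₁)) :=
  isClosed_doubleCommutant _

/-- *-homomorphisms out of `A_X` are determined by their values on the corner. -/
theorem TRO.hom_ext {F : Type*} [NormedAddCommGroup F] [InnerProductSpace ℂ F] [CompleteSpace F]
    {X : TRO H₁ K₁} {S : NonUnitalStarSubalgebra ℂ (F →L[ℂ] F)}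
    (hS : IsClosed (S : Set (F →L[ℂ] F))) {φ ψ : X.linkingAlgebra →⋆ₙₐ[ℂ] S}
    (h : ∀ x, φ (X.toLinkingAlgebra x) = ψ (X.toLinkingAlgebra x)) : φ = ψ := by
  ext1 a
  have := TRO.mem_of_corner_mem (X := X) X.isClosed_linkingAlgebra le_rfl
    (N := NonUnitalStarAlgHom.equalizer φ ψ) (isClosed_eq
      (NonUnitalStarAlgHom.continuous_of_isClosed X.isClosed_linkingAlgebra hS φ)
      (NonUnitalStarAlgHom.continuous_of_isClosed X.isClosed_linkingAlgebra hS ψ)) h a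
  exact this

/-- Normal *-homomorphisms out of `R_X` are determined by their values on the corner. -/
theorem IsNormalExtension.unique {β β' : X.linkingVN →⋆ₙₐ[ℂ] Y.linkingVN}
    (hβ : IsNormalExtension α β) (hβ' : IsNormalExtension α β') : β = β' := by
  have h1 : β.comp X.linkingInclusion = β'.comp X.linkingInclusion := by
    refine TRO.hom_ext Y.isClosed_linkingVN fun x => ?_
    exact (hβ.extends_map x).trans (hβ'.extends_map x).symm
  ext1 T
  have hc : ∀ {β : X.linkingVN →⋆ₙₐ[ℂ] Y.linkingVN}, IsNormalExtension α β →
      @Continuous _ _ (relWeakStar (X.linkingVN : Set (DirSum H₁ K₁ →L[ℂ] DirSum H₁ K₁)))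
        (weakStarTopology _ _) fun T => (β T).1 := fun h => continuous_induced_rng.1 h.normal
  refine Subtype.ext ?_
  exact doubleCommutant_induction X.linkingAlgebra (C := {T | (β T).1 = (β' T).1})
    (@isClosed_eq _ _ (weakStarTopology _ _) (relWeakStar _) t2Space_weakStar _ _ (hc hβ) (hc hβ'))
    (fun a ha => congrArg Subtype.val (DFunLike.congr_fun h1 ⟨a, ha⟩)) T

/-- A normal extension restricts to a Hamana extension. -/
theorem IsNormalExtension.exists_hamanaExtension {β : X.linkingVN →⋆ₙₐ[ℂ] Y.linkingVN}
    (hβ : IsNormalExtension α β) :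
    ∃ γ : X.linkingAlgebra →⋆ₙₐ[ℂ] Y.linkingAlgebra, IsHamanaExtension α γ := by
  let ι := (NonUnitalStarSubalgebraClass.subtype Y.linkingVN).comp β
  -- The preimage of `A_Y` under `β` is a norm-closed *-subalgebra of `R_X` containing the corner
  -- `X`, hence it contains `A_X`.
  have hmem : ∀ a : X.linkingAlgebra, ι (X.linkingInclusion a) ∈ Y.linkingAlgebra := by
    intro a
    refine TRO.mem_of_corner_mem (X := X.toTRO) X.isClosed_linkingVN (le_doubleCommutant _)
      (N := Y.linkingAlgebra.comap ι) ?_ (fun x => ?_) a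
    · exact Y.isClosed_linkingAlgebra.preimage (continuous_subtype_val.comp
        (NonUnitalStarAlgHom.continuous_of_isClosed X.isClosed_linkingVN Y.isClosed_linkingVN β))
    · change (β (X.toLinkingVN x)).1 ∈ Y.linkingAlgebra
      rw [hβ.extends_map]
      exact (Y.toLinkingAlgebra (α x)).2
  refine ⟨NonUnitalStarAlgHom.codRestrict (ι.comp X.linkingInclusion) _ hmem, fun x => ?_⟩
  apply Subtype.ext
  change (β (X.toLinkingVN x)).1 = _
  rw [hβ.extends_map]
  rfl

theorem IsHamanaExtension.unique {γ γ' : X.linkingAlgebra →⋆ₙₐ[ℂ] Y.linkingAlgebra}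
    (hγ : IsHamanaExtension α γ) (hγ' : IsHamanaExtension α γ') : γ = γ' :=
  TRO.hom_ext Y.isClosed_linkingAlgebra fun x => (hγ x).trans (hγ' x).symm

theorem IsNormalExtension.apply_linkingInclusion {β : X.linkingVN →⋆ₙₐ[ℂ] Y.linkingVN}
    (hβ : IsNormalExtension α β) {γ : X.linkingAlgebra →⋆ₙₐ[ℂ] Y.linkingAlgebra}
    (hγ : IsHamanaExtension α γ) (a : X.linkingAlgebra) :
    β (X.linkingInclusion a) = Y.linkingInclusion (γ a) := by
  have h1 : β.comp X.linkingInclusion = Y.linkingInclusion.comp γ := by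
    refine TRO.hom_ext Y.isClosed_linkingVN fun x => ?_
    exact (hβ.extends_map x).trans (congrArg Y.linkingInclusion (hγ x).symm)
  exact DFunLike.congr_fun h1 a

end Uniqueness

/-! ### Injectivity of `α` and of `β`. -/

section Injectivity

variable {H₁ K₁ H₂ K₂ : Type*}
  [NormedAddCommGroup H₁] [InnerProductSpace ℂ H₁] [CompleteSpace H₁]
  [NormedAddCommGroup K₁] [InnerProductSpace ℂ K₁] [CompleteSpace K₁]
  [NormedAddCommGroup H₂] [InnerProductSpace ℂ H₂] [CompleteSpace H₂]
  [NormedAddCommGroup K₂] [InnerProductSpace ℂ K₂] [CompleteSpace K₂]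
  {X : WStarTRO H₁ K₁} {Y : WStarTRO H₂ K₂} {α : X.toSubmodule →ₗ[ℂ] Y.toSubmodule}

theorem corner_injective : Function.Injective (corner (H := H₁) (K := K₁)) := by
  intro x y h
  have := congrArg entry12 h
  rwa [entry12_corner, entry12_corner] at this

/-- The *-algebra of all `a` with `T a = 0 = T a*`. -/
def starAnnihilator {E : Type*} [NormedAddCommGroup E] [InnerProductSpace ℂ E] [CompleteSpace E]
    (T : E →L[ℂ] E) : NonUnitalStarSubalgebra ℂ (E →L[ℂ] E) where
  carrier := {a | T * a = 0 ∧ T * star a = 0}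
  zero_mem' := by simp
  add_mem' := by
    rintro a b ⟨h1, h2⟩ ⟨g1, g2⟩
    exact ⟨by rw [mul_add, h1, g1, add_zero], by rw [star_add, mul_add, h2, g2, add_zero]⟩
  mul_mem' := by
    rintro a b ⟨h1, h2⟩ ⟨g1, g2⟩
    exact ⟨by rw [← mul_assoc, h1, zero_mul], by rw [star_mul, ← mul_assoc, g2, zero_mul]⟩
  smul_mem' := by
    rintro c a ⟨h1, h2⟩
    exact ⟨by rw [mul_smul_comm, h1, smul_zero],
      by rw [star_smul, mul_smul_comm, h2, smul_zero]⟩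
  star_mem' := by
    rintro a ⟨h1, h2⟩
    exact ⟨h2, by rwa [star_star]⟩

theorem isClosed_starAnnihilator {E : Type*} [NormedAddCommGroup E] [InnerProductSpace ℂ E]
    [CompleteSpace E] (T : E →L[ℂ] E) : IsClosed (starAnnihilator T : Set (E →L[ℂ] E)) :=
  (isClosed_eq (by fun_prop) continuous_const).inter (isClosed_eq (by fun_prop) continuous_const)

/-- An element of `R_X` that annihilates the corners `X` and `X*` is zero. -/
theorem WStarTRO.eq_zero_of_mul_corner_eq_zero {T : DirSum H₁ K₁ →L[ℂ] DirSum H₁ K₁}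
    (hT : T ∈ X.linkingVN) (h₁ : ∀ x ∈ X.toSubmodule, T * corner x = 0)
    (h₂ : ∀ x ∈ X.toSubmodule, T * star (corner x) = 0) : T = 0 := by
  refine eq_of_eqOn_of_eqOn_orthogonal
    {v | ∃ a ∈ X.linkingAlgebra, ∃ w, a w = v} ?_ (fun v hv => ?_)
  · rintro _ ⟨a, ha, w, rfl⟩
    have hle : X.linkingAlgebra ≤ starAnnihilator T := TRO.linkingAlgebra_le
      (isClosed_starAnnihilator T) fun x hx => ⟨h₁ x hx, h₂ x hx⟩
    exact congrArg (fun S : DirSum H₁ K₁ →L[ℂ] DirSum H₁ K₁ => S w) (hle ha).1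
  · rw [hT.2 v (mem_commonKer.2 fun a ha => ?_)]
    · rfl
    · refine ext_inner_left ℂ fun w => ?_
      rw [inner_zero_right, ← adjoint_inner_left]
      exact hv _ ⟨star a, star_mem ha, w, rfl⟩

/-- From `x x* x = 0` follows `(x* x)² = 0`, and the C*-identity, used for `x* x` and then in vector
form for `x`, gives `x = 0`. -/
theorem eq_zero_of_ternary_self_eq_zero {x : H₁ →L[ℂ] K₁} (h : x ∘L adjoint x ∘L x = 0) :
    x = 0 := by
  have h1 : star (adjoint x ∘L x) * (adjoint x ∘L x) = 0 := by
    rw [star_eq_adjoint, adjoint_comp, adjoint_adjoint]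
    change (adjoint x ∘L x) ∘L (adjoint x ∘L x) = 0
    rw [comp_assoc, h, comp_zero]
  have h2 := (CStarRing.star_mul_self_eq_zero_iff _).1 h1
  ext v
  have := congrArg (fun S : H₁ →L[ℂ] H₁ => inner ℂ v (S v)) h2
  simpa [adjoint_inner_right] using this

/-- The kernel of `β` is an ideal, and it meets the corner only in `0` because `α` is injective.
Multiplying a kernel element by corners first removes its lower left entry and then shows that it
annihilates all corners and their adjoints. -/
theorem IsNormalExtension.injective_of_injective {β : X.linkingVN →⋆ₙₐ[ℂ] Y.linkingVN}
    (hβ : IsNormalExtension α β) (hα : Function.Injective α) : Function.Injective β := by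
  have hcorner : ∀ {S : X.linkingVN} (x : X.toSubmodule), β S = 0 → S.1 = corner x.1 → x = 0 := by
    intro S x hS hx
    have h1 : S = X.toLinkingVN x := Subtype.ext hx
    rw [h1, hβ.extends_map] at hS
    apply hα
    rw [map_zero]
    exact Subtype.ext (corner_injective ((congrArg Subtype.val hS).trans corner_zero.symm))
  have h21 : ∀ T : X.linkingVN, β T = 0 → entry21 T.1 = 0 := by
    intro T hT
    -- With `x` the adjoint of the lower left entry of `T`, the product `x T x` of corners is the
    -- corner `x x* x`, which lies in the kernel.
    set x : X.toSubmodule := ⟨adjoint (entry21 T.1), WStarTRO.adjoint_entry21_mem T.2⟩ with hx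
    have h1 : β (X.toLinkingVN x * T * X.toLinkingVN x) = 0 := by
      rw [map_mul, map_mul, hT, mul_zero, zero_mul]
    have h2 := hcorner (X.ternary x x x) h1 (by
      change corner x.1 * T.1 * corner x.1 = corner (x.1 ∘L adjoint x.1 ∘L x.1)
      apply ext_entries <;> simp [hx, entry11_mul, entry12_mul, entry21_mul, entry22_mul,
        entry11_corner, entry12_corner, entry21_corner, entry22_corner, comp_assoc])
    have h3 : x.1 ∘L adjoint x.1 ∘L x.1 = 0 := congrArg Subtype.val h2
    have h6 : x.1 = 0 := eq_zero_of_ternary_self_eq_zero h3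
    have h7 := congrArg adjoint h6
    rwa [hx, adjoint_adjoint, map_zero] at h7
  have hmulcorner : ∀ T : X.linkingVN, β T = 0 → ∀ x ∈ X.toSubmodule, T.1 * corner x = 0 := by
    intro T hT x hx
    have h1 : β (T * X.toLinkingVN ⟨x, hx⟩) = 0 := by rw [map_mul, hT, zero_mul]
    have h2 : T.1 * corner x = corner (entry11 T.1 ∘L x) := by
      apply ext_entries <;> simp [entry11_mul, entry12_mul, entry21_mul, entry22_mul,
        entry11_corner, entry12_corner, entry21_corner, entry22_corner, h21 T hT]
    have h3 := hcorner ⟨entry11 T.1 ∘L x, WStarTRO.entry11_comp_mem T.2 hx⟩ h1 h2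
    rw [h2, show entry11 T.1 ∘L x = 0 from congrArg Subtype.val h3, corner_zero]
  have hcornermul : ∀ T : X.linkingVN, β T = 0 → ∀ x ∈ X.toSubmodule, corner x * T.1 = 0 := by
    intro T hT x hx
    have h1 : β (X.toLinkingVN ⟨x, hx⟩ * T) = 0 := by rw [map_mul, hT, mul_zero]
    have h2 : corner x * T.1 = corner (x ∘L entry22 T.1) := by
      apply ext_entries <;> simp [entry11_mul, entry12_mul, entry21_mul, entry22_mul,
        entry11_corner, entry12_corner, entry21_corner, entry22_corner, h21 T hT]
    have h3 := hcorner ⟨x ∘L entry22 T.1, WStarTRO.comp_entry22_mem T.2 hx⟩ h1 h2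
    rw [h2, show x ∘L entry22 T.1 = 0 from congrArg Subtype.val h3, corner_zero]
  refine (injective_iff_map_eq_zero β).2 fun T hT => Subtype.ext ?_
  refine WStarTRO.eq_zero_of_mul_corner_eq_zero T.2 (hmulcorner T hT) fun x hx => ?_
  -- Right multiplication of `T` by `x*` is the adjoint of left multiplication of `T*` by `x`, and
  -- `T*` is in the kernel too.
  have h1 : β (star T) = 0 := by rw [map_star, hT, star_zero]
  have h2 := congrArg star (hcornermul (star T) h1 x hx)
  rw [star_mul, star_zero] at h2
  exact (congrArg (· * star (corner x)) (star_star T.1).symm).trans h2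

theorem IsNormalExtension.injective_iff {β : X.linkingVN →⋆ₙₐ[ℂ] Y.linkingVN}
    (hβ : IsNormalExtension α β) : Function.Injective α ↔ Function.Injective β := by
  refine ⟨hβ.injective_of_injective, fun h x y hxy => ?_⟩
  have h1 : X.toLinkingVN x = X.toLinkingVN y := h (by rw [hβ.extends_map, hβ.extends_map, hxy])
  exact Subtype.ext (corner_injective (congrArg Subtype.val h1))

end Injectivity

/-! ### The unit of a possibly degenerate von Neumann algebra. -/

section Unit

variable {E : Type*} [NormedAddCommGroup E] [InnerProductSpace ℂ E] [CompleteSpace E]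

/-- The von Neumann algebra generated by a *-algebra has a unit. -/
theorem exists_unit_doubleCommutant (A : NonUnitalStarSubalgebra ℂ (E →L[ℂ] E)) :
    ∃ e : doubleCommutant A, ∀ a, e * a = a ∧ a * e = a := by
  set P := (commonKer (A : Set (E →L[ℂ] E))).starProjection with hP
  have hPsa : star P = P := (isSelfAdjoint_starProjection _).star_eq
  have hinv : ∀ c ∈ Set.centralizer (A : Set (E →L[ℂ] E)), P * (c * P) = c * P := by
    intro c hc
    ext v
    refine Submodule.starProjection_eq_self_iff.2 (mem_commonKer.2 fun a ha => ?_)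
    have h1 := congrArg (fun S : E →L[ℂ] E => S (P v)) (hc a ha)
    have h2 : a (P v) = 0 := mem_commonKer.1 (Submodule.starProjection_apply_mem _ v) a ha
    simp only [mul_apply_eq_comp, h2, map_zero] at h1
    exact h1
  have hcomm : ∀ c ∈ Set.centralizer (A : Set (E →L[ℂ] E)), c * P = P * c := by
    intro c hc
    have h1 := hinv (star c) (Set.star_mem_centralizer' (fun a ha => star_mem ha) hc)
    have h2 := congrArg star h1
    simp only [star_mul, star_star, hPsa] at h2
    rw [← hinv c hc, ← mul_assoc, h2]
  have he : 1 - P ∈ doubleCommutant A := by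
    refine ⟨fun c hc => ?_, fun v hv => ?_⟩
    · rw [mul_sub, sub_mul, hcomm c hc, mul_one, one_mul]
    · rw [sub_apply, Submodule.starProjection_eq_self_iff.2 hv]
      exact sub_self v
  have hmul : ∀ a ∈ doubleCommutant A, a * P = 0 := by
    intro a ha
    ext v
    exact ha.2 _ (Submodule.starProjection_apply_mem _ v)
  refine ⟨⟨1 - P, he⟩, fun a => ⟨Subtype.ext ?_, Subtype.ext ?_⟩⟩
  · change (1 - P) * a.1 = a.1
    have h1 := congrArg star (hmul (star a.1) (star_mem a.2))
    rw [star_mul, star_star, hPsa, star_zero] at h1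
    rw [sub_mul, h1, one_mul, sub_zero]
  · change a.1 * (1 - P) = a.1
    rw [mul_sub, hmul a.1 a.2, mul_one, sub_zero]

end Unit

/-! ### Non-degeneracy of `α` and unitality of `β`. -/

section Nondegenerate

variable {H₁ K₁ H₂ K₂ : Type*}
  [NormedAddCommGroup H₁] [InnerProductSpace ℂ H₁] [CompleteSpace H₁]
  [NormedAddCommGroup K₁] [InnerProductSpace ℂ K₁] [CompleteSpace K₁]
  [NormedAddCommGroup H₂] [InnerProductSpace ℂ H₂] [CompleteSpace H₂]
  [NormedAddCommGroup K₂] [InnerProductSpace ℂ K₂] [CompleteSpace K₂]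
  {X : WStarTRO H₁ K₁} {Y : WStarTRO H₂ K₂} {α : X.toSubmodule →ₗ[ℂ] Y.toSubmodule}

theorem corner_ternary (x y z : H₁ →L[ℂ] K₁) :
    corner (x ∘L adjoint y ∘L z) = corner x * star (corner y) * corner z := by
  apply ext_entries <;> simp [entry11_mul, entry12_mul, entry21_mul, entry22_mul,
    entry11_corner, entry12_corner, entry21_corner, entry22_corner, entry11_star_corner,
    entry12_star_corner, entry21_star_corner, entry22_star_corner, comp_assoc]

theorem closure_weakStar_subset {S C : Set (H₁ →L[ℂ] K₁)} (hC : IsClosed[weakStarTopology H₁ K₁] C)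
    (h : S ⊆ C) : closure[weakStarTopology H₁ K₁] S ⊆ C :=
  @closure_minimal _ (weakStarTopology H₁ K₁) _ _ h hC

theorem subset_closure_weakStar (S : Set (H₁ →L[ℂ] K₁)) :
    closure S ⊆ closure[weakStarTopology H₁ K₁] S :=
  closure_minimal (@subset_closure _ (weakStarTopology H₁ K₁) S)
    (IsClosed.of_weakStar (@isClosed_closure _ (weakStarTopology H₁ K₁) S))

theorem isClosed_weakStar_eqLocus {H K H' K' : Type*}
    [NormedAddCommGroup H] [InnerProductSpace ℂ H] [CompleteSpace H]
    [NormedAddCommGroup K] [InnerProductSpace ℂ K] [CompleteSpace K]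
    [NormedAddCommGroup H'] [InnerProductSpace ℂ H'] [CompleteSpace H']
    [NormedAddCommGroup K'] [InnerProductSpace ℂ K'] [CompleteSpace K']
    {f g : (H →L[ℂ] K) → (H' →L[ℂ] K')}
    (hf : @Continuous _ _ (weakStarTopology _ _) (weakStarTopology _ _) f)
    (hg : @Continuous _ _ (weakStarTopology _ _) (weakStarTopology _ _) g) :
    IsClosed[weakStarTopology H K] {T | f T = g T} :=
  @isClosed_eq _ _ (weakStarTopology _ _) (weakStarTopology _ _) t2Space_weakStar _ _ hf hg

/-- The projection `p = β(e)` fixes `α(X)` and `α(X)*` from the left, hence the weak* closed spans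
of `α(X)Y*Y` and `α(X)*YY*`, which are `Y` and `Y*`. Then `b - bp` annihilates all corners and their
adjoints, so it is zero. -/
theorem IsNormalExtension.isUnitalMap_of_isNondegenerate
    {β : X.linkingVN →⋆ₙₐ[ℂ] Y.linkingVN} (hβ : IsNormalExtension α β) (hα : IsNondegenerate α) :
    IsUnitalMap β := by
  obtain ⟨e, he⟩ : ∃ e : X.linkingVN, ∀ a, e * a = a ∧ a * e = a :=
    exists_unit_doubleCommutant X.linkingAlgebra
  have hse : star e = e := by
    have h1 := (he (star e)).2
    have h2 := congrArg star h1
    rw [star_mul, star_star] at h2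
    exact h1.symm.trans h2
  set p := β e with hp
  have hsp : star p = p := by rw [hp, ← map_star, hse]
  have hpx : ∀ x : X.toSubmodule, p.1 * corner (α x).1 = corner (α x).1 := by
    intro x
    have h1 : p * β (X.toLinkingVN x) = β (X.toLinkingVN x) := by rw [hp, ← map_mul, (he _).1]
    rw [hβ.extends_map] at h1
    exact congrArg Subtype.val h1
  have hpx' : ∀ x : X.toSubmodule, p.1 * star (corner (α x).1) = star (corner (α x).1) := by
    intro x
    have h1 : p * β (star (X.toLinkingVN x)) = β (star (X.toLinkingVN x)) := by
      rw [hp, ← map_mul, (he _).1]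
    rw [map_star, hβ.extends_map] at h1
    exact congrArg Subtype.val h1
  have hY : ∀ y ∈ Y.toSubmodule, p.1 * corner y = corner y := by
    let D : Submodule ℂ (H₂ →L[ℂ] K₂) :=
      { carrier := {T | p.1 * corner T = corner T}
        zero_mem' := by simp [corner_zero]
        add_mem' := fun {a b} ha hb => by
          change p.1 * corner (a + b) = corner (a + b)
          rw [corner_add, mul_add, ha, hb]
        smul_mem' := fun c a ha => by
          change p.1 * corner (c • a) = corner (c • a)
          rw [corner_smul, mul_smul_comm, ha] }
    intro y hy
    have hy' : y ∈ (Y.toSubmodule : Set (H₂ →L[ℂ] K₂)) := hy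
    rw [← hα.1] at hy'
    refine closure_weakStar_subset (C := D) ?_ (Submodule.span_le.2 ?_) hy'
    · exact isClosed_weakStar_eqLocus
        (@Continuous.comp _ _ _ (weakStarTopology _ _) (weakStarTopology _ _)
          (weakStarTopology _ _) corner _ (continuous_weakStar_comp_left p.1)
          continuous_weakStar_corner) continuous_weakStar_corner
    · rintro _ ⟨x, y, z, rfl⟩
      change p.1 * corner _ = corner _
      rw [corner_ternary, ← mul_assoc, ← mul_assoc, hpx]
  have hY' : ∀ y ∈ Y.toSubmodule, p.1 * star (corner y) = star (corner y) := by
    let D : Submodule ℂ (K₂ →L[ℂ] H₂) :=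
      { carrier := {T | p.1 * star (corner (adjoint T)) = star (corner (adjoint T))}
        zero_mem' := by simp [corner_zero]
        add_mem' := fun {a b} ha hb => by
          change p.1 * star (corner (adjoint (a + b))) = star (corner (adjoint (a + b)))
          rw [map_add, corner_add, star_add, mul_add, ha, hb]
        smul_mem' := fun c a ha => by
          change p.1 * star (corner (adjoint (c • a))) = star (corner (adjoint (c • a)))
          rw [map_smulₛₗ, corner_smul, star_smul, mul_smul_comm, ha] }
    intro y hy
    have hy' : adjoint y ∈ {T : K₂ →L[ℂ] H₂ | ∃ y : Y.toSubmodule, T = adjoint y.1} :=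
      ⟨⟨y, hy⟩, rfl⟩
    rw [← hα.2] at hy'
    have h1 := closure_weakStar_subset (C := D) ?_ (Submodule.span_le.2 ?_) hy'
    · change p.1 * star (corner (adjoint (adjoint y))) = star (corner (adjoint (adjoint y))) at h1
      rwa [adjoint_adjoint] at h1
    · have hc : @Continuous _ _ (weakStarTopology K₂ H₂) (weakStarTopology _ _)
          fun T : K₂ →L[ℂ] H₂ => star (corner (adjoint T)) :=
        @Continuous.comp _ _ _ (weakStarTopology _ _) (weakStarTopology _ _)
          (weakStarTopology _ _) _ _ continuous_weakStar_adjoint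
          (@Continuous.comp _ _ _ (weakStarTopology _ _) (weakStarTopology _ _)
          (weakStarTopology _ _) (fun T => adjoint T) corner continuous_weakStar_corner
            continuous_weakStar_adjoint)
      exact isClosed_weakStar_eqLocus
        (@Continuous.comp _ _ _ (weakStarTopology _ _) (weakStarTopology _ _)
          (weakStarTopology _ _) _ _ (continuous_weakStar_comp_left p.1) hc) hc
    · rintro _ ⟨x, y, z, rfl⟩
      change p.1 * star (corner _) = star (corner _)
      have h2 : adjoint (adjoint (α x).1 ∘L y.1 ∘L adjoint z.1) =
          z.1 ∘L adjoint y.1 ∘L (α x).1 := by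
        rw [adjoint_comp, adjoint_comp, adjoint_adjoint, adjoint_adjoint, comp_assoc]
      rw [h2, corner_ternary, star_mul, ← mul_assoc, hpx']
  have hright : ∀ b : Y.linkingVN, b * p = b := by
    intro b
    have h1 : (b - b * p).1 = 0 := by
      refine WStarTRO.eq_zero_of_mul_corner_eq_zero (b - b * p).2 (fun y hy => ?_)
        fun y hy => ?_
      · change (b.1 - b.1 * p.1) * corner y = 0
        rw [sub_mul, mul_assoc, hY y hy, sub_self]
      · change (b.1 - b.1 * p.1) * star (corner y) = 0
        rw [sub_mul, mul_assoc, hY' y hy, sub_self]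
    exact (sub_eq_zero.1 (Subtype.ext h1 : b - b * p = 0)).symm
  refine ⟨e, he, fun b => ⟨?_, hright b⟩⟩
  have h1 := congrArg star (hright (star b))
  rwa [star_mul, star_star, hsp] at h1

/-- A weak*-closed condition on `R_X` that is linear, norm-closed and valid on corners and their
products holds on `R_X`. -/
theorem WStarTRO.mem_of_mem_generators (V : Submodule ℂ X.linkingVN)
    (hV : IsClosed (V : Set X.linkingVN))
    (h : ∀ x, X.toLinkingVN x ∈ V) (h' : ∀ x, star (X.toLinkingVN x) ∈ V)
    (hl : ∀ x y, X.toLinkingVN x * star (X.toLinkingVN y) ∈ V)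
    (hr : ∀ x y, star (X.toLinkingVN x) * X.toLinkingVN y ∈ V)
    (a : X.linkingAlgebra) : X.linkingInclusion a ∈ V := by
  let N : Submodule ℂ (DirSum H₁ K₁ →L[ℂ] DirSum H₁ K₁) :=
    V.map (X.linkingVN.toSubmodule.subtype)
  have hN : IsClosed (N : Set (DirSum H₁ K₁ →L[ℂ] DirSum H₁ K₁)) :=
    X.isClosed_linkingVN.isClosedEmbedding_subtypeVal.isClosedMap _ hV
  obtain ⟨b, hb, hba⟩ := TRO.mem_of_mem_linkingAlgebra (X := X.toTRO) (N := N) hN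
    (fun x hx => ⟨_, h ⟨x, hx⟩, rfl⟩) (fun x hx => ⟨_, h' ⟨x, hx⟩, rfl⟩)
    (fun x hx y hy => ⟨_, hl ⟨x, hx⟩ ⟨y, hy⟩, rfl⟩)
    (fun x hx y hy => ⟨_, hr ⟨x, hx⟩ ⟨y, hy⟩, rfl⟩) a.2
  have : b = X.linkingInclusion a := Subtype.ext hba
  exact this ▸ hb

/-- Locates compressions of `β(T)` in a weak* closure by testing corners, their adjoints and the two
kinds of products: norm continuity reaches `A_X`, and normality with weak* density reaches `R_X`. -/
theorem IsNormalExtension.apply_mem_closure {β : X.linkingVN →⋆ₙₐ[ℂ] Y.linkingVN}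
    (hβ : IsNormalExtension α β) {H K : Type*}
    [NormedAddCommGroup H] [InnerProductSpace ℂ H] [CompleteSpace H]
    [NormedAddCommGroup K] [InnerProductSpace ℂ K] [CompleteSpace K]
    (A : DirSum H₂ K₂ →L[ℂ] K) (B : H →L[ℂ] DirSum H₂ K₂) (W : Submodule ℂ (H →L[ℂ] K))
    (h : ∀ x, A ∘L corner (α x).1 ∘L B ∈ W) (h' : ∀ x, A ∘L star (corner (α x).1) ∘L B ∈ W)
    (hl : ∀ x y, A ∘L (corner (α x).1 * star (corner (α y).1)) ∘L B ∈ W)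
    (hr : ∀ x y, A ∘L (star (corner (α x).1) * corner (α y).1) ∘L B ∈ W) (T : X.linkingVN) :
    A ∘L (β T).1 ∘L B ∈ closure[weakStarTopology H K] (W : Set (H →L[ℂ] K)) := by
  have hval : @Continuous _ _ (relWeakStar (X.linkingVN : Set (DirSum H₁ K₁ →L[ℂ] DirSum H₁ K₁)))
      (weakStarTopology _ _) fun T => (β T).1 := continuous_induced_rng.1 hβ.normal
  refine doubleCommutant_induction X.linkingAlgebra
    (C := {T | A ∘L (β T).1 ∘L B ∈ closure[weakStarTopology H K] (W : Set (H →L[ℂ] K))})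
    ?_ (fun a ha => ?_) T
  · exact @IsClosed.preimage _ _ (relWeakStar _) (weakStarTopology _ _) _
      (@Continuous.comp _ _ _ (relWeakStar _) (weakStarTopology _ _)
        (weakStarTopology _ _) _ _ (continuous_weakStar_comp_comp A B) hval) _
      (@isClosed_closure _ (weakStarTopology H K) _)
  · let L : X.linkingVN →ₗ[ℂ] (H →L[ℂ] K) :=
      { toFun := fun T => A ∘L (β T).1 ∘L B
        map_add' := fun S T => by
          rw [map_add]
          change A ∘L ((β S).1 + (β T).1) ∘L B = _
          rw [add_comp, comp_add]
        map_smul' := fun c T => by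
          rw [map_smul]
          change A ∘L (c • (β T).1) ∘L B = _
          rw [smul_comp, comp_smul]; rfl }
    have hL : Continuous L := by
      have h1 := continuous_subtype_val.comp
        (NonUnitalStarAlgHom.continuous_of_isClosed X.isClosed_linkingVN Y.isClosed_linkingVN β)
      exact (by fun_prop : Continuous fun S : DirSum H₂ K₂ →L[ℂ] DirSum H₂ K₂ =>
        A ∘L S ∘L B).comp h1
    have hle := W.le_topologicalClosure
    refine subset_closure_weakStar _ ?_
    refine WStarTRO.mem_of_mem_generators (W.topologicalClosure.comap L)
      ((Submodule.isClosed_topologicalClosure W).preimage hL) (fun x => hle ?_) (fun x => hle ?_)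
      (fun x y => hle ?_) (fun x y => hle ?_) ⟨a, ha⟩
    · change A ∘L (β _).1 ∘L B ∈ W
      rw [hβ.extends_map]
      exact h x
    · change A ∘L (β _).1 ∘L B ∈ W
      rw [map_star, hβ.extends_map]
      exact h' x
    · change A ∘L (β _).1 ∘L B ∈ W
      rw [map_mul, map_star, hβ.extends_map, hβ.extends_map]
      exact hl x y
    · change A ∘L (β _).1 ∘L B ∈ W
      rw [map_mul, map_star, hβ.extends_map, hβ.extends_map]
      exact hr x y

/-- Since `β(e)` is a unit, `y = β(e)₁₁ y`, and `β(e)₁₁` is a weak* limit of elements of the span of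
`α(X)α(X)*`; hence `y` is a limit from `α(X)Y*Y`. The lower right entry treats `Y*` in the same way.
-/
theorem IsNormalExtension.isNondegenerate_of_isUnitalMap
    {β : X.linkingVN →⋆ₙₐ[ℂ] Y.linkingVN} (hβ : IsNormalExtension α β) (hu : IsUnitalMap β) :
    IsNondegenerate α := by
  obtain ⟨e, -, he⟩ := hu
  constructor
  · refine Set.Subset.antisymm ?_ fun y hy => ?_
    · refine closure_weakStar_subset Y.isWeakStarClosed' (Submodule.span_le.2 ?_)
      rintro _ ⟨x, y, z, rfl⟩
      exact Y.ternary_mem' (α x).2 y.2 z.2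
    · have h1 : (β e).1 * corner y = corner y :=
        congrArg Subtype.val (he (Y.toLinkingVN ⟨y, hy⟩)).1
      have h2 : prK H₂ K₂ ∘L (β e).1 ∘L (inK H₂ K₂ ∘L y) = y := by
        have h3 : entry11 (β e).1 ∘L y = y := by
          have := congrArg entry12 h1
          simpa [entry12_mul, entry12_corner, entry22_corner] using this
        exact h3
      rw [← h2]
      have hz : ∀ {T : DirSum H₂ K₂ →L[ℂ] DirSum H₂ K₂} {a : K₂ →L[ℂ] K₂}, entry11 T = a →
          prK H₂ K₂ ∘L T ∘L (inK H₂ K₂ ∘L y) = a ∘L y := by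
        rintro T _ rfl; rfl
      refine hβ.apply_mem_closure _ _ _ (fun x => ?_) (fun x => ?_) (fun x x' => ?_)
        (fun x x' => ?_) e
      · rw [hz (entry11_corner _), zero_comp]; exact zero_mem _
      · rw [hz (entry11_star_corner _), zero_comp]; exact zero_mem _
      -- Only the product `α(x)α(x')*` has a nonzero upper left entry; as `α(x') ∈ Y`, it gives an
      -- element of `α(X)Y*Y` when applied to `y`.
      · refine Submodule.subset_span ⟨x, α x', ⟨y, hy⟩, ?_⟩
        rw [hz (a := (α x).1 ∘L adjoint (α x').1), comp_assoc]
        simp [entry11_mul, entry11_corner, entry12_corner, entry21_star_corner]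
      · rw [hz (a := 0), zero_comp]
        · exact zero_mem _
        · simp [entry11_mul, entry11_corner, entry11_star_corner, entry12_star_corner]
  · refine Set.Subset.antisymm ?_ ?_
    · have hset : {T : K₂ →L[ℂ] H₂ | ∃ y : Y.toSubmodule, T = adjoint y.1} =
          (fun T : K₂ →L[ℂ] H₂ => adjoint T) ⁻¹' (Y.toSubmodule : Set (H₂ →L[ℂ] K₂)) := by
        ext T
        constructor
        · rintro ⟨y, rfl⟩
          change adjoint (adjoint y.1) ∈ Y.toSubmodule
          rw [adjoint_adjoint]
          exact y.2
        · intro hT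
          exact ⟨⟨adjoint T, hT⟩, (adjoint_adjoint T).symm⟩
      rw [hset]
      let D : Submodule ℂ (K₂ →L[ℂ] H₂) :=
        { carrier := (fun T : K₂ →L[ℂ] H₂ => adjoint T) ⁻¹' (Y.toSubmodule : Set (H₂ →L[ℂ] K₂))
          zero_mem' := by simp
          add_mem' := fun {a b} ha hb => by
            change adjoint (a + b) ∈ Y.toSubmodule
            rw [map_add]; exact add_mem ha hb
          smul_mem' := fun c a ha => by
            change adjoint (c • a) ∈ Y.toSubmodule
            rw [map_smulₛₗ]; exact Submodule.smul_mem _ _ ha }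
      refine closure_weakStar_subset (C := (D : Set (K₂ →L[ℂ] H₂))) (@IsClosed.preimage _ _ (weakStarTopology _ _)
        (weakStarTopology _ _) _ continuous_weakStar_adjoint _ Y.isWeakStarClosed')
        (Submodule.span_le.2 ?_)
      rintro _ ⟨x, y, z, rfl⟩
      change adjoint _ ∈ Y.toSubmodule
      rw [adjoint_comp, adjoint_comp, adjoint_adjoint, adjoint_adjoint, comp_assoc]
      exact Y.ternary_mem' z.2 y.2 (α x).2
    · rintro _ ⟨y, rfl⟩
      have h1 : (β e).1 * star (corner y.1) = star (corner y.1) :=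
        congrArg Subtype.val (he (star (Y.toLinkingVN y))).1
      have h2 : prH H₂ K₂ ∘L (β e).1 ∘L (inH H₂ K₂ ∘L adjoint y.1) = adjoint y.1 := by
        have h3 : entry22 (β e).1 ∘L adjoint y.1 = adjoint y.1 := by
          have := congrArg entry21 h1
          simpa [entry21_mul, entry11_star_corner, entry21_star_corner] using this
        exact h3
      rw [← h2]
      have hz : ∀ {T : DirSum H₂ K₂ →L[ℂ] DirSum H₂ K₂} {a : H₂ →L[ℂ] H₂}, entry22 T = a →
          prH H₂ K₂ ∘L T ∘L (inH H₂ K₂ ∘L adjoint y.1) = a ∘L adjoint y.1 := by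
        rintro T _ rfl; rfl
      refine hβ.apply_mem_closure _ _ _ (fun x => ?_) (fun x => ?_) (fun x x' => ?_)
        (fun x x' => ?_) e
      · rw [hz (entry22_corner _), zero_comp]; exact zero_mem _
      · rw [hz (entry22_star_corner _), zero_comp]; exact zero_mem _
      · rw [hz (a := 0), zero_comp]
        · exact zero_mem _
        · simp [entry22_mul, entry22_corner, entry22_star_corner, entry21_corner]
      · refine Submodule.subset_span ⟨x, α x', y, ?_⟩
        rw [hz (a := adjoint (α x).1 ∘L (α x').1), comp_assoc]
        simp [entry22_mul, entry22_corner, entry12_corner, entry21_star_corner]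

end Nondegenerate

end

/-! ### Assembly of the proposition. -/

theorem mainTheorem7 {H₁ K₁ H₂ K₂ : Type*}
    [NormedAddCommGroup H₁] [InnerProductSpace ℂ H₁] [CompleteSpace H₁]
    [NormedAddCommGroup K₁] [InnerProductSpace ℂ K₁] [CompleteSpace K₁]
    [NormedAddCommGroup H₂] [InnerProductSpace ℂ H₂] [CompleteSpace H₂]
    [NormedAddCommGroup K₂] [InnerProductSpace ℂ K₂] [CompleteSpace K₂]
    (X : WStarTRO H₁ K₁) (Y : WStarTRO H₂ K₂)
    (α : X.toSubmodule →ₗ[ℂ] Y.toSubmodule) (hα : IsNormalTROMorphism α) :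
    (∃! β : X.linkingVN →⋆ₙₐ[ℂ] Y.linkingVN, IsNormalExtension α β) ∧
    ∀ β : X.linkingVN →⋆ₙₐ[ℂ] Y.linkingVN, IsNormalExtension α β →
      -- the restriction of `β` to `A_X` is the Hamana extension of `α`
      (∃! γ : X.linkingAlgebra →⋆ₙₐ[ℂ] Y.linkingAlgebra, IsHamanaExtension α γ) ∧
      (∀ γ : X.linkingAlgebra →⋆ₙₐ[ℂ] Y.linkingAlgebra, IsHamanaExtension α γ →
        ∀ a : X.linkingAlgebra, β (X.linkingInclusion a) = Y.linkingInclusion (γ a)) ∧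
      -- the extension of a composition is the composition of the extensions
      (∀ {H₃ K₃ : Type*}
        [NormedAddCommGroup H₃] [InnerProductSpace ℂ H₃] [CompleteSpace H₃]
        [NormedAddCommGroup K₃] [InnerProductSpace ℂ K₃] [CompleteSpace K₃]
        (Z : WStarTRO H₃ K₃) (α' : Y.toSubmodule →ₗ[ℂ] Z.toSubmodule)
        (β' : Y.linkingVN →⋆ₙₐ[ℂ] Z.linkingVN),
        IsNormalTROMorphism α' → IsNormalExtension α' β' →
        ∀ β'' : X.linkingVN →⋆ₙₐ[ℂ] Z.linkingVN,
          IsNormalExtension (α' ∘ₗ α) β'' ↔ β'' = β'.comp β) ∧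
      (Function.Injective α ↔ Function.Injective β) ∧
      (IsNondegenerate α ↔ IsUnitalMap β) := by
  obtain ⟨β₀, hβ₀⟩ := hα.exists_normalExtension
  refine ⟨⟨β₀, hβ₀, fun β hβ => hβ.unique hβ₀⟩, fun β hβ => ⟨?_, ?_, ?_, hβ.injective_iff, ?_⟩⟩
  · obtain ⟨γ, hγ⟩ := hβ.exists_hamanaExtension
    exact ⟨γ, hγ, fun γ' hγ' => hγ'.unique hγ⟩
  · exact fun γ hγ a => hβ.apply_linkingInclusion hγ a
  · intro H₃ K₃ _ _ _ _ _ _ Z α' β' _ hβ' β''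
    have hcomp : IsNormalExtension (α' ∘ₗ α) (β'.comp β) :=
      ⟨@Continuous.comp _ _ _ 
        (relWeakStar (X.linkingVN : Set (DirSum H₁ K₁ →L[ℂ] DirSum H₁ K₁)))
        (relWeakStar (Y.linkingVN : Set (DirSum H₂ K₂ →L[ℂ] DirSum H₂ K₂)))
        (relWeakStar (Z.linkingVN : Set (DirSum H₃ K₃ →L[ℂ] DirSum H₃ K₃)))
        β β' hβ'.normal hβ.normal, fun x => by
          rw [NonUnitalStarAlgHom.comp_apply, hβ.extends_map, hβ'.extends_map]
          rfl⟩
    exact ⟨fun h => h.unique hcomp, fun h => h ▸ hcomp⟩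
  · exact ⟨hβ.isUnitalMap_of_isNondegenerate, hβ.isNondegenerate_of_isUnitalMap⟩
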